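/- Let $M\subset\mathbb R^3$ be an embedded $C^2$ surface and let $S\subset M$ be a bounded Lipschitz region of $M$: $S$ is relatively open in $M$, bounded, $\overline S\subset M$, and near each point of $\overline S\setminus S$ the set $S$ is, in a $C^2$ chart of $M$, the region above the graph of a Lipschitz function. Let $n$ be a continuous unit field on $S$ normal to $M$, and for $h>0$ put $$S_h=\{\,x+t\,n(x)\;:\;x\in S,\ |t|<h\,\}\subset\mathbb R^3 .$$ Fix a target dimension $m$ ($m=1$: scalar functions; $m=3$: displacements). Then there are constants $C>0$ and $h_0>0$, depending only on $S$ (and on the fixed number $m$), such that for every $0<h<h_0$, every $u\in H^1(S_h,\mathbb R^m)$ and every $\lambda>0$ there exists $v\in W^{1,\infty}(S_h,\mathbb R^m)$ satisfying all of: (i) $\|\nabla v\|_{L^\infty(S_h)}\le C\lambda$; (ii) $\displaystyle |\{x\in S_h: u(x)\neq v(x)\}|\le \frac C\lambda\int_{\{x\in S_h:\,|\nabla u(x)|>\lambda\}}|\nabla u|\,dx$; (iii) $\displaystyle \int_{S_h}|\nabla u-\nabla v|^2dx\le C\int_{\{x\in S_h:\,|\nabla u(x)|>\lambda\}}|\nabla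 u|^2dx$. Here $\nabla$ is the weak gradient, $|\cdot|$ of a matrix is its Euclidean (Frobenius) norm, and $|\cdot|$ of a set is Lebesgue measure. In particular $C$ does not depend on $h$, $u$ or $\lambda$. -/

import Mathlib

open MeasureTheory Set
open scoped ENNReal NNReal ContDiff

namespace Shell

/-- Euclidean three-space. -/
abbrev E3 : Type := EuclideanSpace ℝ (Fin 3)

/-- `Φ` is a `C²` diffeomorphism between open sets of `ℝ³` which straightens `M` inside its source
to the coordinate plane `{x₂ = 0}` (coordinates are numbered `0, 1, 2`). -/
structure IsFlatteningChart (M : Set E3) (Φ : OpenPartialHomeomorph E3 E3) : Prop where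
  contDiffOn : ContDiffOn ℝ 2 Φ Φ.source
  contDiffOn_symm : ContDiffOn ℝ 2 Φ.symm Φ.target
  mem_iff : ∀ x ∈ Φ.source, x ∈ M ↔ Φ x 2 = 0

/-- `M` is an (embedded) `C²` surface in `ℝ³`. -/
def IsC2Surface (M : Set E3) : Prop :=
  ∀ p ∈ M, ∃ Φ : OpenPartialHomeomorph E3 E3, IsFlatteningChart M Φ ∧ p ∈ Φ.source

/-- The vectors tangent to the surface `M` at `x`: those whose image under the differential of a
flattening chart lies in the plane `{x₂ = 0}`. -/
def tangentVectors (M : Set E3) (x : E3) : Set E3 :=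
  {w | ∃ Φ : OpenPartialHomeomorph E3 E3,
    IsFlatteningChart M Φ ∧ x ∈ Φ.source ∧ (fderiv ℝ Φ x w) 2 = 0}

/-- `S` is a bounded Lipschitz region in the `C²` surface `M`: it is relatively open in `M`, its
closure is a compact subset of `M`, and near each of its boundary points it is, in a `C²` chart of
`M`, the part of the plane that lies above the graph of a Lipschitz function. -/
structure IsBoundedLipschitzRegion (M S : Set E3) : Prop where
  isOpen_in : ∃ U : Set E3, IsOpen U ∧ S = M ∩ U
  isBounded : Bornology.IsBounded S
  closure_subset : closure S ⊆ M
  lipschitz_boundary : ∀ p ∈ closure S \ S,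
    ∃ Φ : OpenPartialHomeomorph E3 E3, IsFlatteningChart M Φ ∧ p ∈ Φ.source ∧
      ∃ (K : ℝ≥0) (g : ℝ → ℝ), LipschitzWith K g ∧
        ∀ x ∈ M ∩ Φ.source, x ∈ S ↔ g (Φ x 0) < Φ x 1

/-- `n` is a continuous field of unit vectors on `S`, normal to the surface `M` that contains `S`:
an orientation of `S`. -/
structure IsUnitNormalField (M S : Set E3) (n : E3 → E3) : Prop where
  continuousOn : ContinuousOn n S
  norm_eq_one : ∀ x ∈ S, ‖n x‖ = 1
  inner_eq_zero : ∀ x ∈ S, ∀ w ∈ tangentVectors M x, inner ℝ w (n x) = 0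

/-- The shell `S_h = {x + t n(x) | x ∈ S, |t| < h}`. -/
def shell (S : Set E3) (n : E3 → E3) (h : ℝ) : Set E3 :=
  {z | ∃ x ∈ S, ∃ t : ℝ, |t| < h ∧ z = x + t • n x}

/-- `u ∈ W^{1,p}(Ω, ℝᵐ)` with weak gradient `Du`; the entry `(j, i)` of `Du x` is `∂ᵢ uⱼ (x)`.
The norm `‖Du x‖` is the Euclidean (Frobenius) norm of the matrix `∇u(x)`. -/
structure IsSobolev (p : ℝ≥0∞) {m : ℕ} (Ω : Set E3) (u : E3 → EuclideanSpace ℝ (Fin m))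
    (Du : E3 → EuclideanSpace ℝ (Fin m × Fin 3)) : Prop where
  memLp : MemLp u p (volume.restrict Ω)
  memLp_grad : MemLp Du p (volume.restrict Ω)
  integral_eq : ∀ φ : E3 → ℝ, ContDiff ℝ ∞ φ → HasCompactSupport φ → tsupport φ ⊆ Ω →
    ∀ (j : Fin m) (i : Fin 3),
      ∫ x in Ω, u x j * fderiv ℝ φ x (EuclideanSpace.single i 1) = - ∫ x in Ω, Du x (j, i) * φ x

end Shell

/-! The scheme is Lipschitz truncation by the maximal function. Where the averages of |∇u| over
small balls intersected with the shell are at most 2λ, the function u is Lipschitz with constant of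
order λ. Elsewhere lies a bad set whose measure is bounded by the weak type inequality. A McShane
extension from the good set gives v. Since ∇u = ∇v a.e. on {u = v}, estimate (iii) follows from (i)
and (ii).

The point is that no constant may depend on h. `exists_hasBoxCover_shell` shows that, at a fixed
scale δ, a thin shell is near each of its points a bi-Lipschitz image of a box with two sides
between r and R and third side 2h, where L, δ, r, R do not depend on h. The map is normal
coordinates composed with a shear that straightens the Lipschitz boundary; compactness of the
closure of S makes the constants uniform. Two facts about boxes are insensitive to their thinness.
Intersections of a box with balls are doubling, since their volume at scale ρ is comparable to the
product of min(ρ, side/2). And the Poincaré inequality on a convex set involves only its diameter.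
Hence the Vitali argument (`HasBoxCover.volume_not_maximalLE_le`) and the telescoping of averages
(`IsBoxPatch.norm_sub_le`) are uniform in h.

These estimates are local: they compare only points at distance at most a fixed multiple of δ. If
the good set is ε-dense in the shell, a McShane infimum restricted to nearby points keeps the local
Lipschitz constant (`exists_local_lipschitz_extension`), and this is all that the gradient bound
needs. If it is not ε-dense, the bad set contains, up to a null set, a whole ball of radius ε
intersected with the shell. By `exists_volume_le_of_hasBoxCover` the volume of such a piece is
comparable to that of the shell, both being of order h, so v = 0 is admissible. The two cases are
joined in `exists_truncation_of_hasBoxCover`. -/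

section ShellTruncation

open Filter Topology Metric

/-! ### Mollification and L¹ approximation of weakly differentiable functions. -/

section Mollification

variable {E : Type*} [NormedAddCommGroup E] [NormedSpace ℝ E] [FiniteDimensional ℝ E]
  [MeasurableSpace E] [BorelSpace E]

/-- `d` is a weak derivative of `u` on `Ω` in the direction `e`. -/
def HasWeakDeriv (μ : Measure E) (Ω : Set E) (u : E → ℝ) (e : E) (d : E → ℝ) : Prop :=
  ∀ φ : E → ℝ, ContDiff ℝ ∞ φ → HasCompactSupport φ → tsupport φ ⊆ Ω →
    ∫ x in Ω, u x * fderiv ℝ φ x e ∂μ = - ∫ x in Ω, d x * φ x ∂μ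

/-- A sequence which converges almost everywhere and does not increase the `L¹` norm converges
in `L¹`. -/
lemma tendsto_lintegral_enorm_sub_of_ae_tendsto {α : Type*} [MeasurableSpace α] {μ : Measure α}
    {f : α → ℝ} {F : ℕ → α → ℝ} (hf : Integrable f μ) (hF : ∀ k, AEStronglyMeasurable (F k) μ)
    (hle : ∀ k, ∫⁻ x, ‖F k x‖ₑ ∂μ ≤ ∫⁻ x, ‖f x‖ₑ ∂μ)
    (hlim : ∀ᵐ x ∂μ, Tendsto (fun k => F k x) atTop (𝓝 (f x))) :
    Tendsto (fun k => ∫⁻ x, ‖F k x - f x‖ₑ ∂μ) atTop (𝓝 0) := by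
  have hfin : ∫⁻ x, ‖f x‖ₑ ∂μ ≠ ⊤ := hf.2.ne
  have hmin : Tendsto (fun k => ∫⁻ x, min ‖f x‖ₑ ‖F k x - f x‖ₑ ∂μ) atTop (𝓝 0) := by
    have := tendsto_lintegral_of_dominated_convergence' (μ := μ)
      (F := fun k x => min ‖f x‖ₑ ‖F k x - f x‖ₑ) (f := fun _ => 0) (fun x => ‖f x‖ₑ)
      (fun k => hf.1.enorm.min ((hF k).sub hf.1).enorm)
      (fun k => Eventually.of_forall fun x => min_le_left _ _) hfin ?_
    · simpa using this
    · filter_upwards [hlim] with x hx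
      have h1 : Tendsto (fun k => ‖F k x - f x‖ₑ) atTop (𝓝 0) := by
        have := (hx.sub_const (f x)).enorm
        simpa using this
      have := (tendsto_const_nhds (x := ‖f x‖ₑ)).min h1
      simpa using this
  have hbd : ∀ k, ∫⁻ x, ‖F k x - f x‖ₑ ∂μ ≤ 2 * ∫⁻ x, min ‖f x‖ₑ ‖F k x - f x‖ₑ ∂μ := by
    intro k
    have h1 : ∫⁻ x, ‖F k x - f x‖ₑ ∂μ + ∫⁻ x, ‖f x‖ₑ ∂μ ≤
        2 * ∫⁻ x, min ‖f x‖ₑ ‖F k x - f x‖ₑ ∂μ + ∫⁻ x, ‖f x‖ₑ ∂μ := by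
      calc ∫⁻ x, ‖F k x - f x‖ₑ ∂μ + ∫⁻ x, ‖f x‖ₑ ∂μ
          = ∫⁻ x, (‖F k x - f x‖ₑ + ‖f x‖ₑ) ∂μ := (lintegral_add_right' _ hf.1.enorm).symm
        _ ≤ ∫⁻ x, (‖F k x‖ₑ + 2 * min ‖f x‖ₑ ‖F k x - f x‖ₑ) ∂μ := by
            apply lintegral_mono
            intro x
            -- Scheffé's argument: after integration the norm of `F k` is absorbed by that of `f`,
            -- and only the minimum, dominated by `‖f‖`, is left.
            have key : ‖F k x - f x‖ + ‖f x‖ ≤ ‖F k x‖ + 2 * min ‖f x‖ ‖F k x - f x‖ := by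
              rcases min_cases ‖f x‖ ‖F k x - f x‖ with ⟨h, _⟩ | ⟨h, _⟩
              · rw [h]; linarith [norm_sub_le (F k x) (f x)]
              · rw [h]
                have := norm_sub_le (F k x) (F k x - f x)
                simp only [sub_sub_cancel] at this
                linarith
            have e2 : (2 : ℝ≥0∞) = ENNReal.ofReal 2 := by simp
            simp only [← ofReal_norm]
            rw [← ENNReal.ofReal_min, e2, ← ENNReal.ofReal_mul (by norm_num),
              ← ENNReal.ofReal_add (norm_nonneg _) (norm_nonneg _),
              ← ENNReal.ofReal_add (norm_nonneg _) (by positivity)]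
            exact ENNReal.ofReal_le_ofReal key
        _ = ∫⁻ x, ‖F k x‖ₑ ∂μ + 2 * ∫⁻ x, min ‖f x‖ₑ ‖F k x - f x‖ₑ ∂μ := by
            rw [lintegral_add_left' (hF k).enorm, lintegral_const_mul' _ _ (by simp)]
        _ ≤ _ := by rw [add_comm]; exact add_le_add le_rfl (hle k)
    exact (ENNReal.add_le_add_iff_right hfin).1 h1
  refine tendsto_of_tendsto_of_tendsto_of_le_of_le tendsto_const_nhds ?_ (fun _ => zero_le) hbd
  simpa using ENNReal.Tendsto.const_mul hmin (Or.inr (by simp : (2 : ℝ≥0∞) ≠ ⊤))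

/-- A sequence of bump functions whose supports shrink to the origin. -/
noncomputable def shrinkingBump (E : Type*) [NormedAddCommGroup E] (k : ℕ) :
    ContDiffBump (0 : E) where
  rIn := 1 / (k + 1)
  rOut := 2 / (k + 1)
  rIn_pos := by positivity
  rIn_lt_rOut := by gcongr; norm_num

lemma tendsto_shrinkingBump_rOut (E : Type*) [NormedAddCommGroup E] :
    Tendsto (fun k => (shrinkingBump E k).rOut) atTop (𝓝 0) := by
  have := (tendsto_one_div_add_atTop_nhds_zero_nat (𝕜 := ℝ)).const_mul 2
  simp only [mul_zero, mul_one_div] at this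
  exact this

/-- Mollification of a function by the bump functions `shrinkingBump`. -/
noncomputable def mollify (μ : Measure E) (f : E → ℝ) (k : ℕ) : E → ℝ :=
  convolution ((shrinkingBump E k).normed μ) f (ContinuousLinearMap.lsmul ℝ ℝ) μ

variable {μ : Measure E} [μ.IsAddHaarMeasure]

lemma contDiff_mollify {f : E → ℝ} (hf : Integrable f μ) (k : ℕ) :
    ContDiff ℝ 1 (mollify μ f k) :=
  (shrinkingBump E k).hasCompactSupport_normed.contDiff_convolution_left (n := 1) _
    (shrinkingBump E k).contDiff_normed hf.locallyIntegrable

lemma ae_tendsto_mollify {f : E → ℝ} (hf : Integrable f μ) :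
    ∀ᵐ x ∂μ, Tendsto (fun k => mollify μ f k x) atTop (𝓝 (f x)) := by
  refine ContDiffBump.ae_convolution_tendsto_right_of_locallyIntegrable (K := 2)
    (tendsto_shrinkingBump_rOut E) (Eventually.of_forall fun k => ?_) hf.locallyIntegrable
  simp only [shrinkingBump]
  rw [mul_one_div]

/-- The kernel is nonnegative of mass one, so |ψ * f| ≤ ψ * |f|, and Fubini computes the integral of
the right side. -/
lemma lintegral_enorm_mollify_le {f : E → ℝ} (hf : Integrable f μ) (k : ℕ) :
    ∫⁻ x, ‖mollify μ f k x‖ₑ ∂μ ≤ ∫⁻ x, ‖f x‖ₑ ∂μ := by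
  set ψ := (shrinkingBump E k).normed μ with hψ
  have hψi : Integrable ψ μ := (shrinkingBump E k).integrable_normed
  have hi : Integrable (mollify μ f k) μ := hψi.integrable_convolution _ hf
  have hi' : Integrable (convolution ψ (fun x => ‖f x‖) (ContinuousLinearMap.lsmul ℝ ℝ) μ) μ :=
    hψi.integrable_convolution _ hf.norm
  rw [← ofReal_integral_norm_eq_lintegral_enorm hi, ← ofReal_integral_norm_eq_lintegral_enorm hf]
  apply ENNReal.ofReal_le_ofReal
  calc ∫ x, ‖mollify μ f k x‖ ∂μ
      ≤ ∫ x, convolution ψ (fun x => ‖f x‖) (ContinuousLinearMap.lsmul ℝ ℝ) μ x ∂μ := by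
        apply integral_mono hi.norm hi'
        intro x
        simp only [mollify, convolution, ContinuousLinearMap.lsmul_apply, smul_eq_mul]
        refine (norm_integral_le_integral_norm _).trans (le_of_eq ?_)
        congr 1
        ext t
        rw [norm_mul, Real.norm_of_nonneg ((shrinkingBump E k).nonneg_normed t)]
    _ = ∫ x, ‖f x‖ ∂μ := by
        rw [integral_convolution _ hψi hf.norm]
        simp [hψ, (shrinkingBump E k).integral_normed]

lemma tendsto_lintegral_mollify_sub {f : E → ℝ} (hf : Integrable f μ) :
    Tendsto (fun k => ∫⁻ x, ‖mollify μ f k x - f x‖ₑ ∂μ) atTop (𝓝 0) :=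
  tendsto_lintegral_enorm_sub_of_ae_tendsto hf
    (fun k => (contDiff_mollify hf k).continuous.aestronglyMeasurable)
    (lintegral_enorm_mollify_le hf) (ae_tendsto_mollify hf)

/-- The derivative falls on the kernel, and `y ↦ ψ (x - y)` is an admissible test function because
its support lies in the ball of `hx`. The sign of the reflection cancels the one in the weak
derivative. -/
lemma fderiv_mollify_apply {Ω : Set E} (hΩ : MeasurableSet Ω) {u d : E → ℝ} {e : E}
    (hu : IntegrableOn u Ω μ) (hd : HasWeakDeriv μ Ω u e d) {k : ℕ} {x : E}
    (hx : closedBall x (shrinkingBump E k).rOut ⊆ Ω) :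
    fderiv ℝ (mollify μ (Ω.indicator u) k) x e = mollify μ (Ω.indicator d) k x := by
  set ψ := (shrinkingBump E k).normed μ with hψ
  have hψd : ContDiff ℝ ∞ ψ := (shrinkingBump E k).contDiff_normed
  have hψc : HasCompactSupport ψ := (shrinkingBump E k).hasCompactSupport_normed
  have hui : LocallyIntegrable (Ω.indicator u) μ := (hu.integrable_indicator hΩ).locallyIntegrable
  have h1 := (hψc.hasFDerivAt_convolution_left (ContinuousLinearMap.lsmul ℝ ℝ) (μ := μ)
    (hψd.of_le (by simp)) hui x).fderiv
  change fderiv ℝ (mollify μ (Ω.indicator u) k) x = _ at h1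
  have hex : ConvolutionExistsAt (fderiv ℝ ψ) (Ω.indicator u) x
      ((ContinuousLinearMap.lsmul ℝ ℝ).precompL E) μ :=
    (hψc.fderiv (𝕜 := ℝ)).convolutionExists_left _ (hψd.continuous_fderiv (by simp)) hui x
  have hsupp : tsupport (fun y => ψ (x - y)) ⊆ closedBall x (shrinkingBump E k).rOut := by
    refine closure_minimal ?_ isClosed_closedBall
    intro y hy
    have : x - y ∈ tsupport ψ := subset_tsupport _ hy
    rw [hψ, (shrinkingBump E k).tsupport_normed_eq] at this
    simpa [dist_eq_norm, norm_sub_rev] using this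
  have h2 := hd (fun y => ψ (x - y)) (hψd.comp (contDiff_const.sub contDiff_id))
    (HasCompactSupport.of_support_subset_isCompact (isCompact_closedBall x _)
      ((subset_tsupport _).trans hsupp)) (hsupp.trans hx)
  have hfd : ∀ y, fderiv ℝ (fun y => ψ (x - y)) y e = - fderiv ℝ ψ (x - y) e := by
    intro y
    have h := ((hψd.differentiable (by simp)) (x - y)).hasFDerivAt.comp y
      ((hasFDerivAt_id y).const_sub x)
    have h' : fderiv ℝ (fun y => ψ (x - y)) y = _ := h.fderiv
    rw [h']
    simp
  rw [h1]
  simp only [mollify, convolution]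
  rw [ContinuousLinearMap.integral_apply hex]
  simp only [ContinuousLinearMap.precompL_apply, ContinuousLinearMap.lsmul_apply, smul_eq_mul]
  rw [← integral_sub_left_eq_self (fun y => fderiv ℝ ψ y e * Ω.indicator u (x - y)) μ x,
    ← integral_sub_left_eq_self (fun y => ψ y * Ω.indicator d (x - y)) μ x]
  simp only [sub_sub_cancel]
  have e1 : ∀ y, fderiv ℝ ψ (x - y) e * Ω.indicator u y =
      Ω.indicator (fun y => fderiv ℝ ψ (x - y) e * u y) y := by
    intro y; by_cases hy : y ∈ Ω <;> simp [hy]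
  have e2 : ∀ y, ψ (x - y) * Ω.indicator d y = Ω.indicator (fun y => ψ (x - y) * d y) y := by
    intro y; by_cases hy : y ∈ Ω <;> simp [hy]
  simp only [e1, e2]
  rw [integral_indicator hΩ, integral_indicator hΩ]
  simp only [hfd, mul_neg, integral_neg, neg_inj] at h2
  simpa only [mul_comm] using h2

/-- Approximation of weakly differentiable functions by smooth ones. -/
lemma tendsto_lintegral_fderiv_mollify_sub {Ω K : Set E} (hΩ : IsOpen Ω) (hK : IsCompact K)
    (hKΩ : K ⊆ Ω) {u d : E → ℝ} {e : E} (hu : IntegrableOn u Ω μ) (hdi : IntegrableOn d Ω μ)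
    (hd : HasWeakDeriv μ Ω u e d) :
    Tendsto (fun k => ∫⁻ x in K, ‖fderiv ℝ (mollify μ (Ω.indicator u) k) x e - d x‖ₑ ∂μ)
      atTop (𝓝 0) := by
  obtain ⟨δ, hδ, hδΩ⟩ := hK.exists_cthickening_subset_open hΩ hKΩ
  have hev : ∀ᶠ k in atTop, (shrinkingBump E k).rOut < δ :=
    (tendsto_shrinkingBump_rOut E).eventually_lt_const hδ
  have hlim := tendsto_lintegral_mollify_sub (μ := μ) (hdi.integrable_indicator hΩ.measurableSet)
  refine tendsto_of_tendsto_of_tendsto_of_le_of_le' tendsto_const_nhds hlim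
    (Eventually.of_forall fun _ => zero_le) ?_
  filter_upwards [hev] with k hk
  refine le_trans ?_ (setLIntegral_le_lintegral K _)
  refine setLIntegral_mono_ae' hK.measurableSet (Eventually.of_forall fun x hx => ?_)
  have hb : closedBall x (shrinkingBump E k).rOut ⊆ Ω :=
    ((closedBall_subset_closedBall hk.le).trans (closedBall_subset_cthickening hx δ)).trans hδΩ
  rw [fderiv_mollify_apply hΩ.measurableSet hu hd hb, indicator_of_mem (hKΩ hx)]

lemma tendsto_setLIntegral_mollify_sub {Ω : Set E} (hΩ : MeasurableSet Ω) {u : E → ℝ}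
    (hu : IntegrableOn u Ω μ) :
    Tendsto (fun k => ∫⁻ x in Ω, ‖mollify μ (Ω.indicator u) k x - u x‖ₑ ∂μ) atTop (𝓝 0) := by
  have hlim := tendsto_lintegral_mollify_sub (μ := μ) (hu.integrable_indicator hΩ)
  refine tendsto_of_tendsto_of_tendsto_of_le_of_le tendsto_const_nhds hlim
    (fun _ => zero_le) (fun k => ?_)
  refine le_trans ?_ (setLIntegral_le_lintegral Ω _)
  refine setLIntegral_mono_ae' hΩ (Eventually.of_forall fun x hx => ?_)
  rw [indicator_of_mem hx]

end Mollification

/-! ### Chain rule, and vanishing of weak derivatives on zero sets. -/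

section ZeroSet

variable {E : Type*} [NormedAddCommGroup E] [NormedSpace ℝ E] [FiniteDimensional ℝ E]
  [MeasurableSpace E] [BorelSpace E] {μ : Measure E} [μ.IsAddHaarMeasure]

/-- If a sequence converges to `g` in `L¹(s)`, integrals against bounded functions converge. -/
lemma tendsto_setIntegral_mul_of_lintegral {α : Type*} [MeasurableSpace α] {μ : Measure α}
    {g : α → ℝ} {G : ℕ → α → ℝ} {b : α → ℝ} (C : ℝ) (hg : Integrable g μ)
    (hG : ∀ k, AEStronglyMeasurable (G k) μ) (hb : AEStronglyMeasurable b μ) (hC : ∀ x, ‖b x‖ ≤ C)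
    (h : Tendsto (fun k => ∫⁻ x, ‖G k x - g x‖ₑ ∂μ) atTop (𝓝 0)) :
    Tendsto (fun k => ∫ x, G k x * b x ∂μ) atTop (𝓝 (∫ x, g x * b x ∂μ)) := by
  have hC' : ∀ᵐ x ∂μ, ‖b x‖ ≤ C := Eventually.of_forall hC
  refine tendsto_integral_of_L1 _ (hg.mul_bdd hb hC').1 ?_ ?_
  · filter_upwards [h.eventually_lt_const (show (0 : ℝ≥0∞) < ⊤ by simp)] with k hk
    have h1 : Integrable (fun x => G k x - g x) μ := ⟨(hG k).sub hg.1, hk⟩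
    have h2 : Integrable (G k) μ :=
      (h1.add hg).congr (Eventually.of_forall fun x => by simp)
    exact h2.mul_bdd hb hC'
  · have hlim : Tendsto (fun k => (∫⁻ x, ‖G k x - g x‖ₑ ∂μ) * ENNReal.ofReal C) atTop (𝓝 0) := by
      simpa using ENNReal.Tendsto.mul_const h (Or.inr ENNReal.ofReal_ne_top)
    refine tendsto_of_tendsto_of_tendsto_of_le_of_le tendsto_const_nhds hlim
      (fun _ => zero_le) (fun k => ?_)
    simp only
    rw [← lintegral_mul_const' _ _ ENNReal.ofReal_ne_top]
    apply lintegral_mono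
    intro x
    simp only
    rw [← sub_mul, enorm_mul]
    gcongr
    rw [← ofReal_norm]
    exact ENNReal.ofReal_le_ofReal (hC x)

/-- Chain rule for weak derivatives. -/
lemma HasWeakDeriv.comp_contDiff {Ω : Set E} (hΩ : IsOpen Ω) {u d : E → ℝ} {e : E}
    (hu : IntegrableOn u Ω μ) (hdi : IntegrableOn d Ω μ) (hd : HasWeakDeriv μ Ω u e d)
    {η η' : ℝ → ℝ} (hη : ∀ s, HasDerivAt η (η' s) s) (hη' : Continuous η')
    (hη1 : ∀ s, |η' s| ≤ 1) :
    HasWeakDeriv μ Ω (fun x => η (u x)) e (fun x => η' (u x) * d x) := by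
  intro φ hφ hφc hφΩ
  set K := tsupport φ with hK
  have hKc : IsCompact K := hφc
  have hKm : MeasurableSet K := hKc.measurableSet
  have hφ1 : ContDiff ℝ 1 φ := hφ.of_le (by simp)
  have hφ'c : Continuous fun x => fderiv ℝ φ x e := (hφ1.continuous_fderiv_apply (by simp)).comp
    (continuous_id.prodMk continuous_const)
  have hφ's : tsupport (fun x => fderiv ℝ φ x e) ⊆ K := tsupport_fderiv_apply_subset ℝ e
  have hφ'K : ∀ x, x ∉ K → fderiv ℝ φ x e = 0 := fun x hx =>
    image_eq_zero_of_notMem_tsupport (f := fun x => fderiv ℝ φ x e) fun h => hx (hφ's h)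
  have hφK : ∀ x, x ∉ K → φ x = 0 := fun x hx => image_eq_zero_of_notMem_tsupport hx
  obtain ⟨C₁, hC₁⟩ := hφ'c.bounded_above_of_compact_support
    (HasCompactSupport.of_support_subset_isCompact hKc ((subset_tsupport _).trans hφ's))
  obtain ⟨C₂, hC₂⟩ := hφ1.continuous.bounded_above_of_compact_support hφc
  have hηc : Continuous η := continuous_iff_continuousAt.2 fun s => (hη s).continuousAt
  have hηl : ∀ s t, ‖η s - η t‖ ≤ ‖s - t‖ := by
    intro s t
    have := Convex.norm_image_sub_le_of_norm_hasDerivWithin_le (f := η) (f' := η') (C := 1)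
      (fun x _ => (hη x).hasDerivWithinAt) (fun x _ => hη1 x) convex_univ (mem_univ t) (mem_univ s)
    simpa using this
  have huK : IntegrableOn u K μ := hu.mono_set hφΩ
  have hdK : IntegrableOn d K μ := hdi.mono_set hφΩ
  set w := mollify μ (Ω.indicator u) with hw
  have hwc : ∀ k, ContDiff ℝ 1 (w k) := fun k =>
    contDiff_mollify (hu.integrable_indicator hΩ.measurableSet) k
  have hηu : IntegrableOn (fun x => η (u x)) K μ := by
    have h0 : IntegrableOn (fun x => η (u x) - η 0) K μ := by
      refine Integrable.mono huK ((hηc.comp_aestronglyMeasurable huK.1).sub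
        aestronglyMeasurable_const) (Eventually.of_forall fun x => ?_)
      simpa using hηl (u x) 0
    have hc : IntegrableOn (fun _ => η 0) K μ := integrableOn_const hKc.measure_lt_top.ne
    exact (h0.add hc).congr (Eventually.of_forall fun x => by simp)
  have hlim1 : Tendsto (fun k => ∫ x in K, η (w k x) * fderiv ℝ φ x e ∂μ) atTop
      (𝓝 (∫ x in K, η (u x) * fderiv ℝ φ x e ∂μ)) := by
    refine tendsto_setIntegral_mul_of_lintegral C₁ hηu
      (fun k => (hηc.comp (hwc k).continuous).aestronglyMeasurable)
      hφ'c.aestronglyMeasurable hC₁ ?_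
    refine tendsto_of_tendsto_of_tendsto_of_le_of_le tendsto_const_nhds
      (tendsto_setLIntegral_mollify_sub hΩ.measurableSet hu) (fun _ => zero_le) (fun k => ?_)
    refine (lintegral_mono fun x => ?_).trans (lintegral_mono_set hφΩ)
    exact enorm_le_iff_norm_le.2 (hηl _ _)
  have hwd : ∀ k, Continuous fun x => fderiv ℝ (w k) x e := fun k =>
    ((hwc k).continuous_fderiv_apply (by simp)).comp (continuous_id.prodMk continuous_const)
  have hlim2 : Tendsto (fun k => ∫ x in K, η' (w k x) * d x * φ x ∂μ) atTop
      (𝓝 (∫ x in K, η' (u x) * d x * φ x ∂μ)) := by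
    refine tendsto_integral_of_dominated_convergence (fun x => ‖d x‖ * C₂) (fun k => ?_)
      (hdK.norm.mul_const _) (fun k => Eventually.of_forall fun x => ?_) ?_
    · exact ((hη'.comp (hwc k).continuous).aestronglyMeasurable.mul hdK.1).mul
        hφ1.continuous.aestronglyMeasurable
    · rw [norm_mul, norm_mul]
      gcongr
      · exact mul_le_of_le_one_left (norm_nonneg _) (hη1 _)
      · exact hC₂ x
    · filter_upwards [ae_restrict_of_ae (ae_tendsto_mollify (μ := μ)
        (hu.integrable_indicator hΩ.measurableSet)), ae_restrict_mem hKm] with x hx hxK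
      rw [indicator_of_mem (hφΩ hxK)] at hx
      exact (((hη'.tendsto _).comp hx).mul_const _).mul_const _
  -- The derivative of `w k` is split as `d` plus an error: the error tends to zero in L¹(K), while
  -- the `d` part, in which `η' (w k x)` converges only a.e., is handled by domination.
  have hlim3 : Tendsto (fun k => ∫ x in K, η' (w k x) * (fderiv ℝ (w k) x e - d x) * φ x ∂μ) atTop
      (𝓝 0) := by
    have h0 := tendsto_setIntegral_mul_of_lintegral (μ := μ.restrict K) (g := fun _ => (0 : ℝ))
      (G := fun k x => η' (w k x) * (fderiv ℝ (w k) x e - d x)) C₂ (integrable_zero _ _ _)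
      (fun k => (hη'.comp (hwc k).continuous).aestronglyMeasurable.mul
        ((hwd k).aestronglyMeasurable.sub hdK.1)) hφ1.continuous.aestronglyMeasurable hC₂ ?_
    · simpa using h0
    refine tendsto_of_tendsto_of_tendsto_of_le_of_le tendsto_const_nhds
      (tendsto_lintegral_fderiv_mollify_sub hΩ hKc hφΩ hu hdi hd) (fun _ => zero_le) (fun k => ?_)
    refine lintegral_mono fun x => enorm_le_iff_norm_le.2 ?_
    rw [sub_zero, norm_mul]
    exact mul_le_of_le_one_left (norm_nonneg _) (hη1 _)
  have hparts : ∀ k, ∫ x in K, η (w k x) * fderiv ℝ φ x e ∂μ =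
      -(∫ x in K, η' (w k x) * d x * φ x ∂μ
        + ∫ x in K, η' (w k x) * (fderiv ℝ (w k) x e - d x) * φ x ∂μ) := by
    intro k
    have hI1 : Integrable (fun x => η' (w k x) * d x * φ x) (μ.restrict K) := by
      refine (hdK.bdd_mul (c := 1) (hη'.comp (hwc k).continuous).aestronglyMeasurable ?_).mul_bdd
        (c := C₂) hφ1.continuous.aestronglyMeasurable ?_
      · exact Eventually.of_forall fun x => hη1 _
      · exact Eventually.of_forall hC₂
    have hcomp : ∀ x, HasFDerivAt (fun x => η (w k x)) (η' (w k x) • fderiv ℝ (w k) x) x :=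
      fun x => (hη _).comp_hasFDerivAt x (((hwc k).differentiable (by simp)) x).hasFDerivAt
    have hcont : Continuous fun x => η' (w k x) * fderiv ℝ (w k) x e * φ x :=
      ((hη'.comp (hwc k).continuous).mul (hwd k)).mul hφ1.continuous
    have hI2 : Integrable (fun x => η' (w k x) * fderiv ℝ (w k) x e * φ x) μ :=
      hcont.integrable_of_hasCompactSupport hφc.mul_left
    have hI3 : Integrable (fun x => η' (w k x) * (fderiv ℝ (w k) x e - d x) * φ x)
        (μ.restrict K) := by
      have := hI2.integrableOn (s := K) |>.sub hI1
      refine this.congr (Eventually.of_forall fun x => ?_)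
      simp only [Pi.sub_apply]; ring
    have hres : ∀ f : E → ℝ, (∀ x, x ∉ K → f x = 0) → ∫ x in K, f x ∂μ = ∫ x, f x ∂μ :=
      fun f hf => setIntegral_eq_integral_of_forall_compl_eq_zero hf
    rw [← integral_add hI1 hI3]
    have e1 : ∀ x, η' (w k x) * d x * φ x + η' (w k x) * (fderiv ℝ (w k) x e - d x) * φ x =
        fderiv ℝ (fun x => η (w k x)) x e * φ x := by
      intro x; rw [(hcomp x).fderiv]; simp; ring
    simp only [e1]
    rw [hres _ fun x hx => by rw [hφ'K x hx, mul_zero], hres _ fun x hx => by rw [hφK x hx, mul_zero]]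
    apply integral_mul_fderiv_eq_neg_fderiv_mul_of_integrable
    · refine hI2.congr (Eventually.of_forall fun x => ?_)
      simp only; rw [(hcomp x).fderiv]; simp
    · exact Continuous.integrable_of_hasCompactSupport ((hηc.comp (hwc k).continuous).mul hφ'c)
        (HasCompactSupport.mul_left (HasCompactSupport.of_support_subset_isCompact hKc
          ((subset_tsupport _).trans hφ's)))
    · exact Continuous.integrable_of_hasCompactSupport
        ((hηc.comp (hwc k).continuous).mul hφ1.continuous) hφc.mul_left
    · exact fun x _ => (hcomp x).differentiableAt
    · exact fun x _ => hφ1.differentiable (by simp) x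
  have hfin : ∫ x in K, η (u x) * fderiv ℝ φ x e ∂μ = -∫ x in K, η' (u x) * d x * φ x ∂μ := by
    refine tendsto_nhds_unique hlim1 ?_
    simp only [hparts]
    simpa using (hlim2.add hlim3).neg
  have hext : ∀ f : E → ℝ, (∀ x, x ∉ K → f x = 0) → ∫ x in K, f x ∂μ = ∫ x in Ω, f x ∂μ := by
    intro f hf
    rw [setIntegral_eq_integral_of_forall_compl_eq_zero hf,
      setIntegral_eq_integral_of_forall_compl_eq_zero fun x hx => hf x fun h => hx (hφΩ h)]
  rw [← hext _ fun x hx => by rw [hφ'K x hx, mul_zero],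
    ← hext _ fun x hx => by rw [hφK x hx, mul_zero]]
  exact hfin

/-- A weak derivative vanishes almost everywhere on the zero set of the function. -/
lemma HasWeakDeriv.ae_eq_zero_of_eq_zero {Ω : Set E} (hΩ : IsOpen Ω) {u d : E → ℝ} {e : E}
    (hu : IntegrableOn u Ω μ) (hdi : IntegrableOn d Ω μ) (hd : HasWeakDeriv μ Ω u e d) :
    ∀ᵐ x ∂μ.restrict Ω, u x = 0 → d x = 0 := by
  -- The functions `η n` tend to zero uniformly, while their derivatives stay bounded by 1 and tend
  -- to the indicator of {0}. In the limit the chain rule says that `d` times the indicator of {u =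
  -- 0} integrates to zero against every test function.
  set η' : ℕ → ℝ → ℝ := fun n s => 1 / (1 + ((n + 1) * s) ^ 2) with hη'
  set η : ℕ → ℝ → ℝ := fun n s => (1 / (n + 1 : ℝ)) * Real.arctan ((n + 1) * s) with hη
  have hpos : ∀ n : ℕ, (0 : ℝ) < n + 1 := fun n => by positivity
  have hder : ∀ n s, HasDerivAt (η n) (η' n s) s := by
    intro n s
    have h := (((hasDerivAt_id s).const_mul ((n : ℝ) + 1)).arctan).const_mul (1 / (n + 1 : ℝ))
    have hn := (hpos n).ne'
    convert! h using 1
    simp only [hη', id]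
    field_simp
  have hcont : ∀ n, Continuous (η' n) := by
    intro n
    refine continuous_const.div (by fun_prop) fun s => by positivity
  have hle1 : ∀ n s, |η' n s| ≤ 1 := by
    intro n s
    rw [abs_of_nonneg (by positivity), div_le_one (by positivity)]
    nlinarith [sq_nonneg ((n + 1) * s)]
  have hη'lim : ∀ s, Tendsto (fun n => η' n s) atTop (𝓝 (if s = 0 then 1 else 0)) := by
    intro s
    by_cases hs : s = 0
    · simp [hη', hs]
    · simp only [hs, if_false]
      have h1 : Tendsto (fun n : ℕ => ((n : ℝ) + 1)) atTop atTop :=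
        tendsto_natCast_atTop_atTop.atTop_add tendsto_const_nhds
      have h2 : Tendsto (fun n : ℕ => 1 + (((n : ℝ) + 1) * s) ^ 2) atTop atTop := by
        refine tendsto_atTop_add_const_left _ _ ?_
        have h3 := ((tendsto_pow_atTop (α := ℝ) (n := 2) (by norm_num)).comp h1).atTop_mul_const
          (show 0 < s ^ 2 by positivity)
        refine h3.congr fun n => ?_
        simp only [Function.comp]; ring
      exact h2.inv_tendsto_atTop.congr fun n => by simp [hη']
  have hηlim : ∀ n s, ‖η n s‖ ≤ 1 / (n + 1 : ℝ) * 2 := by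
    intro n s
    rw [hη, norm_mul, Real.norm_of_nonneg (by positivity : (0 : ℝ) ≤ 1 / (n + 1))]
    gcongr
    rw [Real.norm_eq_abs, abs_le]
    constructor <;> linarith [Real.arctan_lt_pi_div_two ((n + 1) * s), Real.pi_lt_four,
      Real.neg_pi_div_two_lt_arctan ((n + 1) * s)]
  set f : E → ℝ := fun x => (if u x = 0 then 1 else 0) * d x with hf
  have hfm : AEStronglyMeasurable f (μ.restrict Ω) := by
    refine aestronglyMeasurable_of_tendsto_ae atTop (f := fun n x => η' n (u x) * d x) (fun n => ?_)
      (Eventually.of_forall fun x => (hη'lim (u x)).mul_const _)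
    exact ((hcont n).comp_aestronglyMeasurable hu.1).mul hdi.1
  have hfi : IntegrableOn f Ω μ := by
    refine Integrable.mono hdi hfm (Eventually.of_forall fun x => ?_)
    simp only [hf]; split_ifs <;> simp
  have hzero := hΩ.ae_eq_zero_of_integral_contDiff_smul_eq_zero (f := f) (μ := μ)
    hfi.locallyIntegrableOn ?_
  · rw [ae_restrict_iff' hΩ.measurableSet]
    filter_upwards [hzero] with x hx hxΩ hux
    simpa [hf, hux] using hx hxΩ
  intro φ hφ hφc hφΩ
  have hφ1 : ContDiff ℝ 1 φ := hφ.of_le (by simp)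
  obtain ⟨C₂, hC₂⟩ := hφ1.continuous.bounded_above_of_compact_support hφc
  have hφ'c : Continuous fun x => fderiv ℝ φ x e := (hφ1.continuous_fderiv_apply (by simp)).comp
    (continuous_id.prodMk continuous_const)
  have hφ's : HasCompactSupport fun x => fderiv ℝ φ x e := hφc.fderiv_apply (𝕜 := ℝ) e
  have hφ'i : Integrable (fun x => fderiv ℝ φ x e) μ := hφ'c.integrable_of_hasCompactSupport hφ's
  have heq : ∀ n, ∫ x in Ω, η n (u x) * fderiv ℝ φ x e ∂μ = - ∫ x in Ω, η' n (u x) * d x * φ x ∂μ :=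
    fun n => hd.comp_contDiff hΩ hu hdi (hder n) (hcont n) (hle1 n) φ hφ hφc hφΩ
  have hl1 : Tendsto (fun n => ∫ x in Ω, η n (u x) * fderiv ℝ φ x e ∂μ) atTop (𝓝 0) := by
    refine squeeze_zero_norm (a := fun n : ℕ => 1 / ((n : ℝ) + 1) * (2 * ∫ x in Ω, ‖fderiv ℝ φ x e‖ ∂μ))
      (fun n => ?_) ?_
    · rw [← mul_assoc, ← integral_const_mul]
      refine norm_integral_le_of_norm_le (hφ'i.norm.integrableOn.const_mul _)
        (Eventually.of_forall fun x => ?_)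
      rw [norm_mul]
      gcongr
      exact hηlim n _
    · simpa using (tendsto_one_div_add_atTop_nhds_zero_nat (𝕜 := ℝ)).mul_const
        (2 * ∫ x in Ω, ‖fderiv ℝ φ x e‖ ∂μ)
  have hl2 : Tendsto (fun n => ∫ x in Ω, η' n (u x) * d x * φ x ∂μ) atTop
      (𝓝 (∫ x in Ω, f x * φ x ∂μ)) := by
    refine tendsto_integral_of_dominated_convergence (fun x => ‖d x‖ * C₂) (fun k => ?_)
      (hdi.norm.mul_const _) (fun k => Eventually.of_forall fun x => ?_) ?_
    · exact (((hcont k).comp_aestronglyMeasurable hu.1).mul hdi.1).mul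
        hφ1.continuous.aestronglyMeasurable
    · rw [norm_mul, norm_mul]
      gcongr
      · exact mul_le_of_le_one_left (norm_nonneg _) (hle1 _ _)
      · exact hC₂ x
    · exact Eventually.of_forall fun x => ((hη'lim (u x)).mul_const _).mul_const _
  have hl3 : ∫ x in Ω, f x * φ x ∂μ = 0 := by
    refine tendsto_nhds_unique hl2 ?_
    have := hl1.neg
    simp only [heq, neg_neg, neg_zero] at this
    exact this
  simp only [smul_eq_mul]
  rw [← hl3, ← setIntegral_eq_integral_of_forall_compl_eq_zero (s := Ω)]
  · simp only [mul_comm]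
  · intro x hx
    rw [image_eq_zero_of_notMem_tsupport fun h => hx (hφΩ h), zero_mul]

end ZeroSet

/-! ### Upper gradients along curves and the Poincaré inequality on convex sets. -/

section UpperGradient

variable {E : Type*} [NormedAddCommGroup E] [NormedSpace ℝ E]

/-- The norm of the derivative is an upper gradient along Lipschitz curves. -/
lemma enorm_sub_le_lintegral_fderiv_along {w : E → ℝ} (hw : ContDiff ℝ 1 w) {C : ℝ≥0} {γ : ℝ → E}
    (hγ : LipschitzWith C γ) :
    ‖w (γ 1) - w (γ 0)‖ₑ ≤ C * ∫⁻ t in Ioc (0 : ℝ) 1, ‖fderiv ℝ w (γ t)‖ₑ := by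
  have hgc : Continuous fun t => ‖fderiv ℝ w (γ t)‖ :=
    ((hw.continuous_fderiv (by simp)).comp hγ.continuous).norm
  set B : ℝ → ℝ := fun x => ∫ t in (0 : ℝ)..x, C * ‖fderiv ℝ w (γ t)‖ with hB
  have hBd : ∀ x, HasDerivAt B (C * ‖fderiv ℝ w (γ x)‖) x := fun x =>
    (continuous_const.mul hgc).integral_hasStrictDerivAt 0 x |>.hasDerivAt
  have hle : ‖w (γ 1) - w (γ 0)‖ ≤ B 1 := by
    -- The curve is only Lipschitz, so `w ∘ γ` need not be differentiable everywhere; a comparison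
    -- of right slopes with the derivative of `B` suffices.
    refine image_le_of_liminf_slope_right_le_deriv_boundary (a := 0) (b := 1)
      (f := fun t => ‖w (γ t) - w (γ 0)‖) (B := B) (B' := fun x => C * ‖fderiv ℝ w (γ x)‖)
      ((hw.continuous.comp hγ.continuous).sub continuous_const).norm.continuousOn (by simp [hB])
      (fun x _ => (hBd x).continuousAt.continuousWithinAt)
      (fun x _ => (hBd x).hasDerivWithinAt) (fun x _ r hr => ?_) (right_mem_Icc.2 zero_le_one)
    set D := ‖fderiv ℝ w (γ x)‖ with hD
    have hC0 : (0 : ℝ) ≤ C := C.2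
    -- A local Lipschitz constant of `w` slightly above `D` whose product with `C` stays below `r`;
    -- dividing by `C + 1` also covers `C = 0`.
    have hDK : D < D + (r - C * D) / (C + 1) := by
      have : 0 < (r - C * D) / (C + 1) := div_pos (by linarith) (by linarith)
      linarith
    have hKr : C * (D + (r - C * D) / (C + 1)) < r := by
      have h1 : (C : ℝ) * ((r - C * D) / (C + 1)) < r - C * D := by
        rw [mul_div_assoc', div_lt_iff₀ (by linarith)]
        nlinarith
      linarith
    obtain ⟨K, hK⟩ : ∃ K : ℝ≥0, (K : ℝ) = D + (r - C * D) / (C + 1) :=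
      ⟨⟨_, (norm_nonneg _).trans hDK.le⟩, rfl⟩
    obtain ⟨s, hs, hsl⟩ := (hw.contDiffAt.hasStrictFDerivAt (x := γ x)
      (by simp)).exists_lipschitzOnWith_of_nnnorm_lt K
      (by rw [← NNReal.coe_lt_coe, hK]; exact hDK)
    have hev : ∀ᶠ z in 𝓝[>] x, γ z ∈ s :=
      (hγ.continuous.tendsto x).eventually hs |>.filter_mono nhdsWithin_le_nhds
    refine (Filter.Eventually.and hev self_mem_nhdsWithin).frequently.mono fun z hz => ?_
    obtain ⟨hzs, hxz⟩ := hz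
    have hxz' : (0 : ℝ) < z - x := sub_pos.2 hxz
    rw [slope_def_field, div_lt_iff₀ hxz']
    have h1 : ‖w (γ z) - w (γ x)‖ ≤ K * ‖γ z - γ x‖ := by
      simpa [dist_eq_norm] using hsl.dist_le_mul _ hzs _ (mem_of_mem_nhds hs)
    have h2 : ‖γ z - γ x‖ ≤ C * (z - x) := by
      have := hγ.dist_le_mul z x
      rwa [dist_eq_norm, Real.dist_eq, abs_of_pos hxz'] at this
    have h3 : ‖w (γ z) - w (γ 0)‖ - ‖w (γ x) - w (γ 0)‖ ≤ ‖w (γ z) - w (γ x)‖ := by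
      have := norm_sub_norm_le (w (γ z) - w (γ 0)) (w (γ x) - w (γ 0))
      simpa using this
    calc _ ≤ ‖w (γ z) - w (γ x)‖ := h3
      _ ≤ K * (C * (z - x)) := h1.trans (by gcongr)
      _ = (C * (D + (r - C * D) / (C + 1))) * (z - x) := by
          rw [hK]; ring
      _ < r * (z - x) := by gcongr
  have hint : IntegrableOn (fun t => (C : ℝ) * ‖fderiv ℝ w (γ t)‖) (Ioc 0 1) :=
    (continuous_const.mul hgc).integrableOn_Ioc
  calc ‖w (γ 1) - w (γ 0)‖ₑ = ENNReal.ofReal ‖w (γ 1) - w (γ 0)‖ := (ofReal_norm _).symm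
    _ ≤ ENNReal.ofReal (B 1) := ENNReal.ofReal_le_ofReal hle
    _ = ∫⁻ t in Ioc (0 : ℝ) 1, ENNReal.ofReal (C * ‖fderiv ℝ w (γ t)‖) := by
        rw [hB]
        simp only
        rw [intervalIntegral.integral_of_le zero_le_one,
          ofReal_integral_eq_lintegral_ofReal hint (Eventually.of_forall fun t => by positivity)]
    _ = C * ∫⁻ t in Ioc (0 : ℝ) 1, ‖fderiv ℝ w (γ t)‖ₑ := by
        rw [← lintegral_const_mul' _ _ ENNReal.coe_ne_top]
        congr 1
        ext t
        rw [ENNReal.ofReal_mul C.coe_nonneg, ofReal_norm, ENNReal.ofReal_coe_nnreal]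

variable [FiniteDimensional ℝ E] [MeasurableSpace E] [BorelSpace E] {μ : Measure E}
  [μ.IsAddHaarMeasure]

lemma lintegral_comp_add_smul (G : E → ℝ≥0∞) (hG : Measurable G) (c : E) {t : ℝ} (ht : 0 < t) :
    ∫⁻ b, G (c + t • b) ∂μ = ENNReal.ofReal ((t ^ Module.finrank ℝ E)⁻¹) * ∫⁻ b, G b ∂μ := by
  have h1 : ∫⁻ b, G (c + t • b) ∂μ = ∫⁻ b, G (c + b) ∂(Measure.map (t • ·) μ) :=
    (lintegral_map (hG.comp (measurable_const_add c)) (measurable_const_smul t)).symm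
  rw [h1, Measure.map_addHaar_smul μ ht.ne', lintegral_smul_measure,
    lintegral_add_left_eq_self, abs_of_nonneg (by positivity)]
  rfl

/-- Contracting `Q` towards one of its points stays in `Q` by convexity, and the Jacobian factor `t
^ (-dim)` is at most `2 ^ dim` when `t ≥ 1/2`. -/
lemma lintegral_segment_le {Q : Set E} (hQ : Convex ℝ Q) (hQm : MeasurableSet Q)
    {G : E → ℝ≥0∞} (hG : Measurable G) {a : E} (ha : a ∈ Q) {t : ℝ} (ht : 1 / 2 ≤ t) (ht1 : t ≤ 1) :
    ∫⁻ b in Q, G (a + t • (b - a)) ∂μ ≤ 2 ^ Module.finrank ℝ E * ∫⁻ b in Q, G b ∂μ := by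
  have ht0 : 0 < t := by linarith
  have e1 : ∀ b, a + t • (b - a) = (1 - t) • a + t • b := fun b => by
    rw [smul_sub, sub_smul, one_smul]; abel
  calc ∫⁻ b in Q, G (a + t • (b - a)) ∂μ
      ≤ ∫⁻ b, Q.indicator G ((1 - t) • a + t • b) ∂μ := by
        rw [← lintegral_indicator hQm]
        refine lintegral_mono fun b => ?_
        by_cases hb : b ∈ Q
        · rw [indicator_of_mem hb, e1,
            indicator_of_mem (hQ ha hb (by linarith) ht0.le (by ring))]
        · rw [indicator_of_notMem hb]; exact zero_le
    _ = ENNReal.ofReal ((t ^ Module.finrank ℝ E)⁻¹) * ∫⁻ b in Q, G b ∂μ := by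
        rw [lintegral_comp_add_smul _ (hG.indicator hQm) _ ht0, lintegral_indicator hQm]
    _ ≤ _ := by
        gcongr
        have : (2 : ℝ≥0∞) ^ Module.finrank ℝ E = ENNReal.ofReal (2 ^ Module.finrank ℝ E) := by
          rw [ENNReal.ofReal_pow (by norm_num)]; simp
        rw [this]
        refine ENNReal.ofReal_le_ofReal ?_
        rw [← inv_pow]
        gcongr
        rw [inv_le_comm₀ ht0 (by norm_num)]
        linarith

/-- The Poincaré inequality on convex sets, for a function with an upper gradient `G`. -/
lemma lintegral_lintegral_enorm_sub_le {Q : Set E} (hQ : Convex ℝ Q) (hQm : MeasurableSet Q)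
    (W : E → ℝ) {G : E → ℝ≥0∞} (hG : Measurable G) {D : ℝ≥0∞}
    (h : ∀ a ∈ Q, ∀ b ∈ Q, ‖W b - W a‖ₑ ≤ D * ∫⁻ t in Ioc (0 : ℝ) 1, G (a + t • (b - a))) :
    ∫⁻ a in Q, ∫⁻ b in Q, ‖W b - W a‖ₑ ∂μ ∂μ ≤
      D * (2 ^ Module.finrank ℝ E * μ Q * ∫⁻ b in Q, G b ∂μ) := by
  have hjoint : Measurable fun p : (E × E) × ℝ => G (p.1.1 + p.2 • (p.1.2 - p.1.1)) := by fun_prop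
  have hj2 : ∀ a, Measurable fun p : E × ℝ => G (a + p.2 • (p.1 - a)) := fun a => by fun_prop
  have hj3 : Measurable fun p : E × ℝ => ∫⁻ b in Q, G (p.1 + p.2 • (b - p.1)) ∂μ := by
    refine Measurable.lintegral_prod_right' (f := fun q : (E × ℝ) × E =>
      G (q.1.1 + q.1.2 • (q.2 - q.1.1))) (by fun_prop)
  have hj4 : ∀ t : ℝ, Measurable fun p : E × E => G (p.1 + t • (p.2 - p.1)) := fun t => by fun_prop
  have hj5 : Measurable fun a : E => ∫⁻ b in Q, (∫⁻ t in Ioc (0 : ℝ) 1, G (a + t • (b - a))) ∂μ := by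
    refine Measurable.lintegral_prod_right' (f := fun p : E × E =>
      ∫⁻ t in Ioc (0 : ℝ) 1, G (p.1 + t • (p.2 - p.1))) ?_
    exact Measurable.lintegral_prod_right' hjoint
  have hconst : ∀ t ∈ Ioc (0 : ℝ) 1, ∫⁻ a in Q, ∫⁻ b in Q, G (a + t • (b - a)) ∂μ ∂μ ≤
      2 ^ Module.finrank ℝ E * μ Q * ∫⁻ b in Q, G b ∂μ := by
    intro t ht
    have hint : ∀ (H : E → ℝ≥0∞) (c : ℝ≥0∞), (∀ a ∈ Q, H a ≤ c) →
        ∫⁻ a in Q, H a ∂μ ≤ c * μ Q := fun H c hH =>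
      (setLIntegral_mono_ae' hQm (Eventually.of_forall hH)).trans
        (by rw [setLIntegral_const])
    rcases le_total (1 / 2) t with h2 | h2
    · refine (hint _ _ fun a ha => lintegral_segment_le hQ hQm hG ha h2 ht.2).trans (le_of_eq ?_)
      ring
    -- For `t ≤ 1/2` the contraction towards `a` has no bounded Jacobian; seen from `b`, the same
    -- point has parameter `1 - t ≥ 1/2`.
    · rw [lintegral_lintegral_swap (hj4 t).aemeasurable]
      refine (hint _ (2 ^ Module.finrank ℝ E * ∫⁻ b in Q, G b ∂μ) fun b hb => ?_).trans
        (le_of_eq (by ring))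
      have e : ∀ a, a + t • (b - a) = b + (1 - t) • (a - b) := fun a => by
        rw [sub_smul, one_smul, smul_sub, smul_sub]; abel
      simp only [e]
      exact lintegral_segment_le hQ hQm hG hb (by linarith) (by linarith [ht.1])
  calc ∫⁻ a in Q, ∫⁻ b in Q, ‖W b - W a‖ₑ ∂μ ∂μ
      ≤ ∫⁻ a in Q, ∫⁻ b in Q, D * (∫⁻ t in Ioc (0 : ℝ) 1, G (a + t • (b - a))) ∂μ ∂μ :=
        setLIntegral_mono_ae' hQm (Eventually.of_forall fun a ha =>
          setLIntegral_mono_ae' hQm (Eventually.of_forall fun b hb => h a ha b hb))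
    _ = D * ∫⁻ a in Q, ∫⁻ b in Q, (∫⁻ t in Ioc (0 : ℝ) 1, G (a + t • (b - a))) ∂μ ∂μ := by
        rw [← lintegral_const_mul _ hj5]
        congr 1
        ext a
        rw [lintegral_const_mul]
        exact Measurable.lintegral_prod_right' (hj2 a)
    _ = D * ∫⁻ t in Ioc (0 : ℝ) 1, ∫⁻ a in Q, ∫⁻ b in Q, G (a + t • (b - a)) ∂μ ∂μ := by
        congr 1
        rw [lintegral_lintegral_swap (f := fun t a => ∫⁻ b in Q, G (a + t • (b - a)) ∂μ)
          (hj3.comp measurable_swap).aemeasurable]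
        congr 1
        ext a
        rw [lintegral_lintegral_swap]
        exact (hj2 a).aemeasurable
    _ ≤ D * ∫⁻ t in Ioc (0 : ℝ) 1, 2 ^ Module.finrank ℝ E * μ Q * ∫⁻ b in Q, G b ∂μ := by
        gcongr 1
        exact setLIntegral_mono_ae' measurableSet_Ioc (Eventually.of_forall hconst)
    _ = _ := by simp

end UpperGradient

/-! ### Distortion of volume by bi-Lipschitz maps. -/

section LipschitzMeasure

open Shell

/-- For the sup metric the top-dimensional Hausdorff measure is exactly Lebesgue measure, so no
dimensional constant appears. -/
lemma LipschitzOnWith.volume_image_le_pi {ι : Type*} [Fintype ι] {K : ℝ≥0} {f : (ι → ℝ) → ι → ℝ}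
    {s : Set (ι → ℝ)} (hf : LipschitzOnWith K f s) :
    volume (f '' s) ≤ (K : ℝ≥0∞) ^ Fintype.card ι * volume s := by
  have := hf.hausdorffMeasure_image_le (d := Fintype.card ι) (by positivity)
  rwa [hausdorffMeasure_pi_real, ENNReal.rpow_natCast] at this

lemma lipschitzWith_toLp_two : LipschitzWith 2 (WithLp.toLp 2 : (Fin 3 → ℝ) → E3) := by
  refine (PiLp.lipschitzWith_toLp 2 (fun _ : Fin 3 => ℝ)).weaken ?_
  rw [← NNReal.coe_le_coe]
  simp only [Fintype.card_fin, NNReal.coe_rpow, NNReal.coe_natCast, NNReal.coe_ofNat]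
  have : (1 / 2 : ℝ≥0∞).toReal = 1 / 2 := by simp
  rw [this, ← Real.sqrt_eq_rpow, Real.sqrt_le_left (by norm_num)]
  norm_num

/-- The source carries the sup metric and the target the Euclidean one; passing to coordinates in
the target is 1-Lipschitz and volume preserving. -/
lemma LipschitzOnWith.volume_image_le {K : ℝ≥0} {F : (Fin 3 → ℝ) → E3} {s : Set (Fin 3 → ℝ)}
    (hF : LipschitzOnWith K F s) : volume (F '' s) ≤ (K : ℝ≥0∞) ^ 3 * volume s := by
  have h1 : LipschitzOnWith (1 * K) (fun x => WithLp.ofLp (F x)) s :=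
    (PiLp.lipschitzWith_ofLp 2 (fun _ : Fin 3 => ℝ)).comp_lipschitzOnWith hF
  have h2 := h1.volume_image_le_pi
  rw [one_mul, Fintype.card_fin] at h2
  refine le_trans (le_of_eq ?_) h2
  have e : (fun x => WithLp.ofLp (F x)) '' s = (WithLp.toLp 2 : (Fin 3 → ℝ) → E3) ⁻¹' (F '' s) := by
    ext y
    constructor
    · rintro ⟨x, hx, rfl⟩; exact ⟨x, hx, rfl⟩
    · rintro ⟨x, hx, h⟩; exact ⟨x, hx, by simp [h]⟩
  rw [e]
  exact ((EuclideanSpace.volume_preserving_symm_measurableEquiv_toLp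
    (Fin 3)).symm.measure_preimage_equiv _).symm

/-- The inverse of `F` on its image is `K`-Lipschitz for the Euclidean metric; the extra factor 2 ≥
√3 is the cost of replacing that metric by the sup metric. -/
lemma volume_le_of_antilipschitzOn {K : ℝ≥0} {F : (Fin 3 → ℝ) → E3} {s : Set (Fin 3 → ℝ)}
    (hF : ∀ a ∈ s, ∀ b ∈ s, dist a b ≤ K * dist (F a) (F b)) :
    volume s ≤ ((K * 2 : ℝ≥0) : ℝ≥0∞) ^ 3 * volume (F '' s) := by
  set g := Function.invFunOn F s with hg
  have hinj : InjOn F s := fun a ha b hb hab => by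
    have := hF a ha b hb
    rw [hab, dist_self, mul_zero] at this
    exact dist_le_zero.1 this
  have hgF : ∀ a ∈ s, g (F a) = a := fun a ha => hinj.leftInvOn_invFunOn ha
  have h1 : LipschitzOnWith K g (F '' s) := by
    refine LipschitzOnWith.of_dist_le_mul ?_
    rintro _ ⟨a, ha, rfl⟩ _ ⟨b, hb, rfl⟩
    rw [hgF a ha, hgF b hb]
    exact hF a ha b hb
  have h2 : LipschitzOnWith (K * 2) (fun x => g (WithLp.toLp 2 x))
      ((WithLp.toLp 2 : (Fin 3 → ℝ) → E3) ⁻¹' (F '' s)) :=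
    h1.comp lipschitzWith_toLp_two.lipschitzOnWith (mapsTo_preimage _ _)
  have h3 := h2.volume_image_le_pi
  rw [Fintype.card_fin] at h3
  have e : (fun x => g (WithLp.toLp 2 x)) '' ((WithLp.toLp 2 : (Fin 3 → ℝ) → E3) ⁻¹' (F '' s)) = s := by
    ext a
    constructor
    · rintro ⟨x, ⟨b, hb, hx⟩, rfl⟩
      simp only [← hx, hgF b hb, hb]
    · intro ha
      exact ⟨WithLp.ofLp (F a), ⟨a, ha, rfl⟩, by simp [hgF a ha]⟩
  rw [e] at h3
  refine h3.trans (le_of_eq ?_)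
  congr 1
  exact (EuclideanSpace.volume_preserving_symm_measurableEquiv_toLp
    (Fin 3)).symm.measure_preimage_equiv _

/-- A bi-Lipschitz map quasi-preserves Lebesgue measure. -/
lemma map_restrict_le_of_antilipschitzOn {K : ℝ≥0} {F : (Fin 3 → ℝ) → E3} {s : Set (Fin 3 → ℝ)}
    (hs : MeasurableSet s) (hFc : ContinuousOn F s)
    (hF : ∀ a ∈ s, ∀ b ∈ s, dist a b ≤ K * dist (F a) (F b)) :
    (volume.restrict s).map F ≤
      (((K * 2 : ℝ≥0) : ℝ≥0∞) ^ 3) • volume.restrict (F '' s) := by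
  have hFm : AEMeasurable F (volume.restrict s) := hFc.aemeasurable hs
  refine Measure.le_iff.2 fun A hA => ?_
  rw [Measure.map_apply_of_aemeasurable hFm hA]
  -- Since `F` is continuous only on `s`, the preimage is measurable only relative to `s`.
  obtain ⟨t, ht, hts⟩ : ∃ t, MeasurableSet t ∧ F ⁻¹' A ∩ s = t ∩ s := by
    have hFs : Measurable (s.domRestrict F) := (continuousOn_iff_continuous_domRestrict.1 hFc).measurable
    obtain ⟨t, ht, hte⟩ := hFs hA
    refine ⟨t, ht, ?_⟩
    ext x
    constructor
    · rintro ⟨hx, hxs⟩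
      have : (⟨x, hxs⟩ : s) ∈ s.domRestrict F ⁻¹' A := hx
      rw [← hte] at this
      exact ⟨this, hxs⟩
    · rintro ⟨hx, hxs⟩
      have : (⟨x, hxs⟩ : s) ∈ Subtype.val ⁻¹' t := hx
      rw [hte] at this
      exact ⟨this, hxs⟩
  rw [Measure.restrict_apply' hs, Measure.smul_apply, smul_eq_mul, Measure.restrict_apply hA]
  refine (volume_le_of_antilipschitzOn (K := K) fun a ha b hb => hF a ha.2 b hb.2).trans ?_
  gcongr
  rintro _ ⟨x, ⟨hxA, hxs⟩, rfl⟩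
  exact ⟨hxA, x, hxs, rfl⟩

lemma lintegral_comp_le_of_antilipschitzOn {K : ℝ≥0} {F : (Fin 3 → ℝ) → E3} {s : Set (Fin 3 → ℝ)}
    (hs : MeasurableSet s) (hFc : ContinuousOn F s)
    (hF : ∀ a ∈ s, ∀ b ∈ s, dist a b ≤ K * dist (F a) (F b)) {f : E3 → ℝ≥0∞}
    (hf : AEMeasurable f (volume.restrict (F '' s))) :
    ∫⁻ a in s, f (F a) ≤ ((K * 2 : ℝ≥0) : ℝ≥0∞) ^ 3 * ∫⁻ x in F '' s, f x := by
  have hle := map_restrict_le_of_antilipschitzOn hs hFc hF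
  have hf' : AEMeasurable f ((volume.restrict s).map F) :=
    hf.mono_ac ((Measure.absolutelyContinuous_of_le hle).trans
      (Measure.smul_absolutelyContinuous))
  rw [← lintegral_map' hf' (hFc.aemeasurable hs)]
  refine (lintegral_mono' hle le_rfl).trans (le_of_eq ?_)
  rw [lintegral_smul_measure]
  rfl

end LipschitzMeasure

/-! ### The Poincaré inequality on bi-Lipschitz images of convex sets. -/

section PatchPoincare

open Shell

lemma enorm_fderiv_le_sum (f : E3 →L[ℝ] ℝ) :
    ‖f‖ₑ ≤ ∑ i : Fin 3, ‖f (EuclideanSpace.single i 1)‖ₑ := by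
  have h : ‖f‖ ≤ ∑ i : Fin 3, ‖f (EuclideanSpace.single i 1)‖ := by
    refine f.opNorm_le_bound (Finset.sum_nonneg fun _ _ => norm_nonneg _) fun x => ?_
    have hx : x = ∑ i : Fin 3, x i • EuclideanSpace.single i (1 : ℝ) := by
      ext j
      simp [Pi.single_apply]
    have hx' : f x = ∑ i : Fin 3, x i * f (EuclideanSpace.single i 1) := by
      conv_lhs => rw [hx]
      simp only [map_sum, map_smul, smul_eq_mul]
    rw [hx', Finset.sum_mul]
    refine (norm_sum_le _ _).trans (Finset.sum_le_sum fun i _ => ?_)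
    rw [norm_mul, mul_comm]
    gcongr
    exact PiLp.norm_apply_le x i
  simp only [← ofReal_norm]
  rw [← ENNReal.ofReal_sum_of_nonneg fun _ _ => norm_nonneg _]
  exact ENNReal.ofReal_le_ofReal h

/-- Freezing the segment outside [0, 1] by `projIcc` makes the curve Lipschitz on all of ℝ, as
`enorm_sub_le_lintegral_fderiv_along` requires. -/
lemma LipschitzOnWith.lipschitzWith_comp_segment {L : ℝ≥0} {F : (Fin 3 → ℝ) → E3}
    {Q : Set (Fin 3 → ℝ)} (hF : LipschitzOnWith L F Q) (hQ : Convex ℝ Q) {a b : Fin 3 → ℝ}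
    (ha : a ∈ Q) (hb : b ∈ Q) :
    LipschitzWith (L * nndist a b) fun t : ℝ =>
      F (a + (projIcc (0 : ℝ) 1 zero_le_one t : ℝ) • (b - a)) := by
  have hmem : ∀ t : ℝ, a + (projIcc (0 : ℝ) 1 zero_le_one t : ℝ) • (b - a) ∈ Q := fun t =>
    hQ.add_smul_sub_mem ha hb (projIcc (0 : ℝ) 1 zero_le_one t).2
  refine LipschitzWith.of_dist_le_mul fun s t => ?_
  refine (hF.dist_le_mul _ (hmem s) _ (hmem t)).trans ?_
  rw [NNReal.coe_mul, coe_nndist, mul_assoc]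
  gcongr
  rw [dist_add_left, dist_eq_norm, ← sub_smul, norm_smul, dist_comm a b, dist_eq_norm b a, mul_comm]
  gcongr
  exact (LipschitzWith.projIcc zero_le_one).dist_le_mul s t |>.trans (by simp)

/-- The Poincaré inequality for `C¹` functions on a Lipschitz image of a convex compact set. -/
lemma poincare_comp_of_contDiff {L : ℝ≥0} {F : (Fin 3 → ℝ) → E3} {Q : Set (Fin 3 → ℝ)}
    (hF : LipschitzOnWith L F Q) (hQ : Convex ℝ Q) (hQc : IsCompact Q) {d : ℝ≥0}
    (hd : ∀ a ∈ Q, ∀ b ∈ Q, nndist a b ≤ d) {w : E3 → ℝ} (hw : ContDiff ℝ 1 w) :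
    ∫⁻ a in Q, ∫⁻ b in Q, ‖w (F b) - w (F a)‖ₑ ≤
      ((L * d : ℝ≥0) : ℝ≥0∞) * (8 * volume Q * ∫⁻ z in Q, ‖fderiv ℝ w (F z)‖ₑ) := by
  have hQm := hQc.measurableSet
  have hcont : ContinuousOn (fun z => ‖fderiv ℝ w (F z)‖ₑ) Q :=
    continuous_enorm.comp_continuousOn
      ((hw.continuous_fderiv (by simp)).comp_continuousOn hF.continuousOn)
  have hGm : Measurable (Q.indicator fun z => ‖fderiv ℝ w (F z)‖ₑ) := by
    classical
    rw [← piecewise_eq_indicator]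
    exact hcont.measurable_piecewise continuousOn_const hQm
  have h := lintegral_lintegral_enorm_sub_le (μ := volume) hQ hQm (fun a => w (F a)) hGm
    (D := ((L * d : ℝ≥0) : ℝ≥0∞)) fun a ha b hb => ?_
  · rw [Module.finrank_fin_fun, setLIntegral_indicator hQm, inter_self] at h
    refine h.trans (le_of_eq ?_)
    norm_num
  have h1 := enorm_sub_le_lintegral_fderiv_along hw (hF.lipschitzWith_comp_segment hQ ha hb)
  simp only [projIcc_right (zero_le_one (α := ℝ)), projIcc_left (zero_le_one (α := ℝ)), one_smul,
    zero_smul, add_sub_cancel, add_zero] at h1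
  refine h1.trans ?_
  refine mul_le_mul' (by gcongr; exact hd a ha b hb) ?_
  refine setLIntegral_mono_ae' measurableSet_Ioc (Eventually.of_forall fun t ht => ?_)
  have ht' : t ∈ Icc (0 : ℝ) 1 := Ioc_subset_Icc_self ht
  rw [projIcc_of_mem zero_le_one ht', indicator_of_mem (hQ.add_smul_sub_mem ha hb ht')]

/-- Preimages of null sets under an antilipschitz map are null, so almost everywhere classes can be
composed with `F`. -/
lemma aestronglyMeasurable_comp_of_antilipschitzOn {K : ℝ≥0} {F : (Fin 3 → ℝ) → E3}
    {s : Set (Fin 3 → ℝ)} (hs : MeasurableSet s) (hFc : ContinuousOn F s)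
    (hF : ∀ a ∈ s, ∀ b ∈ s, dist a b ≤ K * dist (F a) (F b)) {f : E3 → ℝ}
    (hf : AEStronglyMeasurable f (volume.restrict (F '' s))) :
    AEStronglyMeasurable (fun a => f (F a)) (volume.restrict s) := by
  refine AEStronglyMeasurable.comp_aemeasurable (hf.mono_ac ?_) (hFc.aemeasurable hs)
  exact (Measure.absolutelyContinuous_of_le (map_restrict_le_of_antilipschitzOn hs hFc hF)).trans
    (Measure.smul_absolutelyContinuous)

/-- The Poincaré inequality for Sobolev functions on a bi-Lipschitz image of a convex compact
set. -/
lemma poincare_comp_of_hasWeakDeriv {L : ℝ≥0} {F : (Fin 3 → ℝ) → E3} {Q : Set (Fin 3 → ℝ)}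
    {Ω : Set E3} (hF : LipschitzOnWith L F Q)
    (hF' : ∀ a ∈ Q, ∀ b ∈ Q, dist a b ≤ L * dist (F a) (F b)) (hQ : Convex ℝ Q)
    (hQc : IsCompact Q) {d : ℝ≥0} (hd : ∀ a ∈ Q, ∀ b ∈ Q, nndist a b ≤ d) (hΩ : IsOpen Ω)
    (hQΩ : F '' Q ⊆ Ω) {u : E3 → ℝ} {D : Fin 3 → E3 → ℝ} (hu : IntegrableOn u Ω)
    (hDi : ∀ i, IntegrableOn (D i) Ω)
    (hD : ∀ i, HasWeakDeriv volume Ω u (EuclideanSpace.single i 1) (D i)) :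
    ∫⁻ a in Q, ∫⁻ b in Q, ‖u (F b) - u (F a)‖ₑ ≤
      ((L * d : ℝ≥0) : ℝ≥0∞) * (8 * volume Q * ∫⁻ z in Q, ∑ i, ‖D i (F z)‖ₑ) := by
  have hQm := hQc.measurableSet
  have hQf : volume Q ≠ ⊤ := hQc.measure_lt_top.ne
  have hKc : IsCompact (F '' Q) := hQc.image_of_continuousOn hF.continuousOn
  set w := mollify volume (Ω.indicator u) with hw
  have hwc : ∀ k, ContDiff ℝ 1 (w k) := fun k =>
    contDiff_mollify (hu.integrable_indicator hΩ.measurableSet) k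
  have hwd : ∀ k i, Continuous fun x => fderiv ℝ (w k) x (EuclideanSpace.single i 1) := fun k i =>
    ((hwc k).continuous_fderiv_apply (by simp)).comp (continuous_id.prodMk continuous_const)
  set M : ℝ≥0∞ := ((L * 2 : ℝ≥0) : ℝ≥0∞) ^ 3 with hM
  have hMf : M ≠ ⊤ := ENNReal.pow_ne_top ENNReal.coe_ne_top
  set ε : ℕ → ℝ≥0∞ := fun k => M * ∫⁻ x in Ω, ‖w k x - u x‖ₑ with hε
  set δ : ℕ → Fin 3 → ℝ≥0∞ := fun k i =>
    M * ∫⁻ x in F '' Q, ‖fderiv ℝ (w k) x (EuclideanSpace.single i 1) - D i x‖ₑ with hδ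
  have hε0 : Tendsto ε atTop (𝓝 0) := by
    simpa using ENNReal.Tendsto.const_mul (tendsto_setLIntegral_mollify_sub hΩ.measurableSet hu)
      (Or.inr hMf)
  have hδ0 : ∀ i, Tendsto (fun k => δ k i) atTop (𝓝 0) := fun i => by
    simpa using ENNReal.Tendsto.const_mul
      (tendsto_lintegral_fderiv_mollify_sub hΩ hKc hQΩ hu (hDi i) (hD i)) (Or.inr hMf)
  have huK : IntegrableOn u (F '' Q) := hu.mono_set hQΩ
  have hDK : ∀ i, IntegrableOn (D i) (F '' Q) := fun i => (hDi i).mono_set hQΩ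
  have hcm : ∀ f : E3 → ℝ, AEStronglyMeasurable f (volume.restrict (F '' Q)) →
      AEStronglyMeasurable (fun a => f (F a)) (volume.restrict Q) := fun f hf =>
    aestronglyMeasurable_comp_of_antilipschitzOn hQm hF.continuousOn hF' hf
  have hεle : ∀ k, ∫⁻ a in Q, ‖w k (F a) - u (F a)‖ₑ ≤ ε k := fun k =>
    (lintegral_comp_le_of_antilipschitzOn hQm hF.continuousOn hF'
      (f := fun x => ‖w k x - u x‖ₑ)
      ((hwc k).continuous.aestronglyMeasurable.sub huK.1).enorm).trans
        (by simp only [hε]; gcongr)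
  have hδle : ∀ k i,
      ∫⁻ a in Q, ‖fderiv ℝ (w k) (F a) (EuclideanSpace.single i 1) - D i (F a)‖ₑ ≤ δ k i :=
    fun k i => lintegral_comp_le_of_antilipschitzOn hQm hF.continuousOn hF'
      (f := fun x => ‖fderiv ℝ (w k) x (EuclideanSpace.single i 1) - D i x‖ₑ)
      ((hwd k i).aestronglyMeasurable.sub (hDK i).1).enorm
  set G : ℝ≥0∞ := ∫⁻ z in Q, ∑ i, ‖D i (F z)‖ₑ with hG
  -- The inequality for the mollified function, with errors: `ε k` for the values at `a` and at `b`,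
  -- `δ k i` for the partial derivatives. All errors vanish as `k → ∞`.
  have hstep : ∀ k, ∫⁻ a in Q, ∫⁻ b in Q, ‖u (F b) - u (F a)‖ₑ ≤
      volume Q * ε k + volume Q * ε k +
        ((L * d : ℝ≥0) : ℝ≥0∞) * (8 * volume Q * (G + ∑ i, δ k i)) := by
    intro k
    set p : (Fin 3 → ℝ) → ℝ≥0∞ := fun a => ‖w k (F a) - u (F a)‖ₑ with hp
    have hpm : AEMeasurable p (volume.restrict Q) :=
      (hcm _ ((hwc k).continuous.aestronglyMeasurable.sub huK.1)).enorm
    have hfd : ∫⁻ z in Q, ‖fderiv ℝ (w k) (F z)‖ₑ ≤ G + ∑ i, δ k i := by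
      calc ∫⁻ z in Q, ‖fderiv ℝ (w k) (F z)‖ₑ
          ≤ ∫⁻ z in Q, (∑ i, ‖D i (F z)‖ₑ +
            ∑ i, ‖fderiv ℝ (w k) (F z) (EuclideanSpace.single i 1) - D i (F z)‖ₑ) := by
              refine lintegral_mono fun z => (enorm_fderiv_le_sum _).trans ?_
              rw [← Finset.sum_add_distrib]
              refine Finset.sum_le_sum fun i _ => ?_
              refine le_trans (le_of_eq ?_) (enorm_add_le _ _)
              rw [add_sub_cancel]
        _ = G + ∑ i, ∫⁻ z in Q,
              ‖fderiv ℝ (w k) (F z) (EuclideanSpace.single i 1) - D i (F z)‖ₑ := by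
              rw [lintegral_add_left', lintegral_finsetSum'
                (f := fun i z => ‖fderiv ℝ (w k) (F z) (EuclideanSpace.single i 1) - D i (F z)‖ₑ)]
              · exact fun i _ => (hcm _ ((hwd k i).aestronglyMeasurable.sub (hDK i).1)).enorm
              · exact Finset.aemeasurable_fun_sum _ fun i _ => (hcm _ (hDK i).1).enorm
        _ ≤ _ := by gcongr with i; exact hδle k i
    calc ∫⁻ a in Q, ∫⁻ b in Q, ‖u (F b) - u (F a)‖ₑ
        ≤ ∫⁻ a in Q, ∫⁻ b in Q, (p a + p b + ‖w k (F b) - w k (F a)‖ₑ) := by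
          refine lintegral_mono fun a => lintegral_mono fun b => ?_
          have e : u (F b) - u (F a) = (w k (F a) - u (F a)) - (w k (F b) - u (F b))
            + (w k (F b) - w k (F a)) := by ring
          rw [e]
          exact (enorm_add_le _ _).trans (add_le_add enorm_sub_le le_rfl)
      _ = ∫⁻ a in Q, (p a * volume Q + (∫⁻ b in Q, p b) +
            ∫⁻ b in Q, ‖w k (F b) - w k (F a)‖ₑ) := by
          congr 1
          ext a
          rw [lintegral_add_left', lintegral_add_left' aemeasurable_const, setLIntegral_const]
          exact aemeasurable_const.add hpm
      _ = (∫⁻ a in Q, p a) * volume Q + (∫⁻ b in Q, p b) * volume Q +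
            ∫⁻ a in Q, ∫⁻ b in Q, ‖w k (F b) - w k (F a)‖ₑ := by
          rw [lintegral_add_left', lintegral_add_left' (hpm.mul_const _),
            lintegral_mul_const' _ _ hQf, setLIntegral_const]
          exact (hpm.mul_const _).add aemeasurable_const
      _ ≤ _ := by
          rw [mul_comm _ (volume Q)]
          gcongr
          · exact hεle k
          · exact hεle k
          · exact (poincare_comp_of_contDiff hF hQ hQc hd (hwc k)).trans (by gcongr)
  refine ge_of_tendsto' (x := atTop) (f := fun k => volume Q * ε k + volume Q * ε k +
        ((L * d : ℝ≥0) : ℝ≥0∞) * (8 * volume Q * (G + ∑ i, δ k i))) ?_ hstep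
  have h1 : Tendsto (fun k => volume Q * ε k) atTop (𝓝 0) := by
    simpa using ENNReal.Tendsto.const_mul hε0 (Or.inr hQf)
  have h2 : Tendsto (fun k => G + ∑ i, δ k i) atTop (𝓝 G) := by
    have := tendsto_finsetSum Finset.univ fun i _ => hδ0 i
    simpa using tendsto_const_nhds.add this
  have h3 := ENNReal.Tendsto.const_mul (ENNReal.Tendsto.const_mul h2
    (Or.inr (ENNReal.mul_ne_top (by simp) hQf : 8 * volume Q ≠ ⊤)))
    (Or.inr (ENNReal.coe_ne_top (r := L * d)))
  simpa using (h1.add h1).add h3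

end PatchPoincare

/-! ### Sub-boxes adapted to thin boxes, and their volumes. -/

section SubBoxes

variable {p q a b : Fin 3 → ℝ} {ρ σ : ℝ}

/-- The open box with corners `p` and `q`. -/
def openBox (p q : Fin 3 → ℝ) : Set (Fin 3 → ℝ) := univ.pi fun i => Ioo (p i) (q i)

/-- The volume of the part of a box near one of its points, at scale `ρ`, up to a factor. -/
noncomputable def boxVol (p q : Fin 3 → ℝ) (ρ : ℝ) : ℝ≥0∞ :=
  ∏ i, ENNReal.ofReal (min ρ ((q i - p i) / 2))

/-- The shrinking factors of `subBox`. -/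
noncomputable def subBoxRatio (p q : Fin 3 → ℝ) (ρ : ℝ) (i : Fin 3) : ℝ :=
  min (ρ / (q i - p i)) (1 / 2)

/-- The lower corner of `subBox`. -/
noncomputable def subBoxLo (p q a : Fin 3 → ℝ) (ρ : ℝ) (i : Fin 3) : ℝ :=
  a i - subBoxRatio p q ρ i * (a i - p i)

/-- The upper corner of `subBox`. -/
noncomputable def subBoxHi (p q a : Fin 3 → ℝ) (ρ : ℝ) (i : Fin 3) : ℝ :=
  a i + subBoxRatio p q ρ i * (q i - a i)

/-- A compact box inside `openBox p q` which contains the point `a`, of side lengths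
`min ρ ((q i - p i) / 2)`. -/
def subBox (p q a : Fin 3 → ℝ) (ρ : ℝ) : Set (Fin 3 → ℝ) :=
  Icc (subBoxLo p q a ρ) (subBoxHi p q a ρ)

lemma mem_openBox : a ∈ openBox p q ↔ ∀ i, p i < a i ∧ a i < q i := by
  simp [openBox, Set.mem_pi]

lemma isOpen_openBox : IsOpen (openBox p q) := isOpen_set_pi finite_univ fun _ _ => isOpen_Ioo

lemma measurableSet_openBox : MeasurableSet (openBox p q) := isOpen_openBox.measurableSet

lemma subBoxRatio_pos (ha : a ∈ openBox p q) (hρ : 0 < ρ) (i : Fin 3) : 0 < subBoxRatio p q ρ i := by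
  have := mem_openBox.1 ha i
  exact lt_min (div_pos hρ (by linarith)) (by norm_num)

lemma subBoxRatio_le (i : Fin 3) : subBoxRatio p q ρ i ≤ 1 / 2 := min_le_right _ _

lemma subBoxRatio_mul (ha : a ∈ openBox p q) (i : Fin 3) :
    subBoxRatio p q ρ i * (q i - p i) = min ρ ((q i - p i) / 2) := by
  have := mem_openBox.1 ha i
  have h : 0 < q i - p i := by linarith
  rw [subBoxRatio, min_mul_of_nonneg _ _ h.le, div_mul_cancel₀ _ h.ne']
  congr 1; ring

lemma subBoxRatio_mono (ha : a ∈ openBox p q) (h : ρ ≤ σ) (i : Fin 3) :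
    subBoxRatio p q ρ i ≤ subBoxRatio p q σ i := by
  have := mem_openBox.1 ha i
  have h : 0 < q i - p i := by linarith
  exact min_le_min_right _ (by gcongr)

lemma subBoxHi_sub_subBoxLo (ha : a ∈ openBox p q) (i : Fin 3) :
    subBoxHi p q a ρ i - subBoxLo p q a ρ i = min ρ ((q i - p i) / 2) := by
  rw [← subBoxRatio_mul ha, subBoxHi, subBoxLo]; ring

lemma subBoxLo_le (ha : a ∈ openBox p q) (hρ : 0 < ρ) (i : Fin 3) : subBoxLo p q a ρ i ≤ a i := by
  have h := mem_openBox.1 ha i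
  have := mul_pos (subBoxRatio_pos ha hρ i) (sub_pos.2 h.1)
  rw [subBoxLo]; linarith

lemma le_subBoxHi (ha : a ∈ openBox p q) (hρ : 0 < ρ) (i : Fin 3) : a i ≤ subBoxHi p q a ρ i := by
  have h := mem_openBox.1 ha i
  have := mul_pos (subBoxRatio_pos ha hρ i) (sub_pos.2 h.2)
  rw [subBoxHi]; linarith

lemma lt_subBoxLo (ha : a ∈ openBox p q) (i : Fin 3) : p i < subBoxLo p q a ρ i := by
  have h := mem_openBox.1 ha i
  have := mul_le_mul_of_nonneg_right (subBoxRatio_le (p := p) (q := q) (ρ := ρ) i)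
    (sub_pos.2 h.1).le
  rw [subBoxLo]; linarith

lemma subBoxHi_lt (ha : a ∈ openBox p q) (i : Fin 3) : subBoxHi p q a ρ i < q i := by
  have h := mem_openBox.1 ha i
  have := mul_le_mul_of_nonneg_right (subBoxRatio_le (p := p) (q := q) (ρ := ρ) i)
    (sub_pos.2 h.2).le
  rw [subBoxHi]; linarith

lemma mem_subBox (ha : a ∈ openBox p q) (hρ : 0 < ρ) : a ∈ subBox p q a ρ :=
  ⟨fun i => subBoxLo_le ha hρ i, fun i => le_subBoxHi ha hρ i⟩

lemma Icc_subset_openBox {l u : Fin 3 → ℝ} (hl : ∀ i, p i < l i) (hu : ∀ i, u i < q i) :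
    Icc l u ⊆ openBox p q := fun _ hx =>
  mem_openBox.2 fun i => ⟨(hl i).trans_le (hx.1 i), (hx.2 i).trans_lt (hu i)⟩

lemma subBox_subset_openBox (ha : a ∈ openBox p q) : subBox p q a ρ ⊆ openBox p q :=
  Icc_subset_openBox (fun i => lt_subBoxLo ha i) (fun i => subBoxHi_lt ha i)

lemma subBox_mono (ha : a ∈ openBox p q) (h : ρ ≤ σ) : subBox p q a ρ ⊆ subBox p q a σ := by
  refine Icc_subset_Icc (fun i => ?_) (fun i => ?_)
  · have h1 := mem_openBox.1 ha i
    have := mul_le_mul_of_nonneg_right (subBoxRatio_mono ha h i) (sub_pos.2 h1.1).le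
    simp only [subBoxLo]; linarith
  · have h1 := mem_openBox.1 ha i
    have := mul_le_mul_of_nonneg_right (subBoxRatio_mono ha h i) (sub_pos.2 h1.2).le
    simp only [subBoxHi]; linarith

lemma dist_le_of_mem_subBox (ha : a ∈ openBox p q) (hρ : 0 < ρ) {x y : Fin 3 → ℝ}
    (hx : x ∈ subBox p q a ρ) (hy : y ∈ subBox p q a ρ) : dist x y ≤ ρ := by
  refine (dist_pi_le_iff hρ.le).2 fun i => ?_
  have h1 := subBoxHi_sub_subBoxLo (ρ := ρ) ha i
  have h2 : min ρ ((q i - p i) / 2) ≤ ρ := min_le_left _ _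
  rw [Real.dist_eq, abs_le]
  constructor <;> linarith [hx.1 i, hx.2 i, hy.1 i, hy.2 i]

lemma subBox_subset_closedBall (ha : a ∈ openBox p q) (hρ : 0 < ρ) :
    subBox p q a ρ ⊆ closedBall a ρ := fun _ hx =>
  dist_le_of_mem_subBox ha hρ hx (mem_subBox ha hρ)

/-- The volume does not depend on the point `a`, which makes `boxVol` a common yardstick for all
points of a box, even near its faces. -/
lemma volume_subBox (ha : a ∈ openBox p q) : volume (subBox p q a ρ) = boxVol p q ρ := by
  rw [subBox, Real.volume_Icc_pi, boxVol]
  simp only [subBoxHi_sub_subBoxLo ha]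

lemma boxVol_pos (ha : a ∈ openBox p q) (hρ : 0 < ρ) : boxVol p q ρ ≠ 0 := by
  refine (CanonicallyOrderedAdd.prod_pos.2 fun i _ => ?_).ne'
  have := mem_openBox.1 ha i
  exact ENNReal.ofReal_pos.2 (lt_min hρ (by linarith))

/-- Each factor min(ρ, side/2) grows at most by `c`. The constant ignores the side lengths; this is
the source of uniformity in the thickness. -/
lemma boxVol_mul_le (ha : a ∈ openBox p q) {c : ℝ} (hc : 1 ≤ c) :
    boxVol p q (c * ρ) ≤ ENNReal.ofReal c ^ 3 * boxVol p q ρ := by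
  have : ENNReal.ofReal c ^ 3 = ∏ _i : Fin 3, ENNReal.ofReal c := by simp
  rw [this, boxVol, boxVol, ← Finset.prod_mul_distrib]
  refine Finset.prod_le_prod' fun i _ => ?_
  rw [← ENNReal.ofReal_mul (by linarith)]
  refine ENNReal.ofReal_le_ofReal ?_
  have := mem_openBox.1 ha i
  rw [mul_min_of_nonneg _ _ (by linarith)]
  refine min_le_min_left _ ?_
  nlinarith

/-- Each side of the intersection is at most min(2ρ, q i - p i), twice the corresponding factor of
`boxVol`. -/
lemma volume_openBox_inter_closedBall_le : 
    volume (openBox p q ∩ closedBall a ρ) ≤ 8 * boxVol p q ρ := by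
  have h1 : openBox p q ∩ closedBall a ρ ⊆
      Icc (fun i => max (p i) (a i - ρ)) (fun i => min (q i) (a i + ρ)) := by
    rintro x ⟨hx, hxa⟩
    have hρ : 0 ≤ ρ := dist_nonneg.trans hxa
    have h2 := (dist_pi_le_iff hρ).1 hxa
    refine ⟨fun i => max_le (mem_openBox.1 hx i).1.le ?_, fun i => le_min (mem_openBox.1 hx i).2.le ?_⟩
    · have := h2 i
      rw [Real.dist_eq, abs_le] at this; linarith
    · have := h2 i
      rw [Real.dist_eq, abs_le] at this; linarith
  refine (measure_mono h1).trans ?_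
  rw [Real.volume_Icc_pi]
  have : (8 : ℝ≥0∞) = ∏ _i : Fin 3, ENNReal.ofReal 2 := by simp; norm_num
  rw [this, boxVol, ← Finset.prod_mul_distrib]
  refine Finset.prod_le_prod' fun i _ => ?_
  rw [← ENNReal.ofReal_mul (by norm_num)]
  refine ENNReal.ofReal_le_ofReal ?_
  rw [mul_min_of_nonneg _ _ (by norm_num)]
  refine le_min ?_ ?_
  · linarith [min_le_right (q i) (a i + ρ), le_max_right (p i) (a i - ρ)]
  · linarith [min_le_left (q i) (a i + ρ), le_max_left (p i) (a i - ρ)]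

/-- Below the thickness of the box all sides equal ρ, so the sub-box is a sup-norm ball, not centred
at `a` but containing it. This makes Lebesgue differentiation applicable. -/
lemma subBox_eq_closedBall (ha : a ∈ openBox p q) (hρ : 0 < ρ) (h : ∀ i, ρ ≤ (q i - p i) / 2) :
    subBox p q a ρ = closedBall (fun i => (subBoxLo p q a ρ i + subBoxHi p q a ρ i) / 2) (ρ / 2) := by
  have h1 : ∀ i, subBoxHi p q a ρ i - subBoxLo p q a ρ i = ρ := fun i => by
    rw [subBoxHi_sub_subBoxLo ha, min_eq_left (h i)]
  ext x
  rw [mem_closedBall, dist_pi_le_iff (by linarith), subBox, mem_Icc, Pi.le_def, Pi.le_def,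
    ← forall_and]
  refine forall_congr' fun i => ?_
  have := h1 i
  rw [Real.dist_eq, abs_le]
  constructor <;> rintro ⟨h2, h3⟩ <;> constructor <;> linarith

/-- The averages of an integrable function over the boxes `subBox` converge almost everywhere. -/
lemma ae_tendsto_average_subBox {U : (Fin 3 → ℝ) → ℝ} (hU : IntegrableOn U (openBox p q)) :
    ∀ᵐ a, a ∈ openBox p q → ∀ ρ : ℝ, 0 < ρ →
      Tendsto (fun k : ℕ => ⨍ z in subBox p q a (ρ / 2 ^ k), U z) atTop (𝓝 (U a)) := by
  have hint : Integrable ((openBox p q).indicator U) :=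
    hU.integrable_indicator measurableSet_openBox
  filter_upwards [IsUnifLocDoublingMeasure.ae_tendsto_average volume hint.locallyIntegrable 1]
    with a h ha ρ hρ
  have hρk : ∀ k : ℕ, 0 < ρ / 2 ^ k := fun k => by positivity
  have hlim : Tendsto (fun k : ℕ => ρ / 2 ^ k) atTop (𝓝 0) := by
    have := (tendsto_pow_atTop_nhds_zero_of_lt_one (r := (1 / 2 : ℝ)) (by norm_num)
      (by norm_num)).const_mul ρ
    simpa [div_eq_mul_inv] using this
  have hsmall : ∀ᶠ k : ℕ in atTop, ∀ i, ρ / 2 ^ k ≤ (q i - p i) / 2 := by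
    rw [eventually_all]
    intro i
    have := mem_openBox.1 ha i
    exact hlim.eventually_le_const (by linarith)
  have h1 := h (l := atTop) (fun k : ℕ => fun i => (subBoxLo p q a (ρ / 2 ^ k) i +
    subBoxHi p q a (ρ / 2 ^ k) i) / 2) (fun k => ρ / 2 ^ k / 2)
    (tendsto_nhdsWithin_iff.2 ⟨by simpa using hlim.div_const 2,
      Eventually.of_forall fun k => half_pos (hρk k)⟩) ?_
  · rw [indicator_of_mem ha] at h1
    refine h1.congr' ?_
    filter_upwards [hsmall] with k hk
    rw [← subBox_eq_closedBall ha (hρk k) hk]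
    refine setAverage_congr_fun measurableSet_Icc (Eventually.of_forall fun x hx => ?_)
    rw [indicator_of_mem (subBox_subset_openBox ha hx)]
  · filter_upwards [hsmall] with k hk
    rw [one_mul, ← subBox_eq_closedBall ha (hρk k) hk]
    exact mem_subBox ha (hρk k)

end SubBoxes

/-! ### Comparison of averages through double integrals. -/

section Averages

variable {α : Type*} [MeasurableSpace α] {μ : Measure α}

lemma measure_mul_enorm_sub_average_le {Q : Set α} (hQ : μ Q ≠ ⊤) {U : α → ℝ}
    (hU : IntegrableOn U Q μ) (c : ℝ) :
    μ Q * ‖c - ⨍ z in Q, U z ∂μ‖ₑ ≤ ∫⁻ z in Q, ‖c - U z‖ₑ ∂μ := by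
  have h1 : μ.real Q * (c - ⨍ z in Q, U z ∂μ) = ∫ z in Q, (c - U z) ∂μ := by
    rw [integral_sub (integrableOn_const (C := c) hQ) hU, setIntegral_const, smul_eq_mul, mul_sub]
    congr 1
    exact measure_smul_setAverage U hQ
  have h2 : μ Q = ‖μ.real Q‖ₑ := by
    rw [Real.enorm_of_nonneg measureReal_nonneg, ofReal_measureReal hQ]
  rw [h2, ← enorm_mul, h1]
  exact enorm_integral_le_lintegral_enorm _

/-- The triangle inequality for integrals is used once over `Q'` and once over `Q`; enlarging `Q'`
to `Q` then produces the left side of the Poincaré inequality. -/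
lemma measure_mul_measure_mul_enorm_average_sub_le {Q Q' : Set α} (hQ : μ Q ≠ ⊤) (hQQ : Q' ⊆ Q)
    {U : α → ℝ} (hU : IntegrableOn U Q μ) :
    μ Q * (μ Q' * ‖(⨍ z in Q', U z ∂μ) - ⨍ z in Q, U z ∂μ‖ₑ) ≤
      ∫⁻ a in Q, ∫⁻ b in Q, ‖U b - U a‖ₑ ∂μ ∂μ := by
  have hQ' : μ Q' ≠ ⊤ := ne_top_of_le_ne_top hQ (measure_mono hQQ)
  calc μ Q * (μ Q' * ‖(⨍ z in Q', U z ∂μ) - ⨍ z in Q, U z ∂μ‖ₑ)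
      ≤ μ Q * ∫⁻ a in Q', ‖(⨍ z in Q, U z ∂μ) - U a‖ₑ ∂μ := by
        rw [enorm_sub_rev]
        gcongr
        exact measure_mul_enorm_sub_average_le hQ' (hU.mono_set hQQ) _
    _ = ∫⁻ a in Q', μ Q * ‖U a - ⨍ z in Q, U z ∂μ‖ₑ ∂μ := by
        rw [lintegral_const_mul' _ _ hQ]
        simp only [enorm_sub_rev]
    _ ≤ ∫⁻ a in Q', ∫⁻ b in Q, ‖U b - U a‖ₑ ∂μ ∂μ := by
        refine lintegral_mono fun a => (measure_mul_enorm_sub_average_le hQ hU (U a)).trans ?_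
        simp only [enorm_sub_rev, le_refl]
    _ ≤ _ := lintegral_mono_set hQQ

end Averages

/-! ### Pointwise Lipschitz estimates on one patch. -/

section BoxPatch

open Shell

/-- `F` maps the open box with corners `p`, `q` onto an open subset of `Ω`, and is bi-Lipschitz with
constant `L` there. -/
structure IsBoxPatch (L : ℝ≥0) (Ω : Set E3) (p q : Fin 3 → ℝ) (F : (Fin 3 → ℝ) → E3) : Prop where
  lipschitzOn : LipschitzOnWith L F (openBox p q)
  antilipschitzOn : ∀ a ∈ openBox p q, ∀ b ∈ openBox p q, dist a b ≤ L * dist (F a) (F b)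
  isOpen_image : IsOpen (F '' openBox p q)
  image_subset : F '' openBox p q ⊆ Ω

/-- `D` is the weak gradient on `Ω` of the integrable function `u`. -/
structure HasWeakGradient (Ω : Set E3) (u : E3 → ℝ) (D : Fin 3 → E3 → ℝ) : Prop where
  integrableOn : IntegrableOn u Ω
  integrableOn_grad : ∀ i, IntegrableOn (D i) Ω
  hasWeakDeriv : ∀ i, HasWeakDeriv volume Ω u (EuclideanSpace.single i 1) (D i)

variable {L : ℝ≥0} {Ω : Set E3} {p q a b : Fin 3 → ℝ} {F : (Fin 3 → ℝ) → E3} {u : E3 → ℝ}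
  {D : Fin 3 → E3 → ℝ}

lemma IsBoxPatch.integrableOn_comp (hF : IsBoxPatch L Ω p q F) (hu : IntegrableOn u Ω) :
    IntegrableOn (fun z => u (F z)) (openBox p q) := by
  have hu' : IntegrableOn u (F '' openBox p q) := hu.mono_set hF.image_subset
  refine ⟨aestronglyMeasurable_comp_of_antilipschitzOn measurableSet_openBox
    hF.lipschitzOn.continuousOn hF.antilipschitzOn hu'.1, ?_⟩
  refine lt_of_le_of_lt (lintegral_comp_le_of_antilipschitzOn measurableSet_openBox
    hF.lipschitzOn.continuousOn hF.antilipschitzOn (f := fun x => ‖u x‖ₑ) hu'.1.enorm) ?_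
  exact ENNReal.mul_lt_top (ENNReal.pow_lt_top ENNReal.coe_lt_top) hu'.2

/-- Comparison of the averages over two nested boxes. -/
lemma IsBoxPatch.dist_average_le (hF : IsBoxPatch L Ω p q F) (hΩ : IsOpen Ω)
    (hu : HasWeakGradient Ω u D) {l r : Fin 3 → ℝ} (hQ : Icc l r ⊆ openBox p q)
    {Q' : Set (Fin 3 → ℝ)} (hQQ : Q' ⊆ Icc l r) (hQ' : volume Q' ≠ 0) {d A : ℝ} (hd0 : 0 ≤ d)
    (hA : 0 ≤ A) (hd : ∀ x ∈ Icc l r, ∀ y ∈ Icc l r, dist x y ≤ d)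
    (hg : ∫⁻ z in Icc l r, ∑ i, ‖D i (F z)‖ₑ ≤ ENNReal.ofReal A * volume Q') :
    dist (⨍ z in Q', u (F z)) (⨍ z in Icc l r, u (F z)) ≤ 8 * L * d * A := by
  have hQf : volume (Icc l r) ≠ ⊤ := isCompact_Icc.measure_lt_top.ne
  have hQ0 : volume (Icc l r) ≠ 0 := fun h => hQ' (measure_mono_null hQQ h)
  have hQ'f : volume Q' ≠ ⊤ := ne_top_of_le_ne_top hQf (measure_mono hQQ)
  lift d to ℝ≥0 using hd0
  have h1 := measure_mul_measure_mul_enorm_average_sub_le hQf hQQ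
    ((hF.integrableOn_comp hu.integrableOn).mono_set hQ)
  have h2 := poincare_comp_of_hasWeakDeriv (hF.lipschitzOn.mono hQ)
    (fun x hx y hy => hF.antilipschitzOn x (hQ hx) y (hQ hy)) (convex_Icc l r) isCompact_Icc (d := d)
    (fun x hx y hy => hd x hx y hy) hΩ ((image_mono hQ).trans hF.image_subset) hu.integrableOn
    hu.integrableOn_grad hu.hasWeakDeriv
  -- The factor `volume (Icc l r)` from the Poincaré inequality cancels, and so does `volume Q'`
  -- through `hg`. Only the diameter `d` survives, not the shape of the box.
  have h3 : volume (Icc l r) * (volume Q' * ‖(⨍ z in Q', u (F z)) - ⨍ z in Icc l r, u (F z)‖ₑ) ≤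
      volume (Icc l r) * (volume Q' * ENNReal.ofReal (8 * L * d * A)) := by
    refine (h1.trans h2).trans ?_
    calc _ ≤ ((L * d : ℝ≥0) : ℝ≥0∞) * (8 * volume (Icc l r) * (ENNReal.ofReal A * volume Q')) := by
          gcongr
      _ = _ := by
          rw [ENNReal.ofReal_mul (by positivity), ENNReal.ofReal_mul (by positivity),
            ENNReal.ofReal_mul (by positivity), ENNReal.ofReal_coe_nnreal,
            ENNReal.ofReal_coe_nnreal, ENNReal.coe_mul, ENNReal.ofReal_ofNat]
          ring
  rw [ENNReal.mul_le_mul_iff_right hQ0 hQf, ENNReal.mul_le_mul_iff_right hQ' hQ'f,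
    ← ofReal_norm] at h3
  rw [dist_eq_norm]
  exact (ENNReal.ofReal_le_ofReal_iff (by positivity)).1 h3

/-- Averages over sub-boxes of scales ρ/2^k telescope to the value at `a`. Each halving costs
8·L·(ρ/2^k)·8A, where the second 8 compares `boxVol` at consecutive scales; the geometric series
sums to 128·L·A·ρ. -/
lemma IsBoxPatch.dist_average_subBox_le (hF : IsBoxPatch L Ω p q F) (hΩ : IsOpen Ω)
    (hu : HasWeakGradient Ω u D) (ha : a ∈ openBox p q) {A ρ : ℝ} (hA : 0 ≤ A) (hρ : 0 < ρ)
    (hg : ∀ t, 0 < t → t ≤ ρ → ∫⁻ z in openBox p q ∩ closedBall a t, ∑ i, ‖D i (F z)‖ₑ ≤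
      ENNReal.ofReal A * boxVol p q t)
    (hlim : Tendsto (fun k : ℕ => ⨍ z in subBox p q a (ρ / 2 ^ k), u (F z)) atTop (𝓝 (u (F a)))) :
    dist (⨍ z in subBox p q a ρ, u (F z)) (u (F a)) ≤ 128 * L * A * ρ := by
  have hρk : ∀ k : ℕ, 0 < ρ / 2 ^ k := fun k => by positivity
  have hstep : ∀ k : ℕ, dist (⨍ z in subBox p q a (ρ / 2 ^ k), u (F z))
      (⨍ z in subBox p q a (ρ / 2 ^ (k + 1)), u (F z)) ≤ 128 * L * A * ρ / 2 / 2 ^ k := by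
    intro k
    have hle : ρ / 2 ^ (k + 1) ≤ ρ / 2 ^ k := by gcongr <;> norm_num
    rw [dist_comm]
    refine (hF.dist_average_le hΩ hu (subBox_subset_openBox ha) (subBox_mono ha hle)
      (by rw [volume_subBox ha]; exact boxVol_pos ha (hρk _)) (hρk k).le
      (A := 8 * A) (by positivity) (fun x hx y hy => dist_le_of_mem_subBox ha (hρk k) hx hy)
      ?_).trans (le_of_eq (by ring))
    calc ∫⁻ z in subBox p q a (ρ / 2 ^ k), ∑ i, ‖D i (F z)‖ₑ
        ≤ ∫⁻ z in openBox p q ∩ closedBall a (ρ / 2 ^ k), ∑ i, ‖D i (F z)‖ₑ :=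
          lintegral_mono_set (subset_inter (subBox_subset_openBox ha)
            (subBox_subset_closedBall ha (hρk k)))
      _ ≤ ENNReal.ofReal A * boxVol p q (ρ / 2 ^ k) :=
          hg _ (hρk k) (div_le_self hρ.le (one_le_pow₀ (by norm_num)))
      _ ≤ ENNReal.ofReal A * (ENNReal.ofReal 2 ^ 3 * boxVol p q (ρ / 2 ^ (k + 1))) := by
          gcongr
          refine le_trans (le_of_eq ?_) (boxVol_mul_le ha one_le_two)
          congr 1
          field_simp; ring
      _ = _ := by
          rw [volume_subBox ha, mul_comm 8 A, ENNReal.ofReal_mul hA, mul_assoc]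
          norm_num
  have := dist_le_of_le_geometric_two_of_tendsto₀ hstep hlim
  simpa using this

/-- At points where the maximal function of the gradient is small, a Sobolev function is
Lipschitz. -/
lemma IsBoxPatch.norm_sub_le (hF : IsBoxPatch L Ω p q F) (hΩ : IsOpen Ω)
    (hu : HasWeakGradient Ω u D) (ha : a ∈ openBox p q) (hb : b ∈ openBox p q) {A : ℝ}
    (hA : 0 ≤ A)
    (hga : ∀ t, 0 < t → t ≤ 2 * dist a b → ∫⁻ z in openBox p q ∩ closedBall a t,
      ∑ i, ‖D i (F z)‖ₑ ≤ ENNReal.ofReal A * boxVol p q t)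
    (hgb : ∀ t, 0 < t → t ≤ 2 * dist a b → ∫⁻ z in openBox p q ∩ closedBall b t,
      ∑ i, ‖D i (F z)‖ₑ ≤ ENNReal.ofReal A * boxVol p q t)
    (hla : ∀ ρ : ℝ, 0 < ρ →
      Tendsto (fun k : ℕ => ⨍ z in subBox p q a (ρ / 2 ^ k), u (F z)) atTop (𝓝 (u (F a))))
    (hlb : ∀ ρ : ℝ, 0 < ρ →
      Tendsto (fun k : ℕ => ⨍ z in subBox p q b (ρ / 2 ^ k), u (F z)) atTop (𝓝 (u (F b)))) :
    ‖u (F a) - u (F b)‖ ≤ 768 * L * A * dist a b := by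
  rcases eq_or_ne a b with rfl | hab
  · simp
  set ρ := dist a b with hρ'
  have hρ : 0 < ρ := dist_pos.2 hab
  have h1 := hF.dist_average_subBox_le hΩ hu ha hA hρ (fun t ht ht' => hga t ht (by linarith))
    (hla ρ hρ)
  have h2 := hF.dist_average_subBox_le hΩ hu hb hA hρ (fun t ht ht' => hgb t ht (by linarith))
    (hlb ρ hρ)
  -- The smallest box containing both sub-boxes links the two averages. It has diameter at most 4ρ,
  -- so each link costs 8·L·4ρ·8A = 256·L·A·ρ, and 2·128 + 2·256 = 768.
  set l : Fin 3 → ℝ := fun i => min (subBoxLo p q a ρ i) (subBoxLo p q b ρ i) with hl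
  set r : Fin 3 → ℝ := fun i => max (subBoxHi p q a ρ i) (subBoxHi p q b ρ i) with hr
  have hP : Icc l r ⊆ openBox p q := Icc_subset_openBox
    (fun i => lt_min (lt_subBoxLo ha i) (lt_subBoxLo hb i))
    (fun i => max_lt (subBoxHi_lt ha i) (subBoxHi_lt hb i))
  have hPa : subBox p q a ρ ⊆ Icc l r := Icc_subset_Icc (fun i => min_le_left _ _)
    (fun i => le_max_left _ _)
  have hPb : subBox p q b ρ ⊆ Icc l r := Icc_subset_Icc (fun i => min_le_right _ _)
    (fun i => le_max_right _ _)
  have hlo : ∀ c ∈ openBox p q, ∀ i, c i - ρ ≤ subBoxLo p q c ρ i ∧ subBoxHi p q c ρ i ≤ c i + ρ := by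
    intro c hc i
    have e1 := subBoxHi_sub_subBoxLo (ρ := ρ) hc i
    have e2 : min ρ ((q i - p i) / 2) ≤ ρ := min_le_left _ _
    constructor <;> linarith [subBoxLo_le hc hρ i, le_subBoxHi hc hρ i]
  have hball : Icc l r ⊆ closedBall a (2 * ρ) := by
    intro x hx
    refine (dist_pi_le_iff (by linarith)).2 fun i => ?_
    have hab' := (dist_pi_le_iff hρ.le).1 hρ'.ge i
    rw [Real.dist_eq, abs_le] at hab' ⊢
    have e1 : a i - 2 * ρ ≤ l i := le_min (by linarith [(hlo a ha i).1])
      (by linarith [(hlo b hb i).1])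
    have e2 : r i ≤ a i + 2 * ρ := max_le (by linarith [(hlo a ha i).2])
      (by linarith [(hlo b hb i).2])
    constructor <;> linarith [hx.1 i, hx.2 i]
  have hdiam : ∀ x ∈ Icc l r, ∀ y ∈ Icc l r, dist x y ≤ 4 * ρ := fun x hx y hy => by
    have e1 := mem_closedBall.1 (hball hx)
    have e2 := mem_closedBall'.1 (hball hy)
    linarith [dist_triangle x a y]
  have hint : ∫⁻ z in Icc l r, ∑ i, ‖D i (F z)‖ₑ ≤ ENNReal.ofReal (8 * A) * boxVol p q ρ := by
    calc ∫⁻ z in Icc l r, ∑ i, ‖D i (F z)‖ₑ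
        ≤ ∫⁻ z in openBox p q ∩ closedBall a (2 * ρ), ∑ i, ‖D i (F z)‖ₑ :=
          lintegral_mono_set (subset_inter hP hball)
      _ ≤ ENNReal.ofReal A * boxVol p q (2 * ρ) := hga _ (by linarith) le_rfl
      _ ≤ ENNReal.ofReal A * (ENNReal.ofReal 2 ^ 3 * boxVol p q ρ) := by
          gcongr
          exact boxVol_mul_le ha one_le_two
      _ = _ := by
          rw [mul_comm 8 A, ENNReal.ofReal_mul hA, mul_assoc]
          norm_num
  have h3 := hF.dist_average_le hΩ hu hP hPa (by rw [volume_subBox ha]; exact boxVol_pos ha hρ)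
    (by linarith) (by linarith : 0 ≤ 8 * A) hdiam (by rwa [volume_subBox ha])
  have h4 := hF.dist_average_le hΩ hu hP hPb (by rw [volume_subBox hb]; exact boxVol_pos hb hρ)
    (by linarith) (by linarith : 0 ≤ 8 * A) hdiam (by rwa [volume_subBox hb])
  rw [← dist_eq_norm]
  set ma := ⨍ z in subBox p q a ρ, u (F z)
  set mb := ⨍ z in subBox p q b ρ, u (F z)
  set mP := ⨍ z in Icc l r, u (F z)
  have t1 := dist_triangle (u (F a)) ma (u (F b))
  have t2 := dist_triangle ma mP (u (F b))
  have t3 := dist_triangle mP mb (u (F b))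
  rw [dist_comm (u (F a)) ma] at t1
  rw [dist_comm mP mb] at t3
  linarith

end BoxPatch

/-! ### Doubling, the weak type estimate, and Lipschitz estimates on the good set. -/

section BoxCover

open Shell

/-- Near each of its points, the set `Ω` is parametrized, uniformly at scale `δ`, by an open box of
thickness `2 * h` and other side lengths between `r` and `R`. -/
structure HasBoxCover (L : ℝ≥0) (δ r R h : ℝ) (Ω : Set E3) : Prop where
  exists_patch : ∀ x ∈ Ω, ∃ (p q : Fin 3 → ℝ) (F : (Fin 3 → ℝ) → E3), IsBoxPatch L Ω p q F ∧
    Ω ∩ closedBall x δ ⊆ F '' openBox p q ∧ (∀ i, i ≠ 2 → r ≤ q i - p i ∧ q i - p i ≤ R) ∧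
    q 2 - p 2 = 2 * h
  subset_closedBall : Ω ⊆ closedBall 0 R

/-- The averages of `G` over the parts of `Ω` in the balls around `x` of radius at most `s` are
bounded by `c`. -/
def MaximalLE (Ω : Set E3) (G : E3 → ℝ≥0∞) (s : ℝ) (c : ℝ≥0∞) (x : E3) : Prop :=
  ∀ t, 0 < t → t ≤ s → ∫⁻ z in Ω ∩ closedBall x t, G z ≤ c * volume (Ω ∩ closedBall x t)

variable {L : ℝ≥0} {Ω : Set E3} {p q a b : Fin 3 → ℝ} {F : (Fin 3 → ℝ) → E3} {u : E3 → ℝ}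
  {D : Fin 3 → E3 → ℝ} {δ r R h : ℝ}

lemma IsBoxPatch.inter_closedBall_subset (hF : IsBoxPatch L Ω p q F) (ha : a ∈ openBox p q) {t : ℝ}
    (hcov : Ω ∩ closedBall (F a) t ⊆ F '' openBox p q) :
    Ω ∩ closedBall (F a) t ⊆ F '' (openBox p q ∩ closedBall a (L * t)) := by
  intro x hx
  obtain ⟨b, hb, rfl⟩ := hcov hx
  refine ⟨b, ⟨hb, ?_⟩, rfl⟩
  refine (hF.antilipschitzOn b hb a ha).trans ?_
  gcongr
  exact hx.2

lemma IsBoxPatch.volume_inter_closedBall_le (hF : IsBoxPatch L Ω p q F) (ha : a ∈ openBox p q)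
    {t : ℝ} (hcov : Ω ∩ closedBall (F a) t ⊆ F '' openBox p q) :
    volume (Ω ∩ closedBall (F a) t) ≤ 8 * (L : ℝ≥0∞) ^ 3 * boxVol p q (L * t) := by
  refine (measure_mono (hF.inter_closedBall_subset ha hcov)).trans ?_
  refine ((hF.lipschitzOn.mono inter_subset_left).volume_image_le).trans ?_
  rw [mul_comm 8, mul_assoc]
  gcongr
  exact volume_openBox_inter_closedBall_le

lemma IsBoxPatch.image_subset_closedBall (hF : IsBoxPatch L Ω p q F) (ha : a ∈ openBox p q)
    {t : ℝ} : F '' (openBox p q ∩ closedBall a t) ⊆ Ω ∩ closedBall (F a) (L * t) := by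
  rintro _ ⟨b, ⟨hb, hba⟩, rfl⟩
  refine ⟨hF.image_subset ⟨b, hb, rfl⟩, ?_⟩
  refine (hF.lipschitzOn.dist_le_mul b hb a ha).trans ?_
  gcongr
  exact hba

/-- The sub-box of scale `t / L` at `a` is carried into the ball of radius `t`, and its volume is at
most (2L)³ times that of its image. -/
lemma IsBoxPatch.boxVol_le (hF : IsBoxPatch L Ω p q F) (ha : a ∈ openBox p q) (hL : 1 ≤ L)
    {t : ℝ} (ht : 0 < t) :
    boxVol p q (t / L) ≤ 8 * (L : ℝ≥0∞) ^ 3 * volume (Ω ∩ closedBall (F a) t) := by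
  have hL0 : (0 : ℝ) < L := lt_of_lt_of_le one_pos hL
  have htL : 0 < t / L := div_pos ht hL0
  have h1 := subBox_subset_openBox (ρ := t / L) ha
  rw [← volume_subBox ha]
  refine (volume_le_of_antilipschitzOn fun x hx y hy =>
    hF.antilipschitzOn x (h1 hx) y (h1 hy)).trans ?_
  have e : ((L * 2 : ℝ≥0) : ℝ≥0∞) ^ 3 = 8 * (L : ℝ≥0∞) ^ 3 := by
    rw [ENNReal.coe_mul, mul_pow, mul_comm]; norm_num
  rw [e]
  gcongr
  refine (image_mono (subset_inter h1 (subBox_subset_closedBall ha htL))).trans ?_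
  refine (hF.image_subset_closedBall ha).trans ?_
  rw [mul_div_cancel₀ _ hL0.ne']

/-- Upper and lower volume bounds by `boxVol`, at scales differing by the factor 5L²: the constant
is 8L³ · (5L²)³ · 8L³. -/
lemma IsBoxPatch.volume_inter_closedBall_five_le (hF : IsBoxPatch L Ω p q F)
    (ha : a ∈ openBox p q) (hL : 1 ≤ L) {t : ℝ} (ht : 0 < t)
    (hcov : Ω ∩ closedBall (F a) (5 * t) ⊆ F '' openBox p q) :
    volume (Ω ∩ closedBall (F a) (5 * t)) ≤
      8000 * (L : ℝ≥0∞) ^ 12 * volume (Ω ∩ closedBall (F a) t) := by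
  have hL0 : (0 : ℝ) < L := lt_of_lt_of_le one_pos hL
  have hL1 : (1 : ℝ) ≤ L := hL
  calc volume (Ω ∩ closedBall (F a) (5 * t))
      ≤ 8 * (L : ℝ≥0∞) ^ 3 * boxVol p q (L * (5 * t)) := hF.volume_inter_closedBall_le ha hcov
    _ = 8 * (L : ℝ≥0∞) ^ 3 * boxVol p q ((5 * L * L) * (t / L)) := by
        congr 2; field_simp
    _ ≤ 8 * (L : ℝ≥0∞) ^ 3 * (ENNReal.ofReal (5 * L * L) ^ 3 * boxVol p q (t / L)) := by
        gcongr
        exact boxVol_mul_le ha (by nlinarith)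
    _ ≤ 8 * (L : ℝ≥0∞) ^ 3 * (ENNReal.ofReal (5 * L * L) ^ 3 *
          (8 * (L : ℝ≥0∞) ^ 3 * volume (Ω ∩ closedBall (F a) t))) := by
        gcongr
        exact hF.boxVol_le ha hL ht
    _ = _ := by
        rw [ENNReal.ofReal_mul (by positivity), ENNReal.ofReal_mul (by positivity),
          ENNReal.ofReal_coe_nnreal, ENNReal.ofReal_ofNat]
        ring

lemma HasBoxCover.isOpen (hc : HasBoxCover L δ r R h Ω) (hδ : 0 ≤ δ) : IsOpen Ω := by
  refine isOpen_iff_forall_mem_open.2 fun x hx => ?_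
  obtain ⟨p, q, F, hF, hcov, -⟩ := hc.exists_patch x hx
  exact ⟨_, hF.image_subset, hF.isOpen_image, hcov ⟨hx, mem_closedBall_self hδ⟩⟩

lemma HasBoxCover.volume_five_le (hc : HasBoxCover L δ r R h Ω) (hL : 1 ≤ L) {x : E3} (hx : x ∈ Ω)
    {t : ℝ} (ht : 0 < t) (htδ : 5 * t ≤ δ) :
    volume (Ω ∩ closedBall x (5 * t)) ≤ 8000 * (L : ℝ≥0∞) ^ 12 * volume (Ω ∩ closedBall x t) := by
  obtain ⟨p, q, F, hF, hcov, -⟩ := hc.exists_patch x hx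
  obtain ⟨a, ha, rfl⟩ := hcov ⟨hx, mem_closedBall_self (by linarith)⟩
  exact hF.volume_inter_closedBall_five_le ha hL ht
    ((inter_subset_inter_right _ (closedBall_subset_closedBall htδ)).trans hcov)

/-- The values of `G` below `c` contribute at most `c * μ A`, half of the assumed lower bound.
Therefore the final estimates involve only the set where |∇u| > λ. -/
lemma volume_mul_le_setLIntegral_indicator {α : Type*} [MeasurableSpace α] {μ : Measure α}
    {A : Set α} (hA : μ A ≠ ⊤) {G : α → ℝ≥0∞} {c : ℝ≥0∞} (hc : c ≠ ⊤)
    (h : 2 * c * μ A ≤ ∫⁻ z in A, G z ∂μ) :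
    c * μ A ≤ ∫⁻ z in A, {z | c < G z}.indicator G z ∂μ := by
  have h1 : ∫⁻ z in A, G z ∂μ ≤ ∫⁻ z in A, {z | c < G z}.indicator G z ∂μ + c * μ A := by
    rw [← setLIntegral_const, ← lintegral_add_right _ measurable_const]
    refine lintegral_mono fun z => ?_
    by_cases hz : c < G z
    · rw [indicator_of_mem (show z ∈ {z | c < G z} from hz)]; exact le_self_add
    · exact (not_lt.1 hz).trans le_add_self
  have h2 := h.trans h1
  rw [two_mul, add_mul] at h2
  exact (ENNReal.add_le_add_iff_right (ENNReal.mul_ne_top hc hA)).1 h2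

/-- The weak type estimate for the maximal function. -/
lemma HasBoxCover.volume_not_maximalLE_le (hc : HasBoxCover L δ r R h Ω) (hL : 1 ≤ L) (hδ : 0 < δ)
    {G : E3 → ℝ≥0∞} {c : ℝ≥0∞} (hct : c ≠ ⊤) :
    c * volume {x ∈ Ω | ¬ MaximalLE Ω G (δ / 5) (2 * c) x} ≤
      8000 * (L : ℝ≥0∞) ^ 12 * ∫⁻ x in {x ∈ Ω | c < G x}, G x := by
  have hΩ := hc.isOpen hδ.le
  set Bad := {x ∈ Ω | ¬ MaximalLE Ω G (δ / 5) (2 * c) x} with hBad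
  have hbad : ∀ x ∈ Bad, ∃ t, 0 < t ∧ t ≤ δ / 5 ∧
      2 * c * volume (Ω ∩ closedBall x t) < ∫⁻ z in Ω ∩ closedBall x t, G z := by
    rintro x ⟨-, hx⟩
    unfold MaximalLE at hx
    push Not at hx
    exact hx
  choose! t ht0 htδ ht using hbad
  -- Radii are capped at δ/5 so that the balls enlarged five times still lie within one patch, where
  -- doubling is available.
  obtain ⟨v, hvB, hvd, hvc⟩ := Vitali.exists_disjoint_subfamily_covering_enlargement_closedBall
    Bad (fun x => x) t (δ / 5) htδ 5 (by norm_num)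
  have hvcount : v.Countable := by
    refine (hvd.mono fun x => ball_subset_closedBall).countable_of_isOpen (fun _ _ => isOpen_ball)
      fun x hx => ⟨x, mem_ball_self (ht0 x (hvB hx))⟩
  have hcovB : Bad ⊆ ⋃ x ∈ v, Ω ∩ closedBall x (5 * t x) := by
    intro x hx
    obtain ⟨y, hy, hxy⟩ := hvc x hx
    exact mem_biUnion hy ⟨hx.1, hxy (mem_closedBall_self (ht0 x hx).le)⟩
  have hfin : ∀ x s, volume (Ω ∩ closedBall x s) ≠ ⊤ := fun x s =>
    ne_top_of_le_ne_top (isCompact_closedBall x s).measure_lt_top.ne (measure_mono inter_subset_right)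
  calc c * volume Bad ≤ c * ∑' x : v, volume (Ω ∩ closedBall (x : E3) (5 * t x)) := by
        gcongr
        exact (measure_mono hcovB).trans (measure_biUnion_le _ hvcount _)
    _ ≤ c * ∑' x : v, 8000 * (L : ℝ≥0∞) ^ 12 * volume (Ω ∩ closedBall (x : E3) (t x)) := by
        gcongr with x
        exact hc.volume_five_le hL (hvB x.2).1 (ht0 x (hvB x.2)) (by linarith [htδ x (hvB x.2)])
    _ = 8000 * (L : ℝ≥0∞) ^ 12 * ∑' x : v, c * volume (Ω ∩ closedBall (x : E3) (t x)) := by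
        rw [ENNReal.tsum_mul_left, ENNReal.tsum_mul_left]; ring
    _ ≤ 8000 * (L : ℝ≥0∞) ^ 12 * ∑' x : v, ∫⁻ z in Ω ∩ closedBall (x : E3) (t x),
          {z | c < G z}.indicator G z := by
        gcongr with x
        exact volume_mul_le_setLIntegral_indicator (hfin _ _) hct (ht x (hvB x.2)).le
    _ = 8000 * (L : ℝ≥0∞) ^ 12 * ∫⁻ z in ⋃ x ∈ v, Ω ∩ closedBall (x : E3) (t x),
          {z | c < G z}.indicator G z := by
        rw [lintegral_biUnion hvcount
          (fun x _ => hΩ.measurableSet.inter isClosed_closedBall.measurableSet)]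
        exact hvd.mono fun x => inter_subset_right
    _ ≤ 8000 * (L : ℝ≥0∞) ^ 12 * ∫⁻ z in Ω, {z | c < G z}.indicator G z := by
        gcongr
        exact iUnion₂_subset fun x _ => inter_subset_left
    _ ≤ _ := by
        refine mul_le_mul' le_rfl ((lintegral_indicator_le _ _).trans (le_of_eq ?_))
        rw [Measure.restrict_restrict' hΩ.measurableSet, inter_comm]
        rfl

/-- Transfers the maximal bound from balls in `Ω` to box coordinates. The constant collects (2L)³
from the change of variables, 3 from `hDG`, 2 from the maximal bound, 8L³ from the volume of a ball,
and L⁶ from comparing scales L²t and t. -/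
lemma IsBoxPatch.lintegral_le_of_maximalLE (hF : IsBoxPatch L Ω p q F) (ha : a ∈ openBox p q)
    (hL : 1 ≤ L) (hD : ∀ i, IntegrableOn (D i) Ω) {G : E3 → ℝ≥0∞}
    (hDG : ∀ x, ∑ i, ‖D i x‖ₑ ≤ 3 * G x) {s lam : ℝ}
    (hcov : Ω ∩ closedBall (F a) s ⊆ F '' openBox p q)
    (hG : MaximalLE Ω G s (2 * ENNReal.ofReal lam) (F a)) {t : ℝ} (ht : 0 < t) (hts : L * t ≤ s) :
    ∫⁻ z in openBox p q ∩ closedBall a t, ∑ i, ‖D i (F z)‖ₑ ≤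
      ENNReal.ofReal (384 * L ^ 12 * lam) * boxVol p q t := by
  have hL0 : (0 : ℝ) < L := lt_of_lt_of_le one_pos hL
  have hL1 : (1 : ℝ) ≤ L := hL
  have hsub := hF.image_subset_closedBall ha (t := t)
  have hcov' := (inter_subset_inter_right Ω (closedBall_subset_closedBall (x := F a) hts)).trans hcov
  calc ∫⁻ z in openBox p q ∩ closedBall a t, ∑ i, ‖D i (F z)‖ₑ
      ≤ ((L * 2 : ℝ≥0) : ℝ≥0∞) ^ 3 *
          ∫⁻ x in F '' (openBox p q ∩ closedBall a t), ∑ i, ‖D i x‖ₑ := by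
        refine lintegral_comp_le_of_antilipschitzOn
          (measurableSet_openBox.inter isClosed_closedBall.measurableSet)
          (hF.lipschitzOn.continuousOn.mono inter_subset_left)
          (fun x hx y hy => hF.antilipschitzOn x hx.1 y hy.1) (f := fun x => ∑ i, ‖D i x‖ₑ) ?_
        exact Finset.aemeasurable_fun_sum _ fun i _ =>
          ((hD i).mono_set (hsub.trans inter_subset_left)).1.enorm
    _ ≤ ((L * 2 : ℝ≥0) : ℝ≥0∞) ^ 3 * (3 * ∫⁻ x in Ω ∩ closedBall (F a) (L * t), G x) := by
        gcongr
        rw [← lintegral_const_mul' _ _ (by simp)]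
        exact (lintegral_mono_set hsub).trans (lintegral_mono fun x => hDG x)
    _ ≤ ((L * 2 : ℝ≥0) : ℝ≥0∞) ^ 3 * (3 * (2 * ENNReal.ofReal lam *
          (8 * (L : ℝ≥0∞) ^ 3 * boxVol p q (L * (L * t))))) := by
        gcongr
        exact (hG _ (by positivity) hts).trans
          (by gcongr; exact hF.volume_inter_closedBall_le ha hcov')
    _ ≤ ((L * 2 : ℝ≥0) : ℝ≥0∞) ^ 3 * (3 * (2 * ENNReal.ofReal lam *
          (8 * (L : ℝ≥0∞) ^ 3 * (ENNReal.ofReal (L * L) ^ 3 * boxVol p q t)))) := by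
        gcongr
        rw [← mul_assoc]
        exact boxVol_mul_le ha (by nlinarith)
    _ = _ := by
        rw [ENNReal.ofReal_mul (by positivity), ENNReal.ofReal_mul (by positivity),
          ENNReal.ofReal_mul (by positivity), ENNReal.ofReal_pow (by positivity),
          ENNReal.ofReal_coe_nnreal, ENNReal.ofReal_ofNat, ENNReal.coe_mul, ENNReal.coe_ofNat]
        ring

/-- A set inside a fixed ball is covered by a bounded number of balls centred in the set. -/
lemma exists_card_bound_cover {X : Type*} [PseudoMetricSpace X] [ProperSpace X] (x₀ : X) (R : ℝ)
    {δ : ℝ} (hδ : 0 < δ) : ∃ N : ℕ, ∀ Ω ⊆ closedBall x₀ R, ∃ s : Finset X, (s : Set X) ⊆ Ω ∧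
      s.card ≤ N ∧ Ω ⊆ ⋃ x ∈ s, ball x δ := by
  classical
  obtain ⟨T, -, hT, hcov⟩ := (isCompact_closedBall x₀ R).finite_cover_balls (half_pos hδ)
  refine ⟨hT.toFinset.card, fun Ω hΩ => ?_⟩
  have hch : ∀ t : X, ∃ x, (ball t (δ / 2) ∩ Ω).Nonempty → x ∈ ball t (δ / 2) ∩ Ω := fun t => by
    by_cases h : (ball t (δ / 2) ∩ Ω).Nonempty
    · exact ⟨h.some, fun _ => h.some_mem⟩
    · exact ⟨t, fun h' => absurd h' h⟩
  choose f hf using hch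
  refine ⟨(hT.toFinset.filter fun t => (ball t (δ / 2) ∩ Ω).Nonempty).image f, ?_, ?_, ?_⟩
  · intro x hx
    simp only [Finset.coe_image, mem_image, Finset.mem_coe, Finset.mem_filter] at hx
    obtain ⟨t, ⟨-, ht⟩, rfl⟩ := hx
    exact (hf t ht).2
  · exact Finset.card_image_le.trans (Finset.card_filter_le _ _)
  · intro x hx
    obtain ⟨t, ht, hxt⟩ := mem_iUnion₂.1 (hcov (hΩ hx))
    have hne : (ball t (δ / 2) ∩ Ω).Nonempty := ⟨x, hxt, hx⟩
    refine mem_iUnion₂.2 ⟨f t, Finset.mem_image_of_mem f (by simp [ht, hne]), ?_⟩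
    have h1 := mem_ball'.1 (hf t hne).1
    have h2 := mem_ball.1 hxt
    rw [mem_ball]
    linarith [dist_triangle x t (f t)]

/-- Off a null set, a Sobolev function is Lipschitz at points where the maximal function of the
gradient is small. -/
lemma HasBoxCover.exists_null_norm_sub_le (hc : HasBoxCover L δ r R h Ω) (hL : 1 ≤ L) (hδ : 0 < δ)
    (hu : HasWeakGradient Ω u D) {G : E3 → ℝ≥0∞} (hDG : ∀ x, ∑ i, ‖D i x‖ₑ ≤ 3 * G x) :
    ∃ Z : Set E3, volume Z = 0 ∧ ∀ lam : ℝ, 0 ≤ lam → ∀ x ∈ Ω \ Z, ∀ y ∈ Ω \ Z,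
      MaximalLE Ω G (δ / 5) (2 * ENNReal.ofReal lam) x →
      MaximalLE Ω G (δ / 5) (2 * ENNReal.ofReal lam) y → dist x y ≤ δ / (10 * L ^ 2) →
      ‖u x - u y‖ ≤ 768 * 384 * L ^ 14 * lam * dist x y := by
  have hΩ := hc.isOpen hδ.le
  have hL0 : (0 : ℝ) < L := lt_of_lt_of_le one_pos hL
  have hL1 : (1 : ℝ) ≤ L := hL
  -- Finitely many patches suffice, so the points where averages fail to converge form one null set,
  -- chosen before `lam`.
  obtain ⟨N, hN⟩ := exists_card_bound_cover (0 : E3) R (half_pos hδ)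
  obtain ⟨s, hsΩ, -, hs⟩ := hN Ω hc.subset_closedBall
  have hpatch := hc.exists_patch
  choose! p q F hF hcov _ _ using hpatch
  set Z : E3 → Set (Fin 3 → ℝ) := fun x => {a | ¬ (a ∈ openBox (p x) (q x) → ∀ ρ : ℝ, 0 < ρ →
    Tendsto (fun k : ℕ => ⨍ z in subBox (p x) (q x) a (ρ / 2 ^ k), u (F x z)) atTop
      (𝓝 (u (F x a))))} with hZ
  have hZ0 : ∀ x ∈ Ω, volume (Z x) = 0 := fun x hx =>
    ae_tendsto_average_subBox ((hF x hx).integrableOn_comp hu.integrableOn)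
  refine ⟨⋃ x ∈ s, F x '' (openBox (p x) (q x) ∩ Z x), ?_, ?_⟩
  · refine (measure_biUnion_null_iff s.countable_toSet).2 fun x hx => ?_
    have := ((hF x (hsΩ hx)).lipschitzOn.mono (inter_subset_left (t := Z x))).volume_image_le
    rw [measure_mono_null inter_subset_right (hZ0 x (hsΩ hx)), mul_zero] at this
    exact le_antisymm this zero_le
  · rintro lam hlam x ⟨hx, hxZ⟩ y ⟨hy, hyZ⟩ hGx hGy hxy
    obtain ⟨w, hw, hxw⟩ := mem_iUnion₂.1 (hs hx)
    have hwΩ := hsΩ hw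
    have hδ2 : δ / (10 * L ^ 2) ≤ δ / 10 := by
      gcongr; nlinarith
    have hmem : ∀ z ∈ Ω, dist z w ≤ δ → ∃ a ∈ openBox (p w) (q w), F w a = z := fun z hz hzw =>
      hcov w hwΩ ⟨hz, hzw⟩
    rw [mem_ball] at hxw
    obtain ⟨a, ha, rfl⟩ := hmem x hx (by linarith)
    have hyw : dist y w ≤ δ / 10 + δ / 2 := by
      have := dist_triangle y (F w a) w
      rw [dist_comm y (F w a)] at this
      linarith
    obtain ⟨b, hb, rfl⟩ := hmem y hy (by linarith)
    have hla : a ∉ Z w := fun h => hxZ (mem_biUnion hw ⟨a, ⟨ha, h⟩, rfl⟩)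
    have hlb : b ∉ Z w := fun h => hyZ (mem_biUnion hw ⟨b, ⟨hb, h⟩, rfl⟩)
    simp only [hZ, mem_ofPred_eq, not_not] at hla hlb
    have hcs : ∀ z, dist z w ≤ δ / 10 + δ / 2 →
        Ω ∩ closedBall z (δ / 5) ⊆ F w '' openBox (p w) (q w) := by
      intro z hz
      refine (inter_subset_inter_right Ω (closedBall_subset_closedBall' ?_)).trans (hcov w hwΩ)
      linarith
    have hab : dist a b ≤ L * dist (F w a) (F w b) := (hF w hwΩ).antilipschitzOn a ha b hb
    -- Origin of the threshold δ/(10L²): scales up to `2 * dist a b ≤ 2 * L * dist x y` in the box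
    -- correspond to balls of radius at most δ/5 in `Ω`.
    have htL : ∀ t, t ≤ 2 * dist a b → L * t ≤ δ / 5 := by
      intro t ht
      have hLxy := mul_le_mul_of_nonneg_left hxy hL0.le
      calc (L : ℝ) * t ≤ L * (2 * (L * (δ / (10 * L ^ 2)))) := by gcongr; linarith
        _ = δ / 5 := by field_simp; norm_num
    have key := (hF w hwΩ).norm_sub_le hΩ hu ha hb (A := 384 * L ^ 12 * lam) (by positivity)
      (fun t ht ht' => (hF w hwΩ).lintegral_le_of_maximalLE ha hL hu.integrableOn_grad hDG
        (hcs _ (by linarith)) hGx ht (htL t ht'))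
      (fun t ht ht' => (hF w hwΩ).lintegral_le_of_maximalLE hb hL hu.integrableOn_grad hDG
        (hcs _ hyw) hGy ht (htL t ht')) (hla ha) (hlb hb)
    calc _ ≤ _ := key
      _ ≤ 768 * L * (384 * L ^ 12 * lam) * (L * dist (F w a) (F w b)) := by gcongr
      _ = _ := by ring

end BoxCover

/-! ### Extension of functions that are Lipschitz at small scale. -/

section LipschitzExtension

variable {X : Type*} [PseudoMetricSpace X]

/-- A function which is Lipschitz at small scale on a sufficiently dense subset of `Ω` extends to a
function on `Ω` with the same property. -/
lemma exists_local_lipschitz_extension {A Ω : Set X} {f : X → ℝ} {K ε : ℝ} (hε : 0 < ε)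
    (hK : 0 ≤ K) (hf : ∀ x ∈ A, ∀ y ∈ A, dist x y ≤ 5 * ε → |f x - f y| ≤ K * dist x y)
    (hA : ∀ x ∈ Ω, ∃ y ∈ A, dist x y ≤ ε) :
    ∃ v : X → ℝ, (∀ x ∈ A, v x = f x) ∧
      ∀ x ∈ Ω, ∀ y ∈ Ω, dist x y ≤ ε → |v x - v y| ≤ 2 * K * dist x y := by
  -- McShane's infimum over nearby points only, since `f` is controlled only at distances up to 5ε.
  -- The slope is doubled so that points leaving the ball of radius 4ε do not matter.
  set T : X → Set ℝ := fun x => (fun y => f y + 2 * K * dist x y) '' (A ∩ closedBall x (4 * ε))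
    with hT
  have hlow : ∀ x, ∀ y₀ ∈ A, dist x y₀ ≤ ε → ∀ c ∈ T x, f y₀ - K * (5 * ε) ≤ c := by
    rintro x y₀ hy₀ hxy₀ _ ⟨y, ⟨hy, hyx⟩, rfl⟩
    have hyx' : dist y x ≤ 4 * ε := hyx
    have h1 : dist y₀ y ≤ 5 * ε := by
      have := dist_triangle y₀ x y
      rw [dist_comm y₀ x, dist_comm x y] at this
      linarith
    have h2 := (abs_le.1 (hf y₀ hy₀ y hy h1)).2
    have h3 : K * dist y₀ y ≤ K * (5 * ε) := by gcongr
    have h4 : 0 ≤ 2 * K * dist x y := by positivity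
    simp only
    linarith
  have hne : ∀ x ∈ Ω, (T x).Nonempty := fun x hx => by
    obtain ⟨y, hy, hxy⟩ := hA x hx
    exact ⟨_, y, ⟨hy, by rw [mem_closedBall']; linarith⟩, rfl⟩
  have hbdd : ∀ x ∈ Ω, BddBelow (T x) := fun x hx => by
    obtain ⟨y, hy, hxy⟩ := hA x hx
    exact ⟨_, fun c hc => hlow x y hy hxy c hc⟩
  refine ⟨fun x => sInf (T x), fun x hx => ?_, ?_⟩
  · have hmem : f x ∈ T x := ⟨x, ⟨hx, mem_closedBall_self (by linarith)⟩, by simp⟩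
    have hle : ∀ c ∈ T x, f x ≤ c := by
      rintro _ ⟨y, ⟨hy, hyx⟩, rfl⟩
      have hyx' : dist x y ≤ 4 * ε := mem_closedBall'.1 hyx
      have h2 := (abs_le.1 (hf x hx y hy (by linarith))).2
      have h4 : 0 ≤ K * dist x y := by positivity
      simp only
      linarith
    exact le_antisymm (csInf_le ⟨_, hle⟩ hmem) (le_csInf ⟨_, hmem⟩ hle)
  · have key : ∀ x ∈ Ω, ∀ x' ∈ Ω, dist x x' ≤ ε → sInf (T x') ≤ sInf (T x) + 2 * K * dist x x' := by
      intro x hx x' hx' hxx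
      rw [← sub_le_iff_le_add]
      refine le_csInf (hne x hx) ?_
      rintro _ ⟨y, ⟨hy, hyx⟩, rfl⟩
      have hyx' : dist x y ≤ 4 * ε := mem_closedBall'.1 hyx
      simp only
      rw [sub_le_iff_le_add]
      have htri := dist_triangle x' x y
      rw [dist_comm x' x] at htri
      by_cases hcase : dist x' y ≤ 4 * ε
      · refine (csInf_le (hbdd x' hx') ⟨y, ⟨hy, mem_closedBall'.2 hcase⟩, rfl⟩).trans ?_
        have := mul_le_mul_of_nonneg_left htri (by positivity : 0 ≤ 2 * K)
        simp only
        linarith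
      -- Here `y` is no competitor for `x'`, but then its distance to `x` exceeds 3ε. The doubled
      -- slope has a surplus `K * dist x y ≥ 3 * K * ε`, which pays for replacing `y` by a point
      -- `y₀` within ε of `x`.
      · obtain ⟨y₀, hy₀, hxy₀⟩ := hA x hx
        have htri2 := dist_triangle x' x y₀
        rw [dist_comm x' x] at htri2
        have htri3 := dist_triangle y₀ x y
        rw [dist_comm y₀ x] at htri3
        refine (csInf_le (hbdd x' hx') ⟨y₀, ⟨hy₀, mem_closedBall'.2 (by linarith)⟩, rfl⟩).trans ?_
        have h1 := (abs_le.1 (hf y₀ hy₀ y hy (by linarith))).2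
        have h2 : K * dist y₀ y ≤ K * (ε + dist x y) := by gcongr; linarith
        have h3 : 2 * K * dist x' y₀ ≤ 2 * K * (dist x x' + ε) := by gcongr; linarith
        have h4 : K * (3 * ε) ≤ K * dist x y := by gcongr; linarith
        simp only
        linarith
    intro x hx y hy hxy
    rw [abs_le]
    have h1 := key x hx y hy hxy
    have h2 := key y hy x hx (by rwa [dist_comm])
    rw [dist_comm y x] at h2
    constructor <;> linarith

/-- On a bounded set, a function which is Lipschitz at small scale is Lipschitz. -/
lemma exists_lipschitzOnWith_of_local [ProperSpace X] {Ω : Set X} {x₀ : X} {R : ℝ}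
    (hΩ : Ω ⊆ closedBall x₀ R) {v : X → ℝ} {K ε : ℝ} (hε : 0 < ε) (hK : 0 ≤ K)
    (hv : ∀ x ∈ Ω, ∀ y ∈ Ω, dist x y ≤ ε → |v x - v y| ≤ K * dist x y) :
    ∃ K' : ℝ≥0, LipschitzOnWith K' v Ω := by
  obtain ⟨N, hN⟩ := exists_card_bound_cover x₀ R hε
  obtain ⟨s, hs, -, hcov⟩ := hN Ω hΩ
  set M := ∑ y ∈ s, |v y| + K * ε with hM
  have hM0 : 0 ≤ M := by positivity
  have hbd : ∀ x ∈ Ω, |v x| ≤ M := by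
    intro x hx
    obtain ⟨y, hy, hxy⟩ := mem_iUnion₂.1 (hcov hx)
    have hxy' : dist x y < ε := hxy
    have h1 := hv x hx y (hs hy) hxy'.le
    have h2 : |v y| ≤ ∑ y ∈ s, |v y| := Finset.single_le_sum (f := fun y => |v y|)
      (fun _ _ => abs_nonneg _) hy
    have h3 : K * dist x y ≤ K * ε := by gcongr
    have h4 := abs_sub_abs_le_abs_sub (v x) (v y)
    linarith
  refine ⟨⟨max K (2 * M / ε), le_max_of_le_left hK⟩, LipschitzOnWith.of_dist_le_mul ?_⟩
  intro x hx y hy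
  rw [Real.dist_eq]
  change _ ≤ max K (2 * M / ε) * dist x y
  rcases le_total (dist x y) ε with h | h
  · exact (hv x hx y hy h).trans (by gcongr; exact le_max_left _ _)
  · calc |v x - v y| ≤ |v x| + |v y| := abs_sub _ _
      _ ≤ 2 * M := by linarith [hbd x hx, hbd y hy]
      _ = 2 * M / ε * ε := by field_simp
      _ ≤ _ := by gcongr; exact le_max_right _ _

end LipschitzExtension

/-! ### Weak derivatives of Lipschitz functions and the quadratic estimate. -/

section Truncation

open Shell

lemma LipschitzWith.hasWeakDeriv {K : ℝ≥0} {V : E3 → ℝ} (hV : LipschitzWith K V) {Ω : Set E3}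
    (e : E3) : HasWeakDeriv volume Ω V e fun x => lineDeriv ℝ V x e := by
  intro φ hφ hφc hφΩ
  have hφ1 : ContDiff ℝ 1 φ := hφ.of_le (by simp)
  obtain ⟨C, hC⟩ := hφ1.lipschitzWith_of_hasCompactSupport hφc (by simp)
  have h := hV.integral_lineDeriv_mul_eq (μ := volume) hC hφc e
  have h0 : ∀ x, x ∉ Ω → φ x = 0 := fun x hx =>
    image_eq_zero_of_notMem_tsupport fun h => hx (hφΩ h)
  have h0' : ∀ x, x ∉ Ω → fderiv ℝ φ x e = 0 := fun x hx => by
    have := image_eq_zero_of_notMem_tsupport (f := fderiv ℝ φ) (x := x)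
      fun h => hx (hφΩ (tsupport_fderiv_subset ℝ h))
    rw [this]; rfl
  rw [setIntegral_eq_integral_of_forall_compl_eq_zero fun x hx => by rw [h0' x hx, mul_zero],
    setIntegral_eq_integral_of_forall_compl_eq_zero fun x hx => by rw [h0 x hx, mul_zero], h,
    ← integral_neg]
  congr 1
  ext x
  rw [(hφ1.differentiable (by simp) x).lineDeriv_eq_fderiv]
  simp [mul_comm]

lemma HasWeakDeriv.sub {Ω : Set E3} {u u' d d' : E3 → ℝ} {e : E3} (hu : IntegrableOn u Ω)
    (hu' : IntegrableOn u' Ω) (hd : IntegrableOn d Ω) (hd' : IntegrableOn d' Ω)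
    (h : HasWeakDeriv volume Ω u e d) (h' : HasWeakDeriv volume Ω u' e d') :
    HasWeakDeriv volume Ω (fun x => u x - u' x) e fun x => d x - d' x := by
  intro φ hφ hφc hφΩ
  have hφ1 : ContDiff ℝ 1 φ := hφ.of_le (by simp)
  have hφ'c : Continuous fun x => fderiv ℝ φ x e := (hφ1.continuous_fderiv_apply (by simp)).comp
    (continuous_id.prodMk continuous_const)
  obtain ⟨C₁, hC₁⟩ := hφ'c.bounded_above_of_compact_support (hφc.fderiv_apply (𝕜 := ℝ) e)
  obtain ⟨C₂, hC₂⟩ := hφ1.continuous.bounded_above_of_compact_support hφc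
  have i1 : ∀ w : E3 → ℝ, IntegrableOn w Ω → IntegrableOn (fun x => w x * fderiv ℝ φ x e) Ω :=
    fun w hw => hw.mul_bdd (c := C₁) hφ'c.aestronglyMeasurable (Eventually.of_forall hC₁)
  have i2 : ∀ w : E3 → ℝ, IntegrableOn w Ω → IntegrableOn (fun x => w x * φ x) Ω :=
    fun w hw => hw.mul_bdd (c := C₂) hφ1.continuous.aestronglyMeasurable (Eventually.of_forall hC₂)
  simp only [sub_mul]
  rw [integral_sub (i1 u hu) (i1 u' hu'), integral_sub (i2 d hd) (i2 d' hd'), h φ hφ hφc hφΩ,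
    h' φ hφ hφc hφΩ]
  ring

/-- The quadratic estimate of the truncation follows from the estimate of the exceptional set. -/
lemma lintegral_enorm_sub_sq_le {α V : Type*} [MeasurableSpace α] [NormedAddCommGroup V]
    {μ : Measure α} {Ω W : Set α} (hΩ : MeasurableSet Ω) {g g' : α → V} {lam C₁ C₂ : ℝ}
    (hg : AEStronglyMeasurable g (μ.restrict Ω)) (hlam : 0 < lam) (hC₁ : 0 ≤ C₁)
    (hW : μ W ≤ ENNReal.ofReal (C₁ / lam) * ∫⁻ x in {x ∈ Ω | lam < ‖g x‖}, ‖g x‖ₑ ∂μ)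
    (hg' : ∀ x ∈ Ω, ‖g' x‖ ≤ C₂ * lam) (heq : ∀ᵐ x ∂μ.restrict Ω, x ∉ W → g x = g' x) :
    ∫⁻ x in Ω, ‖g x - g' x‖ₑ ^ 2 ∂μ ≤ ENNReal.ofReal (2 + (2 + 2 * C₂ ^ 2) * C₁) *
      ∫⁻ x in {x ∈ Ω | lam < ‖g x‖}, ‖g x‖ₑ ^ 2 ∂μ := by
  set S := {x ∈ Ω | lam < ‖g x‖} with hS
  set c : ℝ≥0∞ := ENNReal.ofReal ((2 + 2 * C₂ ^ 2) * lam ^ 2) with hc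
  -- Off `W` the difference vanishes. On `W` it is bounded by 2|g|² plus a multiple of λ², and where
  -- |g| ≤ λ the first term is itself absorbed into that multiple. `W` is replaced by a measurable
  -- hull.
  have hpt : ∀ᵐ x ∂μ.restrict Ω, ‖g x - g' x‖ₑ ^ 2 ≤
      2 * S.indicator (fun x => ‖g x‖ₑ ^ 2) x + (toMeasurable μ W).indicator (fun _ => c) x := by
    filter_upwards [heq, ae_restrict_mem hΩ] with x hx hxΩ
    by_cases hxW : x ∈ W
    · rw [indicator_of_mem (subset_toMeasurable μ W hxW)]
      have h1 : ‖g x - g' x‖ ^ 2 ≤ 2 * ‖g x‖ ^ 2 + 2 * (C₂ * lam) ^ 2 := by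
        have h2 : ‖g x - g' x‖ ≤ ‖g x‖ + C₂ * lam := (norm_sub_le _ _).trans (by
          gcongr; exact hg' x hxΩ)
        have h3 : ‖g x - g' x‖ ^ 2 ≤ (‖g x‖ + C₂ * lam) ^ 2 := by gcongr
        nlinarith [sq_nonneg (‖g x‖ - C₂ * lam)]
      have e2 : (2 : ℝ≥0∞) = ENNReal.ofReal 2 := by simp
      by_cases hxS : x ∈ S
      · rw [indicator_of_mem hxS, ← ofReal_norm, ← ofReal_norm, ← ENNReal.ofReal_pow (norm_nonneg _),
          ← ENNReal.ofReal_pow (norm_nonneg _), e2, ← ENNReal.ofReal_mul (by norm_num), hc,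
          ← ENNReal.ofReal_add (by positivity) (by positivity)]
        refine ENNReal.ofReal_le_ofReal (h1.trans ?_)
        nlinarith [sq_nonneg lam]
      · rw [indicator_of_notMem hxS, mul_zero, zero_add, ← ofReal_norm,
          ← ENNReal.ofReal_pow (norm_nonneg _), hc]
        refine ENNReal.ofReal_le_ofReal (h1.trans ?_)
        have h4 : ‖g x‖ ≤ lam := not_lt.1 fun h => hxS ⟨hxΩ, h⟩
        have h5 : ‖g x‖ ^ 2 ≤ lam ^ 2 := by gcongr
        nlinarith
    · rw [hx hxW]
      simp
  have hSI : ∫⁻ x in Ω, S.indicator (fun x => ‖g x‖ₑ ^ 2) x ∂μ ≤ ∫⁻ x in S, ‖g x‖ₑ ^ 2 ∂μ := by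
    refine (lintegral_indicator_le _ _).trans (le_of_eq ?_)
    rw [Measure.restrict_restrict' hΩ, inter_eq_left.2 fun x hx => hx.1]
  have hWI : ∫⁻ x in Ω, (toMeasurable μ W).indicator (fun _ => c) x ∂μ ≤
      ENNReal.ofReal ((2 + 2 * C₂ ^ 2) * C₁) * ∫⁻ x in S, ‖g x‖ₑ ^ 2 ∂μ := by
    -- On `S` one has λ < |g|, so λ² times the volume bound for `W` becomes quadratic. Since `S`
    -- need not be measurable, the inequality is checked through a measurable representative of `g`.
    have hlamS : ENNReal.ofReal lam * ∫⁻ x in S, ‖g x‖ₑ ∂μ ≤ ∫⁻ x in S, ‖g x‖ₑ ^ 2 ∂μ := by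
      have hSind : ∀ᵐ x ∂μ.restrict S, ENNReal.ofReal lam * ‖g x‖ₑ ≤ ‖g x‖ₑ ^ 2 := by
        have hgm := hg.stronglyMeasurable_mk
        have hA : MeasurableSet {x | ¬ lam < ‖hg.mk g x‖} :=
          (measurableSet_lt measurable_const hgm.norm.measurable).compl
        have h1 : ∀ᵐ x ∂μ.restrict S, g x = hg.mk g x :=
          ae_mono (Measure.restrict_mono_set _ fun x hx => hx.1) hg.ae_eq_mk
        have h2 : ∀ᵐ x ∂μ.restrict S, lam < ‖hg.mk g x‖ := by
          rw [ae_iff, Measure.restrict_apply hA]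
          have h3 := ae_iff.1 hg.ae_eq_mk
          rw [Measure.restrict_apply' hΩ] at h3
          refine measure_mono_null ?_ h3
          rintro x ⟨hx, hxS⟩
          refine ⟨fun h => hx ?_, hxS.1⟩
          rw [← h]
          exact hxS.2
        filter_upwards [h1, h2] with x hx1 hx2
        rw [← hx1] at hx2
        rw [sq, ← ofReal_norm]
        gcongr
      rw [← lintegral_const_mul' _ _ ENNReal.ofReal_ne_top]
      exact lintegral_mono_ae hSind
    calc ∫⁻ x in Ω, (toMeasurable μ W).indicator (fun _ => c) x ∂μ
        ≤ c * μ W := by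
          refine (setLIntegral_le_lintegral _ _).trans ?_
          refine (lintegral_indicator_const_le _ _).trans ?_
          rw [measure_toMeasurable]
      _ ≤ c * (ENNReal.ofReal (C₁ / lam) * ∫⁻ x in S, ‖g x‖ₑ ∂μ) := by gcongr
      _ = ENNReal.ofReal ((2 + 2 * C₂ ^ 2) * C₁) * (ENNReal.ofReal lam * ∫⁻ x in S, ‖g x‖ₑ ∂μ) := by
          rw [← mul_assoc, ← mul_assoc, hc, ← ENNReal.ofReal_mul (by positivity),
            ← ENNReal.ofReal_mul (by positivity)]
          congr 2
          field_simp
      _ ≤ _ := by gcongr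
  calc ∫⁻ x in Ω, ‖g x - g' x‖ₑ ^ 2 ∂μ
      ≤ ∫⁻ x in Ω, (2 * S.indicator (fun x => ‖g x‖ₑ ^ 2) x +
          (toMeasurable μ W).indicator (fun _ => c) x) ∂μ := lintegral_mono_ae hpt
    _ = 2 * ∫⁻ x in Ω, S.indicator (fun x => ‖g x‖ₑ ^ 2) x ∂μ +
          ∫⁻ x in Ω, (toMeasurable μ W).indicator (fun _ => c) x ∂μ := by
        rw [lintegral_add_right _ (measurable_const.indicator (measurableSet_toMeasurable μ W)),
          lintegral_const_mul' _ _ (by simp)]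
    _ ≤ 2 * (∫⁻ x in S, ‖g x‖ₑ ^ 2 ∂μ) +
          ENNReal.ofReal ((2 + 2 * C₂ ^ 2) * C₁) * ∫⁻ x in S, ‖g x‖ₑ ^ 2 ∂μ := by gcongr
    _ = _ := by
        rw [← add_mul, ENNReal.ofReal_add (by norm_num) (by positivity), ENNReal.ofReal_ofNat]

end Truncation

/-! ### The truncation theorem on sets covered by boxes. -/

section Main

open Shell

variable {L : ℝ≥0} {Ω : Set E3} {δ r R h : ℝ}

/-- Directional derivatives in the open set `Ω` see only the local constant `2 * K`. The global
constant `K'` is uncontrolled and serves only to extend the function to the whole space. -/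
lemma exists_lipschitzWith_of_local {Ω A : Set E3} (hΩ : IsOpen Ω) {R : ℝ}
    (hR : Ω ⊆ closedBall 0 R) (hAΩ : A ⊆ Ω) {f : E3 → ℝ} {K ε : ℝ} (hε : 0 < ε) (hK : 0 ≤ K)
    (hf : ∀ x ∈ A, ∀ y ∈ A, dist x y ≤ 5 * ε → |f x - f y| ≤ K * dist x y)
    (hA : ∀ x ∈ Ω, ∃ y ∈ A, dist x y ≤ ε) :
    ∃ (V : E3 → ℝ) (K' : ℝ≥0), LipschitzWith K' V ∧ (∀ x ∈ A, V x = f x) ∧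
      ∀ x ∈ Ω, ∀ e : E3, ‖lineDeriv ℝ V x e‖ ≤ 2 * K * ‖e‖ := by
  obtain ⟨v, hvA, hv⟩ := exists_local_lipschitz_extension hε hK hf hA
  obtain ⟨K', hK'⟩ := exists_lipschitzOnWith_of_local hR hε (by positivity) hv
  obtain ⟨V, hV, hVv⟩ := hK'.extend_real
  refine ⟨V, K', hV, fun x hx => by rw [← hVv (hAΩ hx), hvA x hx], fun x hx e => ?_⟩
  refine norm_lineDeriv_le_of_lip' ℝ (by positivity) ?_
  filter_upwards [hΩ.mem_nhds hx, closedBall_mem_nhds x hε] with y hy hyx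
  rw [← hVv hx, ← hVv hy, ← dist_eq_norm y x]
  exact hv y hy x hx hyx

/-- The volume of `Ω` is controlled by the volume of the part of `Ω` in any ball of fixed radius
centred in `Ω`. -/
lemma exists_volume_le_of_hasBoxCover (hL : 1 ≤ L) (hδ : 0 < δ) (hr : 0 < r) (R : ℝ)
    {ε : ℝ} (hε : 0 < ε) : ∃ C : ℝ, 0 ≤ C ∧ ∃ h₁ : ℝ, 0 < h₁ ∧ ∀ h : ℝ, 0 < h → h < h₁ →
      ∀ Ω : Set E3, HasBoxCover L δ r R h Ω → ∀ x ∈ Ω,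
        volume Ω ≤ ENNReal.ofReal C * volume (Ω ∩ closedBall x ε) := by
  have hL0 : (0 : ℝ) < L := lt_of_lt_of_le one_pos hL
  obtain ⟨N, hN⟩ := exists_card_bound_cover (0 : E3) R hδ
  -- Both volumes are of order `h`: at most `N` patches of volume at most `L³ · R² · 2h` above, and
  -- `boxVol` at scale `ε / L` at least `τ² · h` below. The latter uses `h < τ`, so that the third
  -- factor is exactly `h`.
  set τ := min (ε / L) (r / 2) with hτ
  have hτ0 : 0 < τ := lt_min (div_pos hε hL0) (half_pos hr)
  refine ⟨16 * N * L ^ 6 * R ^ 2 / τ ^ 2, by positivity, τ, hτ0, fun h hh hhτ Ω hc x hx => ?_⟩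
  obtain ⟨s, hsΩ, hsN, hs⟩ := hN Ω hc.subset_closedBall
  have hup : ∀ y ∈ s, volume (Ω ∩ ball y δ) ≤ ENNReal.ofReal (L ^ 3 * (R ^ 2 * (2 * h))) := by
    intro y hy
    obtain ⟨p, q, F, hF, hcov, hpq, hpq2⟩ := hc.exists_patch y (hsΩ hy)
    calc volume (Ω ∩ ball y δ) ≤ volume (F '' openBox p q) :=
          measure_mono ((inter_subset_inter_right _ ball_subset_closedBall).trans hcov)
      _ ≤ (L : ℝ≥0∞) ^ 3 * volume (openBox p q) := hF.lipschitzOn.volume_image_le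
      _ ≤ _ := by
          rw [openBox, Real.volume_pi_Ioo, Fin.prod_univ_three, hpq2,
            ENNReal.ofReal_mul (p := (L : ℝ) ^ 3) (by positivity),
            ENNReal.ofReal_mul (p := R ^ 2) (by positivity),
            ENNReal.ofReal_pow (by positivity), ENNReal.ofReal_coe_nnreal]
          gcongr
          have h0 := hpq 0 (by decide)
          have h1 := hpq 1 (by decide)
          rw [← ENNReal.ofReal_mul (by linarith)]
          refine ENNReal.ofReal_le_ofReal ?_
          rw [sq]
          exact mul_le_mul h0.2 h1.2 (by linarith) (by linarith)
  have htot : volume Ω ≤ ENNReal.ofReal (N * (L ^ 3 * (R ^ 2 * (2 * h)))) := by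
    calc volume Ω ≤ volume (⋃ y ∈ s, Ω ∩ ball y δ) := by
          refine measure_mono fun z hz => ?_
          obtain ⟨y, hy, hzy⟩ := mem_iUnion₂.1 (hs hz)
          exact mem_iUnion₂.2 ⟨y, hy, hz, hzy⟩
      _ ≤ ∑ y ∈ s, volume (Ω ∩ ball y δ) := measure_biUnion_finset_le s _
      _ ≤ ∑ _y ∈ s, ENNReal.ofReal (L ^ 3 * (R ^ 2 * (2 * h))) := Finset.sum_le_sum hup
      _ = s.card * ENNReal.ofReal (L ^ 3 * (R ^ 2 * (2 * h))) := by simp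
      _ ≤ _ := by
          rw [ENNReal.ofReal_mul (p := (N : ℝ)) (by positivity), ENNReal.ofReal_natCast]
          gcongr
  obtain ⟨p, q, F, hF, hcov, hpq, hpq2⟩ := hc.exists_patch x hx
  obtain ⟨a, ha, rfl⟩ := hcov ⟨hx, mem_closedBall_self hδ.le⟩
  have hlow : ENNReal.ofReal (τ ^ 2 * h) ≤
      8 * (L : ℝ≥0∞) ^ 3 * volume (Ω ∩ closedBall (F a) ε) := by
    refine le_trans ?_ (hF.boxVol_le ha hL hε)
    rw [boxVol, Fin.prod_univ_three, hpq2, ENNReal.ofReal_mul (by positivity), sq,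
      ENNReal.ofReal_mul hτ0.le]
    have h0 := (hpq 0 (by decide)).1
    have h1 := (hpq 1 (by decide)).1
    have hτε : τ ≤ ε / L := min_le_left _ _
    have hτr : τ ≤ r / 2 := min_le_right _ _
    gcongr
    · exact le_min hτε (by linarith)
    · exact le_min hτε (by linarith)
    · exact le_min (by linarith) (by linarith)
  calc volume Ω ≤ ENNReal.ofReal (N * (L ^ 3 * (R ^ 2 * (2 * h)))) := htot
    _ = ENNReal.ofReal (2 * N * L ^ 3 * R ^ 2 / τ ^ 2) * ENNReal.ofReal (τ ^ 2 * h) := by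
        rw [← ENNReal.ofReal_mul (by positivity)]
        congr 1
        field_simp
    _ ≤ ENNReal.ofReal (2 * N * L ^ 3 * R ^ 2 / τ ^ 2) *
          (8 * (L : ℝ≥0∞) ^ 3 * volume (Ω ∩ closedBall (F a) ε)) := by gcongr
    _ = _ := by
        have e : 16 * N * (L : ℝ) ^ 6 * R ^ 2 / τ ^ 2 =
            2 * N * L ^ 3 * R ^ 2 / τ ^ 2 * (8 * L ^ 3) := by ring
        rw [e, ENNReal.ofReal_mul (by positivity) (q := 8 * (L : ℝ) ^ 3),
          ENNReal.ofReal_mul (by norm_num : (0 : ℝ) ≤ 8), ENNReal.ofReal_pow (by positivity),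
          ENNReal.ofReal_coe_nnreal, ENNReal.ofReal_ofNat]
        ring

lemma Shell.IsSobolev.hasWeakGradient {m : ℕ} {u : E3 → EuclideanSpace ℝ (Fin m)}
    {Du : E3 → EuclideanSpace ℝ (Fin m × Fin 3)} (hu : IsSobolev 2 Ω u Du)
    (hΩ : volume Ω ≠ ⊤) (j : Fin m) :
    HasWeakGradient Ω (fun x => u x j) fun i x => Du x (j, i) := by
  have : IsFiniteMeasure (volume.restrict Ω) := ⟨by simpa using hΩ.lt_top⟩
  have h1 : Integrable u (volume.restrict Ω) := hu.memLp.integrable (by norm_num)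
  have h2 : Integrable Du (volume.restrict Ω) := hu.memLp_grad.integrable (by norm_num)
  exact ⟨(EuclideanSpace.proj (𝕜 := ℝ) j).integrable_comp h1,
    fun i => (EuclideanSpace.proj (𝕜 := ℝ) (j, i)).integrable_comp h2,
    fun i φ hφ hφc hφΩ => hu.integral_eq φ hφ hφc hφΩ j i⟩

lemma EuclideanSpace.norm_le_card_mul {ι : Type*} [Fintype ι] {w : EuclideanSpace ℝ ι} {c : ℝ}
    (hw : ∀ i, ‖w i‖ ≤ c) : ‖w‖ ≤ Fintype.card ι * c := by
  classical
  have hx : w = ∑ i : ι, w i • EuclideanSpace.single i (1 : ℝ) := by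
    ext j
    simp [Pi.single_apply]
  rw [hx]
  refine (norm_sum_le _ _).trans ?_
  refine (Finset.sum_le_card_nsmul _ _ c fun i _ => ?_).trans (by simp)
  rw [norm_smul]
  simpa using hw i

lemma sum_enorm_row_le {m : ℕ} (w : EuclideanSpace ℝ (Fin m × Fin 3)) (j : Fin m) :
    ∑ i : Fin 3, ‖w (j, i)‖ₑ ≤ 3 * ‖w‖ₑ := by
  refine (Finset.sum_le_card_nsmul _ _ ‖w‖ₑ fun i _ => ?_).trans (by simp)
  exact enorm_le_iff_norm_le.2 (PiLp.norm_apply_le w (j, i))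

/-- The Lipschitz truncation assembled from Lipschitz functions `V j` which coincide with the
components of `u` off an exceptional set `W`. -/
lemma Shell.IsSobolev.truncation_of_components {m : ℕ} {u : E3 → EuclideanSpace ℝ (Fin m)}
    {Du : E3 → EuclideanSpace ℝ (Fin m × Fin 3)} (hu : IsSobolev 2 Ω u Du) (hΩ : IsOpen Ω)
    (hR : Ω ⊆ closedBall 0 R) {C₁ C₂ lam : ℝ} (hlam : 0 < lam) (hC₁ : 0 ≤ C₁) {W : Set E3}
    (hW : volume W ≤ ENNReal.ofReal (C₁ / lam) * ∫⁻ x in {x ∈ Ω | lam < ‖Du x‖}, ‖Du x‖ₑ)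
    {V : Fin m → E3 → ℝ} {K : Fin m → ℝ≥0} (hV : ∀ j, LipschitzWith (K j) (V j))
    (hVu : ∀ j, ∀ x ∈ Ω, x ∉ W → V j x = u x j)
    (hVd : ∀ j, ∀ x ∈ Ω, ∀ i : Fin 3,
      ‖lineDeriv ℝ (V j) x (EuclideanSpace.single i 1)‖ ≤ C₂ * lam) :
    ∃ (v : E3 → EuclideanSpace ℝ (Fin m)) (Dv : E3 → EuclideanSpace ℝ (Fin m × Fin 3)),
      IsSobolev ∞ Ω v Dv ∧
      eLpNorm Dv ∞ (volume.restrict Ω) ≤ ENNReal.ofReal (m * 3 * C₂ * lam) ∧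
      volume {x ∈ Ω | u x ≠ v x} ≤
        ENNReal.ofReal (C₁ / lam) * ∫⁻ x in {x ∈ Ω | lam < ‖Du x‖}, ‖Du x‖ₑ ∧
      ∫⁻ x in Ω, ‖Du x - Dv x‖ₑ ^ 2 ≤ ENNReal.ofReal (2 + (2 + 2 * (m * 3 * C₂) ^ 2) * C₁) *
        ∫⁻ x in {x ∈ Ω | lam < ‖Du x‖}, ‖Du x‖ₑ ^ 2 := by
  have hΩf : volume Ω ≠ ⊤ :=
    ne_top_of_le_ne_top (isCompact_closedBall _ _).measure_lt_top.ne (measure_mono hR)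
  have : IsFiniteMeasure (volume.restrict Ω) := ⟨by simpa using hΩf.lt_top⟩
  set v : E3 → EuclideanSpace ℝ (Fin m) := fun x => WithLp.toLp 2 fun j => V j x with hv
  set Dv : E3 → EuclideanSpace ℝ (Fin m × Fin 3) := fun x =>
    WithLp.toLp 2 fun k => lineDeriv ℝ (V k.1) x (EuclideanSpace.single k.2 1) with hDv
  have hvc : Continuous v := by
    refine (PiLp.continuous_toLp 2 _).comp (continuous_pi fun j => (hV j).continuous)
  have hDvm : Measurable Dv := by
    refine (WithLp.measurable_toLp 2 _).comp (measurable_pi_lambda _ fun k =>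
      measurable_lineDeriv (hV k.1).continuous)
  have hDvle : ∀ x ∈ Ω, ‖Dv x‖ ≤ m * 3 * C₂ * lam := by
    intro x hx
    refine (EuclideanSpace.norm_le_card_mul (c := C₂ * lam) fun k => hVd k.1 x hx k.2).trans
      (le_of_eq ?_)
    simp only [Fintype.card_prod, Fintype.card_fin]
    push_cast
    ring
  have hDvae : ∀ᵐ x ∂volume.restrict Ω, ‖Dv x‖ ≤ m * 3 * C₂ * lam := by
    filter_upwards [ae_restrict_mem hΩ.measurableSet] with x hx using hDvle x hx
  obtain ⟨B, hB⟩ := (isCompact_closedBall (0 : E3) R).exists_bound_of_continuousOn hvc.continuousOn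
  have hvL : MemLp v ∞ (volume.restrict Ω) := by
    refine memLp_top_of_bound hvc.aestronglyMeasurable B ?_
    filter_upwards [ae_restrict_mem hΩ.measurableSet] with x hx using hB x (hR hx)
  have hDvL : MemLp Dv ∞ (volume.restrict Ω) :=
    memLp_top_of_bound hDvm.aestronglyMeasurable _ hDvae
  have hweak : ∀ j i, HasWeakDeriv volume Ω (fun x => v x j) (EuclideanSpace.single i 1)
      fun x => Dv x (j, i) := fun j i => (hV j).hasWeakDeriv _
  have hne : {x ∈ Ω | u x ≠ v x} ⊆ W := by
    rintro x ⟨hx, hux⟩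
    by_contra hxW
    refine hux ?_
    ext j
    exact (hVu j x hx hxW).symm
  refine ⟨v, Dv, ⟨hvL, hDvL, fun φ hφ hφc hφΩ j i => hweak j i φ hφ hφc hφΩ⟩, ?_,
    (measure_mono hne).trans hW, ?_⟩
  · rw [eLpNorm_exponent_top]
    refine eLpNormEssSup_le_of_ae_bound hDvae
  refine lintegral_enorm_sub_sq_le hΩ.measurableSet hu.memLp_grad.1 hlam hC₁ hW hDvle ?_
  have hvi : Integrable v (volume.restrict Ω) := hvL.integrable (by simp)
  have hDvi : Integrable Dv (volume.restrict Ω) := hDvL.integrable (by simp)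
  have hzero : ∀ᵐ x ∂volume.restrict Ω, ∀ j i, u x j - v x j = 0 →
      Du x (j, i) - Dv x (j, i) = 0 := by
    rw [ae_all_iff]; intro j
    rw [ae_all_iff]; intro i
    have h1 := hu.hasWeakGradient hΩf j
    have h2 : IntegrableOn (fun x => v x j) Ω := (EuclideanSpace.proj (𝕜 := ℝ) j).integrable_comp hvi
    have h3 : IntegrableOn (fun x => Dv x (j, i)) Ω :=
      (EuclideanSpace.proj (𝕜 := ℝ) (j, i)).integrable_comp hDvi
    exact ((h1.hasWeakDeriv i).sub h1.integrableOn h2 (h1.integrableOn_grad i) h3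
      (hweak j i)).ae_eq_zero_of_eq_zero hΩ (h1.integrableOn.sub h2)
      ((h1.integrableOn_grad i).sub h3)
  filter_upwards [hzero, ae_restrict_mem hΩ.measurableSet] with x hx hxΩ hxW
  ext k
  have := hx k.1 k.2 (by rw [hv]; simp only; rw [hVu k.1 x hxΩ hxW, sub_self])
  exact sub_eq_zero.1 this

/-- Lipschitz truncation of Sobolev functions on sets which are uniformly covered by boxes. -/
theorem exists_truncation_of_hasBoxCover (m : ℕ) (hL : 1 ≤ L) (hδ : 0 < δ) (hr : 0 < r) (R : ℝ) :
    ∃ C : ℝ, 0 < C ∧ ∃ h₁ : ℝ, 0 < h₁ ∧ ∀ h : ℝ, 0 < h → h < h₁ →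
      ∀ Ω : Set E3, HasBoxCover L δ r R h Ω →
      ∀ (u : E3 → EuclideanSpace ℝ (Fin m)) (Du : E3 → EuclideanSpace ℝ (Fin m × Fin 3)),
        IsSobolev 2 Ω u Du → ∀ lam : ℝ, 0 < lam →
        ∃ (v : E3 → EuclideanSpace ℝ (Fin m)) (Dv : E3 → EuclideanSpace ℝ (Fin m × Fin 3)),
          IsSobolev ∞ Ω v Dv ∧
          eLpNorm Dv ∞ (volume.restrict Ω) ≤ ENNReal.ofReal (C * lam) ∧
          volume {x ∈ Ω | u x ≠ v x} ≤
            ENNReal.ofReal (C / lam) * ∫⁻ x in {x ∈ Ω | lam < ‖Du x‖}, ‖Du x‖ₑ ∧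
          ∫⁻ x in Ω, ‖Du x - Dv x‖ₑ ^ 2 ≤
            ENNReal.ofReal C * ∫⁻ x in {x ∈ Ω | lam < ‖Du x‖}, ‖Du x‖ₑ ^ 2 := by
  have hL0 : (0 : ℝ) < L := lt_of_lt_of_le one_pos hL
  -- Chosen so that 5ε, the range needed by the extension, equals δ/(10L²), the range of the
  -- Lipschitz estimate on the good set.
  set ε := δ / (50 * L ^ 2) with hεd
  have hε : 0 < ε := by positivity
  obtain ⟨CV, hCV, h₁, hh₁, hvol⟩ := exists_volume_le_of_hasBoxCover hL hδ hr R hε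
  set CB : ℝ := 8000 * L ^ 12 with hCB
  -- The two entries serve the two cases: exceptional set the bad set, or exceptional set all of
  -- `Ω`.
  set C₁ : ℝ := max CB (CV * CB) with hC₁d
  have hC₁ : 0 ≤ C₁ := le_max_of_le_left (by positivity)
  set C₂ : ℝ := 2 * (768 * 384 * L ^ 14) with hC₂d
  have hC₂ : 0 ≤ C₂ := by positivity
  set C : ℝ := m * 3 * C₂ + C₁ + (2 + (2 + 2 * (m * 3 * C₂) ^ 2) * C₁) with hC
  have hC3 : 0 ≤ (2 + 2 * (m * 3 * C₂) ^ 2) * C₁ := by positivity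
  have hC4 : 0 ≤ m * 3 * C₂ := by positivity
  refine ⟨C, by linarith, h₁, hh₁, fun h hh hhh Ω hc u Du hu lam hlam => ?_⟩
  have hΩ := hc.isOpen hδ.le
  have hR := hc.subset_closedBall
  have hΩf : volume Ω ≠ ⊤ :=
    ne_top_of_le_ne_top (isCompact_closedBall _ _).measure_lt_top.ne (measure_mono hR)
  set S := {x ∈ Ω | lam < ‖Du x‖} with hS
  set G : E3 → ℝ≥0∞ := fun x => ‖Du x‖ₑ with hG
  set Bad := {x ∈ Ω | ¬ MaximalLE Ω G (δ / 5) (2 * ENNReal.ofReal lam) x} with hBad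
  have hSG : {x ∈ Ω | ENNReal.ofReal lam < G x} = S := by
    ext x
    simp only [hS, hG, mem_ofPred_eq, ← ofReal_norm]
    rw [ENNReal.ofReal_lt_ofReal_iff_of_nonneg hlam.le]
  have hbadvol : volume Bad ≤ ENNReal.ofReal (CB / lam) * ∫⁻ x in S, ‖Du x‖ₑ := by
    have h1 := hc.volume_not_maximalLE_le hL hδ (G := G) (c := ENNReal.ofReal lam)
      ENNReal.ofReal_ne_top
    rw [hSG] at h1
    have hne : ENNReal.ofReal lam ≠ 0 := by simpa using hlam
    rw [← ENNReal.mul_le_mul_iff_right hne ENNReal.ofReal_ne_top]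
    refine h1.trans (le_of_eq ?_)
    rw [← mul_assoc, ← ENNReal.ofReal_mul hlam.le, mul_div_cancel₀ _ hlam.ne', hCB,
      ENNReal.ofReal_mul (by norm_num), ENNReal.ofReal_pow (by positivity),
      ENNReal.ofReal_coe_nnreal, ENNReal.ofReal_ofNat]
  have hnull : ∀ j : Fin m, ∃ Z : Set E3, volume Z = 0 ∧ ∀ lam : ℝ, 0 ≤ lam →
      ∀ x ∈ Ω \ Z, ∀ y ∈ Ω \ Z, MaximalLE Ω G (δ / 5) (2 * ENNReal.ofReal lam) x →
      MaximalLE Ω G (δ / 5) (2 * ENNReal.ofReal lam) y → dist x y ≤ δ / (10 * L ^ 2) →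
      ‖u x j - u y j‖ ≤ 768 * 384 * L ^ 14 * lam * dist x y := fun j =>
    hc.exists_null_norm_sub_le hL hδ (hu.hasWeakGradient hΩf j) fun x => sum_enorm_row_le (Du x) j
  choose Z hZ0 hZ using hnull
  set W := Bad ∪ ⋃ j, Z j with hW
  have hWBad : volume W ≤ volume Bad := by
    refine (measure_union_le _ _).trans ?_
    rw [measure_iUnion_null hZ0, add_zero]
  set A := Ω \ W with hA
  have hA' : ∀ x ∈ A, ∀ j, x ∈ Ω \ Z j := fun x hx j =>
    ⟨hx.1, fun h => hx.2 (Or.inr (mem_iUnion.2 ⟨j, h⟩))⟩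
  have hAM : ∀ x ∈ A, MaximalLE Ω G (δ / 5) (2 * ENNReal.ofReal lam) x := fun x hx => by
    by_contra h
    exact hx.2 (Or.inl ⟨hx.1, h⟩)
  have hfinal : ∀ W' : Set E3, volume W' ≤ ENNReal.ofReal (C₁ / lam) * ∫⁻ x in S, ‖Du x‖ₑ →
      ∀ (V : Fin m → E3 → ℝ) (K : Fin m → ℝ≥0), (∀ j, LipschitzWith (K j) (V j)) →
      (∀ j, ∀ x ∈ Ω, x ∉ W' → V j x = u x j) → (∀ j, ∀ x ∈ Ω, ∀ i : Fin 3,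
        ‖lineDeriv ℝ (V j) x (EuclideanSpace.single i 1)‖ ≤ C₂ * lam) →
      ∃ (v : E3 → EuclideanSpace ℝ (Fin m)) (Dv : E3 → EuclideanSpace ℝ (Fin m × Fin 3)),
          IsSobolev ∞ Ω v Dv ∧
          eLpNorm Dv ∞ (volume.restrict Ω) ≤ ENNReal.ofReal (C * lam) ∧
          volume {x ∈ Ω | u x ≠ v x} ≤
            ENNReal.ofReal (C / lam) * ∫⁻ x in S, ‖Du x‖ₑ ∧
          ∫⁻ x in Ω, ‖Du x - Dv x‖ₑ ^ 2 ≤ ENNReal.ofReal C * ∫⁻ x in S, ‖Du x‖ₑ ^ 2 := by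
    intro W' hW' V K hV hVu hVd
    obtain ⟨v, Dv, h1, h2, h3, h4⟩ :=
      hu.truncation_of_components hΩ hR hlam hC₁ hW' hV hVu hVd
    refine ⟨v, Dv, h1, h2.trans (ENNReal.ofReal_le_ofReal ?_), h3.trans ?_, h4.trans ?_⟩
    · gcongr; linarith
    · gcongr; linarith
    · gcongr; linarith
  -- If density fails, `W` swallows a whole ball of radius ε in `Ω`; then `volume Ω` is itself
  -- controlled by the bad set, and zero is taken as the truncation.
  by_cases hdense : ∀ x ∈ Ω, ∃ y ∈ A, dist x y ≤ ε
  · have hlip : ∀ j : Fin m, ∃ (V : E3 → ℝ) (K' : ℝ≥0), LipschitzWith K' V ∧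
        (∀ x ∈ A, V x = u x j) ∧
        ∀ x ∈ Ω, ∀ e : E3, ‖lineDeriv ℝ V x e‖ ≤ 2 * (768 * 384 * L ^ 14 * lam) * ‖e‖ := by
      intro j
      refine exists_lipschitzWith_of_local hΩ hR sdiff_subset hε (by positivity)
        (fun x hx y hy hxy => ?_) hdense
      refine hZ j lam hlam.le x (hA' x hx j) y (hA' y hy j) (hAM x hx) (hAM y hy) (hxy.trans ?_)
      rw [hεd]
      refine le_of_eq ?_
      field_simp
      norm_num
    choose V K hV hVA hVd using hlip
    refine hfinal W (hWBad.trans (hbadvol.trans ?_)) V K hV (fun j x hx hxW => hVA j x ⟨hx, hxW⟩)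
      fun j x hx i => ?_
    · gcongr
      exact le_max_left _ _
    · refine (hVd j x hx _).trans (le_of_eq ?_)
      simp [hC₂d]
      ring
  · push Not at hdense
    obtain ⟨x, hx, hxA⟩ := hdense
    have hsub : Ω ∩ closedBall x ε ⊆ W := by
      rintro y ⟨hy, hyx⟩
      by_contra hyW
      exact absurd (mem_closedBall'.1 hyx) (not_le.2 (hxA y ⟨hy, hyW⟩))
    refine hfinal Ω ?_ (fun _ _ => 0) (fun _ => 0) (fun _ => LipschitzWith.const 0)
      (fun j x hx hx' => absurd hx hx') fun j x _ i => ?_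
    · calc volume Ω ≤ ENNReal.ofReal CV * volume (Ω ∩ closedBall x ε) := hvol h hh hhh Ω hc x hx
        _ ≤ ENNReal.ofReal CV * (ENNReal.ofReal (CB / lam) * ∫⁻ x in S, ‖Du x‖ₑ) := by
            gcongr
            exact (measure_mono hsub).trans (hWBad.trans hbadvol)
        _ = ENNReal.ofReal (CV * CB / lam) * ∫⁻ x in S, ‖Du x‖ₑ := by
            rw [← mul_assoc, ← ENNReal.ofReal_mul hCV, ← mul_div_assoc]
        _ ≤ _ := by
            gcongr
            exact le_max_right _ _
    · have : lineDeriv ℝ (fun _ : E3 => (0 : ℝ)) x (EuclideanSpace.single i 1) = 0 := by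
        simp [lineDeriv]
      rw [this, norm_zero]
      positivity

end Main

/-! ### Normal coordinates of the surface. -/

section NormalCoordinates

open Shell

/-- The point of the plane `{x₂ = 0}` with the first two coordinates of `y`. -/
noncomputable def planePoint : (Fin 3 → ℝ) →L[ℝ] E3 :=
  ((EuclideanSpace.equiv (Fin 3) ℝ).symm : (Fin 3 → ℝ) →L[ℝ] E3).comp
    (ContinuousLinearMap.pi ![ContinuousLinearMap.proj 0, ContinuousLinearMap.proj 1, 0])

@[simp] lemma planePoint_zero (y : Fin 3 → ℝ) : planePoint y 0 = y 0 := by simp [planePoint]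

@[simp] lemma planePoint_one (y : Fin 3 → ℝ) : planePoint y 1 = y 1 := by simp [planePoint]

@[simp] lemma planePoint_two (y : Fin 3 → ℝ) : planePoint y 2 = 0 := by simp [planePoint]

lemma planePoint_eq {y : Fin 3 → ℝ} {x : E3} (h0 : x 0 = y 0) (h1 : x 1 = y 1) (h2 : x 2 = 0) :
    planePoint y = x := by
  ext i
  fin_cases i <;> simp [h0, h1, h2]

variable {M : Set E3} {Φ : OpenPartialHomeomorph E3 E3}

/-- The gradient of the last coordinate of a chart. -/
noncomputable def chartGradient (Φ : OpenPartialHomeomorph E3 E3) (x : E3) : E3 :=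
  (InnerProductSpace.toDual ℝ E3).symm ((EuclideanSpace.proj (𝕜 := ℝ) (2 : Fin 3)).comp
    (fderiv ℝ Φ x))

/-- The unit normal given by a chart. -/
noncomputable def chartNormal (Φ : OpenPartialHomeomorph E3 E3) (x : E3) : E3 :=
  ‖chartGradient Φ x‖⁻¹ • chartGradient Φ x

/-- Normal coordinates given by a chart. -/
noncomputable def normalCoord (Φ : OpenPartialHomeomorph E3 E3) (y : Fin 3 → ℝ) : E3 :=
  Φ.symm (planePoint y) + y 2 • chartNormal Φ (Φ.symm (planePoint y))

lemma inner_chartGradient (x w : E3) : inner ℝ (chartGradient Φ x) w = fderiv ℝ Φ x w 2 := by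
  rw [chartGradient, InnerProductSpace.toDual_symm_apply]
  rfl

lemma fderiv_fderiv_symm (hΦ : IsFlatteningChart M Φ) {x : E3} (hx : x ∈ Φ.source) (w : E3) :
    fderiv ℝ Φ x (fderiv ℝ Φ.symm (Φ x) w) = w := by
  have h1 : DifferentiableAt ℝ Φ x :=
    (hΦ.contDiffOn.contDiffAt (Φ.open_source.mem_nhds hx)).differentiableAt (by simp)
  have h2 : DifferentiableAt ℝ Φ.symm (Φ x) :=
    (hΦ.contDiffOn_symm.contDiffAt (Φ.open_target.mem_nhds (Φ.map_source hx))).differentiableAt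
      (by simp)
  have h3 : HasFDerivAt (Φ ∘ Φ.symm) ((fderiv ℝ Φ x).comp (fderiv ℝ Φ.symm (Φ x))) (Φ x) := by
    refine HasFDerivAt.comp (Φ x) ?_ h2.hasFDerivAt
    rw [Φ.left_inv hx]
    exact h1.hasFDerivAt
  have h4 : HasFDerivAt (Φ ∘ Φ.symm) (ContinuousLinearMap.id ℝ E3) (Φ x) := by
    refine (hasFDerivAt_id (Φ x)).congr_of_eventuallyEq ?_
    filter_upwards [Φ.open_target.mem_nhds (Φ.map_source hx)] with y hy
    exact Φ.right_inv hy
  have := congrArg (fun T : E3 →L[ℝ] E3 => T w) (h3.unique h4)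
  exact this

/-- The differential of the chart is onto, so some vector has image with last coordinate 1. -/
lemma chartGradient_ne_zero (hΦ : IsFlatteningChart M Φ) {x : E3} (hx : x ∈ Φ.source) :
    chartGradient Φ x ≠ 0 := by
  intro h
  have h1 := inner_chartGradient (Φ := Φ) x
    (fderiv ℝ Φ.symm (Φ x) (EuclideanSpace.single 2 1))
  rw [fderiv_fderiv_symm hΦ hx, h] at h1
  simp at h1

/-- The normal costs one derivative of the chart; this is where `C²` regularity of the surface
enters. -/
lemma contDiffAt_chartNormal (hΦ : IsFlatteningChart M Φ) {x : E3} (hx : x ∈ Φ.source) :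
    ContDiffAt ℝ 1 (chartNormal Φ) x := by
  have h1 : ContDiffAt ℝ 1 (fderiv ℝ Φ) x :=
    (hΦ.contDiffOn.contDiffAt (Φ.open_source.mem_nhds hx)).fderiv_right (by norm_num)
  have h2 : ContDiffAt ℝ 1 (chartGradient Φ) x := by
    refine (InnerProductSpace.toDual ℝ E3).symm.toContinuousLinearEquiv.contDiff.contDiffAt.comp x ?_
    exact contDiffAt_const.clm_comp h1
  exact ((h2.norm ℝ (chartGradient_ne_zero hΦ hx)).inv
    (norm_ne_zero_iff.2 (chartGradient_ne_zero hΦ hx))).smul h2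

/-- A unit normal coincides up to sign with the unit normal of a chart. -/
lemma eq_or_eq_neg_chartNormal {S : Set E3} {n : E3 → E3} (hn : IsUnitNormalField M S n)
    (hΦ : IsFlatteningChart M Φ) {x : E3} (hx : x ∈ Φ.source) (hxS : x ∈ S) :
    n x = chartNormal Φ x ∨ n x = - chartNormal Φ x := by
  set G := chartGradient Φ x with hG
  have hG0 : G ≠ 0 := chartGradient_ne_zero hΦ hx
  have hGn : ‖G‖ ≠ 0 := norm_ne_zero_iff.2 hG0
  set c : ℝ := inner ℝ G (n x) / ‖G‖ ^ 2 with hc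
  -- The part of `n x` orthogonal to `G` is tangent, hence orthogonal to `n x` as well as to `G`,
  -- hence to itself.
  set w := n x - c • G with hw
  have hwG : inner ℝ G w = 0 := by
    rw [hw, inner_sub_right, inner_smul_right, real_inner_self_eq_norm_sq, hc]
    field_simp
    ring
  have hwt : w ∈ tangentVectors M x := ⟨Φ, hΦ, hx, by rw [← inner_chartGradient]; exact hwG⟩
  have hwn : inner ℝ w (n x) = 0 := hn.inner_eq_zero x hxS w hwt
  have hw0 : w = 0 := by
    rw [← inner_self_eq_zero (𝕜 := ℝ)]
    conv_lhs => rw [hw]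
    rw [← hw, inner_sub_left, inner_smul_left, hwG, mul_zero, sub_zero, real_inner_comm]
    exact hwn
  have hnG : n x = c • G := sub_eq_zero.1 hw0
  have hnorm : |c| * ‖G‖ = 1 := by
    have := hn.norm_eq_one x hxS
    rwa [hnG, norm_smul, Real.norm_eq_abs] at this
  rw [hnG, chartNormal, ← hG]
  rcases abs_choice c with h | h
  · left
    rw [h] at hnorm
    rw [eq_inv_of_mul_eq_one_left hnorm]
  · right
    rw [h] at hnorm
    rw [← neg_smul, ← eq_inv_of_mul_eq_one_left hnorm, neg_neg]

/-- At height zero the derivative of the normal field drops out. Applying the differential of the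
chart to the image of `v` and reading the last coordinate gives `v 2` times the norm of the
gradient; so the kernel is trivial, and equality of dimensions gives an isomorphism. -/
lemma normalCoord_hasStrictFDerivAt (hΦ : IsFlatteningChart M Φ) {x : E3} (hx : x ∈ Φ.source)
    {y : Fin 3 → ℝ} (hy : planePoint y = Φ x) (hy2 : y 2 = 0) :
    ∃ f' : (Fin 3 → ℝ) ≃L[ℝ] E3, HasStrictFDerivAt (normalCoord Φ) (f' : (Fin 3 → ℝ) →L[ℝ] E3) y := by
  have hyt : planePoint y ∈ Φ.target := hy ▸ Φ.map_source hx
  have hψ : ContDiffAt ℝ 1 Φ.symm (planePoint y) :=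
    (hΦ.contDiffOn_symm.contDiffAt (Φ.open_target.mem_nhds hyt)).of_le (by norm_num)
  have hX : ContDiffAt ℝ 1 (fun y => Φ.symm (planePoint y)) y :=
    hψ.comp y planePoint.contDiff.contDiffAt
  have hXy : Φ.symm (planePoint y) = x := by rw [hy, Φ.left_inv hx]
  have hν : ContDiffAt ℝ 1 (fun y => chartNormal Φ (Φ.symm (planePoint y))) y := by
    have h0 : ContDiffAt ℝ 1 (chartNormal Φ) (Φ.symm (planePoint y)) := by
      rw [hXy]
      exact contDiffAt_chartNormal hΦ hx
    exact ContDiffAt.comp (g := chartNormal Φ) (f := fun y => Φ.symm (planePoint y)) y h0 hX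
  have hp2 : ContDiffAt ℝ 1 (fun y : Fin 3 → ℝ => y 2) y := (contDiff_apply ℝ ℝ 2).contDiffAt
  have hN : ContDiffAt ℝ 1 (normalCoord Φ) y := hX.add (hp2.smul hν)
  have hXd : HasFDerivAt (fun y => Φ.symm (planePoint y))
      ((fderiv ℝ Φ.symm (Φ x)).comp planePoint) y := by
    have h := (hψ.differentiableAt (by simp)).hasFDerivAt.comp y planePoint.hasFDerivAt
    rwa [hy] at h
  have hNd := hXd.add ((ContinuousLinearMap.proj (R := ℝ) (φ := fun _ : Fin 3 => ℝ)
    2).hasFDerivAt.smul (hν.differentiableAt (by simp)).hasFDerivAt)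
  have hval : ∀ v, fderiv ℝ (normalCoord Φ) y v =
      fderiv ℝ Φ.symm (Φ x) (planePoint v) + v 2 • chartNormal Φ x := by
    intro v
    have : fderiv ℝ (normalCoord Φ) y = _ := hNd.fderiv
    rw [this]
    simp [hy2, hXy]
  have hinj : Function.Injective (fderiv ℝ (normalCoord Φ) y) := by
    rw [injective_iff_map_eq_zero]
    intro v hv
    rw [hval] at hv
    have h1 := congrArg (fun z => fderiv ℝ Φ x z) hv
    simp only [map_add, map_smul, map_zero] at h1
    rw [fderiv_fderiv_symm hΦ hx] at h1
    have h2 := congrArg (fun z : E3 => z 2) h1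
    have h3 : fderiv ℝ Φ x (chartNormal Φ x) 2 = ‖chartGradient Φ x‖ := by
      rw [← inner_chartGradient, chartNormal, inner_smul_right, real_inner_self_eq_norm_sq]
      have := norm_ne_zero_iff.2 (chartGradient_ne_zero hΦ hx)
      field_simp
    have hv2 : v 2 = 0 := by
      simp only [PiLp.add_apply, PiLp.smul_apply, planePoint_two, h3, PiLp.zero_apply, zero_add,
        smul_eq_mul, mul_eq_zero, norm_eq_zero, chartGradient_ne_zero hΦ hx, or_false] at h2
      exact h2
    rw [hv2, zero_smul, add_zero] at h1
    have hv0 := congrArg (fun z : E3 => z 0) h1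
    have hv1 := congrArg (fun z : E3 => z 1) h1
    simp only [planePoint_zero, planePoint_one, PiLp.zero_apply] at hv0 hv1
    ext i
    fin_cases i <;> simp [hv0, hv1, hv2]
  set e := (fderiv ℝ (normalCoord Φ) y).toLinearMap.linearEquivOfInjective hinj (by simp) with he
  refine ⟨e.toContinuousLinearEquiv, ?_⟩
  have h1 := hN.hasStrictFDerivAt (by simp)
  convert! h1 using 1

end NormalCoordinates

/-! ### Uniform box covers of thin shells. -/

section ShellCover

open Shell

lemma HasStrictFDerivAt.exists_isOpen_biLipschitz {E F : Type*} [NormedAddCommGroup E]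
    [NormedSpace ℝ E] [NormedAddCommGroup F] [NormedSpace ℝ F] [CompleteSpace E] {f : E → F}
    {f' : E ≃L[ℝ] F} {a : E} (hf : HasStrictFDerivAt f (f' : E →L[ℝ] F) a) :
    ∃ (L : ℝ≥0) (s : Set E), IsOpen s ∧ a ∈ s ∧ LipschitzOnWith L f s ∧
      (∀ x ∈ s, ∀ y ∈ s, dist x y ≤ L * dist (f x) (f y)) ∧
      ∀ t ⊆ s, IsOpen t → IsOpen (f '' t) := by
  obtain ⟨s, has, hs, hfs⟩ := hf.approximates_deriv_on_open_nhds
  have hc : Subsingleton E ∨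
      ‖(f'.symm : F →L[ℝ] E)‖₊⁻¹ / 2 < ‖(f'.symm : F →L[ℝ] E)‖₊⁻¹ :=
    f'.subsingleton_or_nnnorm_symm_pos.imp id fun hf' =>
      NNReal.half_lt_self <| ne_of_gt <| inv_pos.2 hf'
  have h1 := hfs.lipschitz
  have h2 := hfs.antilipschitz hc
  set A := ‖(f' : E →L[ℝ] F)‖₊ + ‖(f'.symm : F →L[ℝ] E)‖₊⁻¹ / 2
  set B := (‖(f'.symm : F →L[ℝ] E)‖₊⁻¹ - ‖(f'.symm : F →L[ℝ] E)‖₊⁻¹ / 2)⁻¹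
  refine ⟨max A B, s, hs, has, ?_, ?_, ?_⟩
  · exact (lipschitzOnWith_iff_restrict.2 h1).weaken (le_max_left _ _)
  · intro x hx y hy
    have h3 := h2.le_mul_dist ⟨x, hx⟩ ⟨y, hy⟩
    refine h3.trans ?_
    gcongr
    · exact le_max_right _ _
    · exact le_rfl
  · intro t hts ht
    refine (hfs.mono_set hts).open_image f'.toNonlinearRightInverse ht ?_
    rwa [f'.toEquiv.subsingleton_congr] at hc

/-- The shear that carries the half space `{y₁ > 0}` to the region above the graph of `g`. -/
def shear (g : ℝ → ℝ) (y : Fin 3 → ℝ) : Fin 3 → ℝ := ![y 0, g (y 0) + y 1, y 2]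

lemma shear_neg_shear (g : ℝ → ℝ) (y : Fin 3 → ℝ) : shear (fun t => - g t) (shear g y) = y := by
  ext i
  fin_cases i <;> simp [shear]

lemma shear_shear_neg (g : ℝ → ℝ) (y : Fin 3 → ℝ) : shear g (shear (fun t => - g t) y) = y := by
  ext i
  fin_cases i <;> simp [shear]

lemma lipschitzWith_shear {K : ℝ≥0} {g : ℝ → ℝ} (hg : LipschitzWith K g) :
    LipschitzWith (K + 1) (shear g) := by
  refine LipschitzWith.of_dist_le_mul fun x y => ?_
  rw [dist_pi_le_iff (by positivity)]
  have hi : ∀ i, dist (x i) (y i) ≤ (K + 1) * dist x y := fun i =>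
    (dist_le_pi_dist x y i).trans (le_mul_of_one_le_left dist_nonneg (by simp))
  intro i
  fin_cases i
  · simpa [shear] using hi 0
  · have h1 := hg.dist_le_mul (x 0) (y 0)
    have h0 := dist_le_pi_dist x y 0
    have h2 := dist_le_pi_dist x y 1
    have h3 : (K : ℝ) * dist (x 0) (y 0) ≤ K * dist x y := by gcongr
    have h4 := dist_add_add_le (g (x 0)) (x 1) (g (y 0)) (y 1)
    simp only [shear, Fin.mk_one, Matrix.cons_val_one, Matrix.cons_val_zero, NNReal.coe_add,
      NNReal.coe_one]
    linarith
  · simpa [shear] using hi 2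

lemma isOpen_shear_image {K : ℝ≥0} {g : ℝ → ℝ} (hg : LipschitzWith K g) {s : Set (Fin 3 → ℝ)}
    (hs : IsOpen s) : IsOpen (shear g '' s) := by
  have : shear g '' s = shear (fun t => - g t) ⁻¹' s := by
    rw [Set.image_eq_preimage_of_inverse (shear_neg_shear g) (shear_shear_neg g)]
  rw [this]
  exact hs.preimage (lipschitzWith_shear (K := K) hg.neg).continuous

variable {M S : Set E3} {n : E3 → E3}

/-- Near each point of its closure a Lipschitz region lies above a graph in a chart. -/
lemma exists_graph_chart (hM : IsC2Surface M) (hS : IsBoundedLipschitzRegion M S) {p : E3}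
    (hp : p ∈ closure S) :
    ∃ Φ : OpenPartialHomeomorph E3 E3, IsFlatteningChart M Φ ∧ p ∈ Φ.source ∧
      ∃ (K : ℝ≥0) (g : ℝ → ℝ), LipschitzWith K g ∧ ∃ O : Set E3, IsOpen O ∧ p ∈ O ∧
        O ⊆ Φ.source ∧ ∀ x ∈ M ∩ O, x ∈ S ↔ g (Φ x 0) < Φ x 1 := by
  by_cases hpS : p ∈ S
  · obtain ⟨Φ, hΦ, hpΦ⟩ := hM p (hS.closure_subset hp)
    obtain ⟨U, hU, hSU⟩ := hS.isOpen_in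
    have hcont : ContinuousOn (fun x => Φ x 1) Φ.source :=
      (EuclideanSpace.proj (𝕜 := ℝ) (1 : Fin 3)).continuous.comp_continuousOn Φ.continuousOn
    -- At a point of `S` the graph is a dummy: a constant low enough that all of `M ∩ O` lies above
    -- it.
    refine ⟨Φ, hΦ, hpΦ, 0, fun _ => Φ p 1 - 1, LipschitzWith.const _,
      (Φ.source ∩ (fun x => Φ x 1) ⁻¹' Ioi (Φ p 1 - 1)) ∩ U,
      (hcont.isOpen_inter_preimage Φ.open_source isOpen_Ioi).inter hU,
      ⟨⟨hpΦ, by simp⟩, (hSU ▸ hpS).2⟩, fun x hx => hx.1.1, ?_⟩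
    rintro x ⟨hxM, ⟨-, hx1⟩, hxU⟩
    exact ⟨fun _ => hx1, fun _ => hSU ▸ ⟨hxM, hxU⟩⟩
  · obtain ⟨Φ, hΦ, hpΦ, K, g, hg, h⟩ := hS.lipschitz_boundary p ⟨hp, hpS⟩
    exact ⟨Φ, hΦ, hpΦ, K, g, hg, Φ.source, Φ.open_source, hpΦ, subset_rfl, h⟩

lemma IsBoxPatch.mono {L L' : ℝ≥0} {Ω : Set E3} {p q : Fin 3 → ℝ} {F : (Fin 3 → ℝ) → E3}
    (hF : IsBoxPatch L Ω p q F) (hL : L ≤ L') : IsBoxPatch L' Ω p q F where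
  lipschitzOn := hF.lipschitzOn.weaken hL
  antilipschitzOn a ha b hb := (hF.antilipschitzOn a ha b hb).trans (by gcongr)
  isOpen_image := hF.isOpen_image
  image_subset := hF.image_subset

/-- Near each point of the closure of the region, thin shells are bi-Lipschitz images of boxes. -/
lemma exists_patch_near (hM : IsC2Surface M) (hS : IsBoundedLipschitzRegion M S)
    (hn : IsUnitNormalField M S n) {p : E3} (hp : p ∈ closure S) :
    ∃ L : ℝ≥0, ∃ r > 0, ∃ R, ∃ ρ > 0, ∀ h, 0 < h → h < ρ →
      ∃ (a b : Fin 3 → ℝ) (F : (Fin 3 → ℝ) → E3), IsBoxPatch L (shell S n h) a b F ∧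
        shell S n h ∩ ball p ρ ⊆ F '' openBox a b ∧
        (∀ i, i ≠ 2 → r ≤ b i - a i ∧ b i - a i ≤ R) ∧ b 2 - a 2 = 2 * h := by
  obtain ⟨Φ, hΦ, hpΦ, K, g, hg, O, hO, hpO, hOΦ, hOS⟩ := exists_graph_chart hM hS hp
  have hp2 : Φ p 2 = 0 := (hΦ.mem_iff p hpΦ).1 (hS.closure_subset hp)
  set a₀ := Φ p 0
  set s₀ := Φ p 1 - g (Φ p 0) with hs₀
  have hcoord : ∀ i, ContinuousAt (fun x => Φ x i) p := fun i =>
    (EuclideanSpace.proj (𝕜 := ℝ) i).continuous.continuousAt.comp (Φ.continuousAt hpΦ)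
  have hgc : ContinuousAt (fun x => Φ x 1 - g (Φ x 0)) p :=
    (hcoord 1).sub (hg.continuous.continuousAt.comp (hcoord 0))
  -- The height of `p` above the graph is nonnegative because `p` is a limit of points of `S`; this
  -- keeps the second side of the box at least `r`.
  have hs₀0 : 0 ≤ s₀ := by
    by_contra! hneg
    have h1 : ∀ᶠ x in 𝓝 p, Φ x 1 - g (Φ x 0) < 0 := hgc.eventually_lt_const hneg
    obtain ⟨x, ⟨hx1, hxO⟩, hxS⟩ := mem_closure_iff_nhds.1 hp _ (inter_mem h1 (hO.mem_nhds hpO))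
    have := (hOS x ⟨hS.closure_subset (subset_closure hxS), hxO⟩).1 hxS
    exact absurd this (sub_neg.1 hx1).not_gt
  set ys : Fin 3 → ℝ := ![a₀, Φ p 1, 0] with hys
  set yc : Fin 3 → ℝ := ![a₀, s₀, 0] with hyc
  have hyeq : shear g yc = ys := by
    ext i
    fin_cases i <;> simp [shear, hyc, hys, hs₀, a₀]
  have hplane : planePoint ys = Φ p := (planePoint_eq (by simp [hys, a₀]) (by simp [hys]) hp2)
  obtain ⟨f', hf'⟩ := normalCoord_hasStrictFDerivAt hΦ hpΦ hplane (by simp [hys])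
  obtain ⟨L, s, hs, hyss, hLip, hanti, hopen⟩ := hf'.exists_isOpen_biLipschitz
  have hW : ∀ᶠ y in 𝓝 ys, y ∈ s ∧ planePoint y ∈ Φ.target ∧ Φ.symm (planePoint y) ∈ O := by
    have h0 : ∀ᶠ y in 𝓝 ys, y ∈ s := hs.mem_nhds hyss
    refine h0.and ?_
    have h1 : ∀ᶠ w in 𝓝 (planePoint ys), w ∈ Φ.target ∧ Φ.symm w ∈ O := by
      rw [hplane]
      have h2 : ∀ᶠ w in 𝓝 (Φ p), w ∈ Φ.target := Φ.open_target.mem_nhds (Φ.map_source hpΦ)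
      refine h2.and ?_
      refine (Φ.symm.continuousAt (Φ.map_source hpΦ)).eventually ?_
      rw [Φ.left_inv hpΦ]
      exact hO.mem_nhds hpO
    exact planePoint.continuous.continuousAt.eventually h1
  have hW' := ((lipschitzWith_shear hg).continuous.continuousAt (x := yc)).eventually
    (hyeq.symm ▸ hW)
  obtain ⟨r, hr, hball⟩ := Metric.eventually_nhds_iff_ball.1 hW'
  have hnear : ∀ᶠ x in 𝓝 p, x ∈ O ∧ |Φ x 0 - a₀| < r ∧ |Φ x 1 - g (Φ x 0) - s₀| < r := by
    have h0 : ∀ᶠ x in 𝓝 p, x ∈ O := hO.mem_nhds hpO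
    have h1 := Metric.tendsto_nhds.1 (hcoord 0) r hr
    have h2 := Metric.tendsto_nhds.1 hgc r hr
    exact h0.and (h1.and h2)
  obtain ⟨σ, hσ, hnear⟩ := Metric.eventually_nhds_iff_ball.1 hnear
  refine ⟨max (L * (K + 1)) ((K + 1) * L), r, hr, 2 * r, min r (σ / 2), by positivity, ?_⟩
  intro h hh hhr
  have hhr' : h < r := hhr.trans_le (min_le_left _ _)
  have hhσ : h < σ / 2 := hhr.trans_le (min_le_right _ _)
  set lo : Fin 3 → ℝ := ![a₀ - r, max 0 (s₀ - r), -h] with hlo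
  set hi : Fin 3 → ℝ := ![a₀ + r, s₀ + r, h] with hhi
  have hmem : ∀ y, y ∈ openBox lo hi ↔ (a₀ - r < y 0 ∧ y 0 < a₀ + r) ∧
      ((0 < y 1 ∧ s₀ - r < y 1) ∧ y 1 < s₀ + r) ∧ (-h < y 2 ∧ y 2 < h) := by
    intro y
    rw [mem_openBox, Fin.forall_fin_succ, Fin.forall_fin_succ, Fin.forall_fin_one]
    simp [hlo, hhi]
  have hbox : openBox lo hi ⊆ ball yc r := by
    intro y hy
    rw [hmem] at hy
    rw [mem_ball, dist_pi_lt_iff hr, Fin.forall_fin_succ, Fin.forall_fin_succ, Fin.forall_fin_one]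
    simp only [Real.dist_eq, abs_lt]
    simp [hyc]
    refine ⟨⟨?_, ?_⟩, ⟨?_, ?_⟩, ?_, ?_⟩ <;> linarith [hy.1.1, hy.1.2, hy.2.1.1.2, hy.2.1.2,
      hy.2.2.1, hy.2.2.2]
  have hboxs : shear g '' openBox lo hi ⊆ s := by
    rintro _ ⟨y, hy, rfl⟩
    exact (hball y (hbox hy)).1
  have hsub : ∀ y ∈ openBox lo hi, Φ.symm (planePoint (shear g y)) ∈ S := by
    intro y hy
    obtain ⟨-, hyt, hyO⟩ := hball y (hbox hy)
    rw [hmem] at hy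
    have hΦX := Φ.right_inv hyt
    refine (hOS _ ⟨(hΦ.mem_iff _ (hOΦ hyO)).2 (by rw [hΦX, planePoint_two]), hyO⟩).2 ?_
    rw [hΦX]
    simp [shear, hy.2.1.1.1]
  refine ⟨lo, hi, fun y => normalCoord Φ (shear g y), ⟨?_, ?_, ?_, ?_⟩, ?_, ?_, ?_⟩
  · refine LipschitzOnWith.weaken ?_ (le_max_left _ _)
    exact hLip.comp (lipschitzWith_shear hg).lipschitzOnWith (mapsTo_iff_image_subset.2 hboxs)
  · intro y hy z hz
    have h1 := (lipschitzWith_shear (K := K) (g := fun t => - g t)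
      hg.neg).dist_le_mul (shear g y) (shear g z)
    rw [shear_neg_shear, shear_neg_shear] at h1
    have h2 := hanti _ (hboxs (mem_image_of_mem _ hy)) _ (hboxs (mem_image_of_mem _ hz))
    calc dist y z ≤ _ := h1
      _ ≤ (K + 1 : ℝ≥0) * (L * dist (normalCoord Φ (shear g y)) (normalCoord Φ (shear g z))) := by
        gcongr
      _ = ((K + 1) * L : ℝ≥0) * dist (normalCoord Φ (shear g y)) (normalCoord Φ (shear g z)) := by
        push_cast; ring
      _ ≤ _ := by
        gcongr
        exact le_max_right _ _
  · have := hopen _ hboxs (isOpen_shear_image hg isOpen_openBox)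
    rwa [image_image] at this
  · rintro _ ⟨y, hy, rfl⟩
    have hyS := hsub y hy
    obtain ⟨-, hyt, hyO⟩ := hball y (hbox hy)
    rw [hmem] at hy
    have hy2 : |y 2| < h := abs_lt.2 hy.2.2
    have hsh2 : shear g y 2 = y 2 := by simp [shear]
    -- The sign of the normal may be chosen pointwise, because the interval of heights is symmetric.
    rcases eq_or_eq_neg_chartNormal hn hΦ (hOΦ hyO) hyS with h | h
    · exact ⟨_, hyS, y 2, hy2, by rw [h]; simp only [normalCoord, hsh2]⟩
    · refine ⟨_, hyS, - y 2, by rwa [abs_neg], ?_⟩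
      rw [h]
      simp only [normalCoord, hsh2, smul_neg, neg_smul, neg_neg]
  · rintro z ⟨⟨x, hxS, t, ht, rfl⟩, hz⟩
    -- The foot point is within `h < σ / 2` of the shell point, which is within `σ / 2` of `p`.
    have hxp : x ∈ ball p σ := by
      have h1 : dist x (x + t • n x) < σ / 2 := by
        rw [dist_self_add_right, norm_smul, hn.norm_eq_one x hxS, mul_one, Real.norm_eq_abs]
        exact ht.trans hhσ
      have h2 : dist (x + t • n x) p < σ / 2 := (mem_ball.1 hz).trans_le (min_le_right _ _)
      rw [mem_ball]
      linarith [dist_triangle x (x + t • n x) p]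
    obtain ⟨hxO, hx0, hx1⟩ := hnear x hxp
    have hxM : x ∈ M := hS.closure_subset (subset_closure hxS)
    have hx2 : Φ x 2 = 0 := (hΦ.mem_iff x (hOΦ hxO)).1 hxM
    have hxg := (hOS x ⟨hxM, hxO⟩).1 hxS
    rw [abs_lt] at hx0 hx1 ht
    have key : ∀ τ : ℝ, -h < τ → τ < h → τ • chartNormal Φ x = t • n x →
        x + t • n x ∈ (fun y => normalCoord Φ (shear g y)) '' openBox lo hi := by
      intro τ h1 h2 h3
      refine ⟨![Φ x 0, Φ x 1 - g (Φ x 0), τ], ?_, ?_⟩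
      · rw [hmem]
        simp only [Matrix.cons_val_zero, Matrix.cons_val_one, Matrix.cons_val]
        refine ⟨⟨?_, ?_⟩, ⟨⟨?_, ?_⟩, ?_⟩, h1, h2⟩ <;> linarith
      · have hpl : planePoint (shear g ![Φ x 0, Φ x 1 - g (Φ x 0), τ]) = Φ x :=
          planePoint_eq (by simp [shear]) (by simp [shear]) hx2
        simp only [normalCoord, hpl, Φ.left_inv (hOΦ hxO)]
        rw [← h3]
        simp [shear]
    rcases eq_or_eq_neg_chartNormal hn hΦ (hOΦ hxO) hxS with h | h
    · exact key t ht.1 ht.2 (by rw [h])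
    · exact key (-t) (by linarith) (by linarith) (by rw [h, smul_neg, neg_smul])
  · intro i hi2
    have h1 : s₀ - r ≤ max 0 (s₀ - r) := le_max_right _ _
    have h2 : max 0 (s₀ - r) ≤ s₀ := max_le hs₀0 (by linarith)
    fin_cases i
    · simp only [hlo, hhi, Fin.zero_eta, Matrix.cons_val_zero]
      constructor <;> linarith
    · simp only [hlo, hhi, Fin.mk_one, Matrix.cons_val_one, Matrix.cons_val_zero]
      constructor <;> linarith
    · exact absurd rfl hi2
  · simp only [hlo, hhi, Matrix.cons_val]
    ring

/-- Thin shells are uniformly covered by bi-Lipschitz images of boxes. -/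
theorem exists_hasBoxCover_shell (hM : IsC2Surface M) (hS : IsBoundedLipschitzRegion M S)
    (hn : IsUnitNormalField M S n) :
    ∃ L : ℝ≥0, 1 ≤ L ∧ ∃ δ, 0 < δ ∧ ∃ r, 0 < r ∧ ∃ R h₀, 0 < h₀ ∧ ∀ h, 0 < h → h < h₀ →
      HasBoxCover L δ r R h (shell S n h) := by
  have hcomp : IsCompact (closure S) := hS.isBounded.isCompact_closure
  have hloc : ∃ L : ℝ≥0, ∃ r > 0, ∃ R, ∃ δ > 0, ∀ h, 0 < h → h < δ → ∀ x ∈ closure S,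
      ∃ (a b : Fin 3 → ℝ) (F : (Fin 3 → ℝ) → E3), IsBoxPatch L (shell S n h) a b F ∧
        shell S n h ∩ ball x δ ⊆ F '' openBox a b ∧
        (∀ i, i ≠ 2 → r ≤ b i - a i ∧ b i - a i ≤ R) ∧ b 2 - a 2 = 2 * h := by
    refine hcomp.induction_on (p := fun A => ∃ L : ℝ≥0, ∃ r > 0, ∃ R, ∃ δ > 0, ∀ h, 0 < h →
      h < δ → ∀ x ∈ A, ∃ (a b : Fin 3 → ℝ) (F : (Fin 3 → ℝ) → E3),
        IsBoxPatch L (shell S n h) a b F ∧ shell S n h ∩ ball x δ ⊆ F '' openBox a b ∧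
        (∀ i, i ≠ 2 → r ≤ b i - a i ∧ b i - a i ≤ R) ∧ b 2 - a 2 = 2 * h) ?_ ?_ ?_ ?_
    · exact ⟨0, 1, one_pos, 0, 1, one_pos, fun h _ _ x hx => absurd hx (notMem_empty x)⟩
    · rintro A B hAB ⟨L, r, hr, R, δ, hδ, H⟩
      exact ⟨L, r, hr, R, δ, hδ, fun h h0 h1 x hx => H h h0 h1 x (hAB hx)⟩
    · rintro A B ⟨L, r, hr, R, δ, hδ, H⟩ ⟨L', r', hr', R', δ', hδ', H'⟩
      refine ⟨max L L', min r r', lt_min hr hr', max R R', min δ δ', lt_min hδ hδ', ?_⟩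
      rintro h h0 h1 x (hx | hx)
      · obtain ⟨a, b, F, hF, hsub, hab, hab2⟩ := H h h0 (h1.trans_le (min_le_left _ _)) x hx
        exact ⟨a, b, F, hF.mono (le_max_left _ _),
          (inter_subset_inter_right _ (ball_subset_ball (min_le_left _ _))).trans hsub,
          fun i hi => ⟨(min_le_left _ _).trans (hab i hi).1,
            (hab i hi).2.trans (le_max_left _ _)⟩, hab2⟩
      · obtain ⟨a, b, F, hF, hsub, hab, hab2⟩ := H' h h0 (h1.trans_le (min_le_right _ _)) x hx
        exact ⟨a, b, F, hF.mono (le_max_right _ _),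
          (inter_subset_inter_right _ (ball_subset_ball (min_le_right _ _))).trans hsub,
          fun i hi => ⟨(min_le_right _ _).trans (hab i hi).1,
            (hab i hi).2.trans (le_max_right _ _)⟩, hab2⟩
    · intro p hp
      obtain ⟨L, r, hr, R, ρ, hρ, H⟩ := exists_patch_near hM hS hn hp
      refine ⟨ball p (ρ / 2), mem_nhdsWithin_of_mem_nhds (ball_mem_nhds _ (by positivity)),
        L, r, hr, R, ρ / 2, by positivity, fun h h0 h1 x hx => ?_⟩
      obtain ⟨a, b, F, hF, hsub, hab⟩ := H h h0 (by linarith)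
      refine ⟨a, b, F, hF, (inter_subset_inter_right _ (ball_subset_ball' ?_)).trans hsub, hab⟩
      rw [mem_ball] at hx
      linarith
  obtain ⟨L, r, hr, R, δ, hδ, H⟩ := hloc
  obtain ⟨R', hR'⟩ := hS.isBounded.subset_closedBall (0 : E3)
  -- Patches are available around foot points `x`. A shell point is within δ/4 of its foot point, so
  -- its closed ball of radius δ/4 lies in the ball of radius δ about `x`.
  refine ⟨max 1 L, le_max_left _ _, δ / 4, by positivity, r, hr, max R (R' + δ), δ / 4,
    by positivity, fun h h0 h1 => ⟨?_, ?_⟩⟩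
  · rintro _ ⟨x, hx, t, ht, rfl⟩
    obtain ⟨a, b, F, hF, hsub, hab, hab2⟩ := H h h0 (by linarith) x (subset_closure hx)
    refine ⟨a, b, F, hF.mono (le_max_right _ _),
      (inter_subset_inter_right _ (closedBall_subset_ball' ?_)).trans hsub,
      fun i hi => ⟨(hab i hi).1, (hab i hi).2.trans (le_max_left _ _)⟩, hab2⟩
    rw [dist_self_add_left, norm_smul, hn.norm_eq_one x hx, mul_one, Real.norm_eq_abs]
    linarith
  · rintro _ ⟨x, hx, t, ht, rfl⟩
    have h2 := mem_closedBall_zero_iff.1 (hR' hx)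
    rw [mem_closedBall_zero_iff]
    refine (norm_add_le _ _).trans (le_trans ?_ (le_max_right _ _))
    rw [norm_smul, hn.norm_eq_one x hx, mul_one, Real.norm_eq_abs]
    linarith

end ShellCover

end ShellTruncation

theorem theorem2p1 (m : ℕ) (M S : Set Shell.E3) (n : Shell.E3 → Shell.E3)
    (hM : Shell.IsC2Surface M) (hS : Shell.IsBoundedLipschitzRegion M S)
    (hn : Shell.IsUnitNormalField M S n) :
    ∃ C : ℝ, 0 < C ∧ ∃ h₀ : ℝ, 0 < h₀ ∧ ∀ h : ℝ, 0 < h → h < h₀ →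
      ∀ (u : Shell.E3 → EuclideanSpace ℝ (Fin m))
        (Du : Shell.E3 → EuclideanSpace ℝ (Fin m × Fin 3)),
        Shell.IsSobolev 2 (Shell.shell S n h) u Du →
      ∀ lam : ℝ, 0 < lam →
        ∃ (v : Shell.E3 → EuclideanSpace ℝ (Fin m))
          (Dv : Shell.E3 → EuclideanSpace ℝ (Fin m × Fin 3)),
          Shell.IsSobolev ∞ (Shell.shell S n h) v Dv ∧
          eLpNorm Dv ∞ (volume.restrict (Shell.shell S n h)) ≤ ENNReal.ofReal (C * lam) ∧
          volume {x ∈ Shell.shell S n h | u x ≠ v x} ≤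
            ENNReal.ofReal (C / lam) *
              ∫⁻ x in {x ∈ Shell.shell S n h | lam < ‖Du x‖}, ‖Du x‖ₑ ∧
          ∫⁻ x in Shell.shell S n h, ‖Du x - Dv x‖ₑ ^ 2 ≤
            ENNReal.ofReal C *
              ∫⁻ x in {x ∈ Shell.shell S n h | lam < ‖Du x‖}, ‖Du x‖ₑ ^ 2 := by
  obtain ⟨L, hL, δ, hδ, r, hr, R, h₀, hh₀, hcover⟩ := exists_hasBoxCover_shell hM hS hn
  obtain ⟨C, hC, h₁, hh₁, H⟩ := exists_truncation_of_hasBoxCover m hL hδ hr R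
  exact ⟨C, hC, min h₀ h₁, lt_min hh₀ hh₁, fun h h0 h1 u Du hu lam hlam =>
    H h h0 (h1.trans_le (min_le_right _ _)) _ (hcover h h0 (h1.trans_le (min_le_left _ _))) u Du hu
      lam hlam⟩
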